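/- Theorem. An instance $I$ of List Coloring Clique Modulator consists of a finite simple graph $G$, a set $D\subseteq V(G)$ of size $k$ such that $G-D$ is a clique, and a finite list $L(v)$ of colors (natural numbers) for every $v\in V(G)$; the question is whether there is a map $\lambda$ on $V(G)$ with $\lambda(v)\in L(v)$ for all $v\in V(G)$ and $\lambda(u)\ne\lambda(v)$ for all adjacent $u,v$. The parameter is $k$. List Coloring Clique Modulator can be solved by a randomized algorithm in time ${\mathcal O}^*(2^{k\log k})$. That is, for every $\varepsilon>0$ there are a program for a random access machine with logarithmic cost that can flip fair coins, and constants $A,c\in\mathbb{N}$, such that on every instance $I$, whose encoding has bit length $|I|$, (i) for all outcomes of the coin flips, the program halts within time $A\cdot 2^{k\log_2 k}\cdot |I|^{c}$ (where $2^{0\log_2 0}=1$); (ii) if $I$ has a proper list coloring, then the program answers Yes with probability at least $1-\varepsilon$; (iii) if $I$ has no proper list coloring, then the program never answers Yes. -/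

import Mathlib

open MeasureTheory

/-! ## Randomized random access machines with logarithmic (bit) cost

Programs act on registers `reg x` and arrays `arr a` of natural numbers (a program mentions only
finitely many register names and array names) and can flip fair coins. -/

namespace RAM

/-- Binary operations: addition, truncated subtraction, multiplication, quotient, remainder
(with `a / 0 = 0` and `a % 0 = a`), and the two comparisons, with value `1` for true and `0` for
false. -/
inductive Op where
  | add | sub | mul | div | mod | lt | eq

def Op.eval : Op → ℕ → ℕ → ℕ
  | .add, a, b => a + b
  | .sub, a, b => a - b
  | .mul, a, b => a * b
  | .div, a, b => a / b
  | .mod, a, b => a % b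
  | .lt, a, b => if a < b then 1 else 0
  | .eq, a, b => if a = b then 1 else 0

/-- Bit cost of an operation; `Nat.size a` is the number of binary digits of `a`. Multiplication
and division are charged at the schoolbook rate, the other operations linearly. -/
def Op.cost : Op → ℕ → ℕ → ℕ
  | .add, a, b | .sub, a, b | .lt, a, b | .eq, a, b => 1 + a.size + b.size
  | .mul, a, b | .div, a, b | .mod, a, b => (1 + a.size) * (1 + b.size)

inductive Expr where
  /-- a constant -/
  | lit (m : ℕ)
  /-- the content of a register -/
  | reg (x : ℕ)
  /-- the content of the cell of the array `a` whose address is the value of `e` -/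
  | get (a : ℕ) (e : Expr)
  | bin (o : Op) (e₁ e₂ : Expr)

inductive Prog where
  | skip
  /-- `reg x := e` -/
  | set (x : ℕ) (e : Expr)
  /-- `arr a [i] := e` -/
  | put (a : ℕ) (i e : Expr)
  /-- `reg x :=` a fresh uniformly random bit -/
  | flip (x : ℕ)
  | seq (p q : Prog)
  /-- run `p` if the value of `e` is nonzero, and `q` otherwise -/
  | ite (e : Expr) (p q : Prog)
  /-- run `p` as long as the value of `e` is nonzero -/
  | while (e : Expr) (p : Prog)

/-- A state of the machine; `coins` holds the outcomes of the coin flips still to come. -/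
structure State where
  reg : ℕ → ℕ
  arr : ℕ → ℕ → ℕ
  coins : ℕ → Bool

def Expr.eval (s : State) : Expr → ℕ
  | .lit m => m
  | .reg x => s.reg x
  | .get a e => s.arr a (e.eval s)
  | .bin o e₁ e₂ => o.eval (e₁.eval s) (e₂.eval s)

/-- The cost of evaluating an expression: every constant, register access, array access and
operation is charged for the lengths of all numbers involved, addresses included. -/
def Expr.cost (s : State) : Expr → ℕ
  | .lit m => 1 + m.size
  | .reg x => 1 + (s.reg x).size
  | .get a e => e.cost s + (1 + (e.eval s).size + (s.arr a (e.eval s)).size)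
  | .bin o e₁ e₂ => e₁.cost s + e₂.cost s + o.cost (e₁.eval s) (e₂.eval s)

def State.setReg (s : State) (x v : ℕ) : State :=
  { s with reg := Function.update s.reg x v }

def State.setArr (s : State) (a i v : ℕ) : State :=
  { s with arr := Function.update s.arr a (Function.update (s.arr a) i v) }

/-- Write the next coin into register `x` and advance the coin sequence by one. -/
def State.flip (s : State) (x : ℕ) : State :=
  { s.setReg x (s.coins 0).toNat with coins := fun i => s.coins (i + 1) }

/-- `Exec p s t s'`: the program `p`, started in state `s`, halts in state `s'` after a run of
total cost `t`. -/
inductive Exec : Prog → State → ℕ → State → Prop where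
  | skip (s : State) : Exec .skip s 1 s
  | set (s : State) (x : ℕ) (e : Expr) :
      Exec (.set x e) s (e.cost s + (1 + (e.eval s).size)) (s.setReg x (e.eval s))
  | put (s : State) (a : ℕ) (i e : Expr) :
      Exec (.put a i e) s (i.cost s + e.cost s + (1 + (i.eval s).size + (e.eval s).size))
        (s.setArr a (i.eval s) (e.eval s))
  | flip (s : State) (x : ℕ) : Exec (.flip x) s 1 (s.flip x)
  | seq {p q : Prog} {s s' s'' : State} {t t' : ℕ} :
      Exec p s t s' → Exec q s' t' s'' → Exec (.seq p q) s (t + t') s''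
  | ite_true {e : Expr} {p q : Prog} {s s' : State} {t : ℕ} :
      e.eval s ≠ 0 → Exec p s t s' → Exec (.ite e p q) s (e.cost s + 1 + t) s'
  | ite_false {e : Expr} {p q : Prog} {s s' : State} {t : ℕ} :
      e.eval s = 0 → Exec q s t s' → Exec (.ite e p q) s (e.cost s + 1 + t) s'
  | while_true {e : Expr} {p : Prog} {s s' s'' : State} {t t' : ℕ} :
      e.eval s ≠ 0 → Exec p s t s' → Exec (.while e p) s' t' s'' →
      Exec (.while e p) s (e.cost s + 1 + t + t') s''
  | while_false {e : Expr} {p : Prog} {s : State} :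
      e.eval s = 0 → Exec (.while e p) s (e.cost s + 1) s

/-- For given coin outcomes a program has at most one halting run. -/
theorem Exec.unique {p : Prog} {s s₁ s₂ : State} {t₁ t₂ : ℕ}
    (h₁ : Exec p s t₁ s₁) (h₂ : Exec p s t₂ s₂) : t₁ = t₂ ∧ s₁ = s₂ := by
  induction h₁ generalizing t₂ s₂ with
  | skip | set | put | flip => cases h₂; exact ⟨rfl, rfl⟩
  | seq _ _ ih ih' =>
    cases h₂ with
    | seq a b => obtain ⟨rfl, rfl⟩ := ih a; obtain ⟨rfl, rfl⟩ := ih' b; exact ⟨rfl, rfl⟩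
  | ite_true h _ ih =>
    cases h₂ with
    | ite_true _ a => obtain ⟨rfl, rfl⟩ := ih a; exact ⟨rfl, rfl⟩
    | ite_false h' _ => exact absurd h' h
  | ite_false h _ ih =>
    cases h₂ with
    | ite_true h' _ => exact absurd h h'
    | ite_false _ a => obtain ⟨rfl, rfl⟩ := ih a; exact ⟨rfl, rfl⟩
  | while_true h _ _ ih ih' =>
    cases h₂ with
    | while_true _ a b => obtain ⟨rfl, rfl⟩ := ih a; obtain ⟨rfl, rfl⟩ := ih' b; exact ⟨rfl, rfl⟩
    | while_false h' => exact absurd h' h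
  | while_false h =>
    cases h₂ with
    | while_true h' _ _ => exact absurd h h'
    | while_false _ => exact ⟨rfl, rfl⟩

/-- The initial state on an input word `w` of natural numbers: `w` is stored in array `0`, its
length in register `0`, everything else is `0`; the coin flips are going to come out as `ω`. -/
def initState (w : List ℕ) (ω : ℕ → Bool) : State where
  reg := Function.update (fun _ => 0) 0 w.length
  arr := Function.update (fun _ _ => 0) 0 (fun i => w.getD i 0)
  coins := ω

/-- The program halts on input `w` with coin flips `ω`, at a total cost of at most `T`. -/
def HaltsWithin (p : Prog) (w : List ℕ) (ω : ℕ → Bool) (T : ℝ) : Prop :=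
  ∃ t s, Exec p (initState w ω) t s ∧ (t : ℝ) ≤ T

/-- The program halts on input `w` with coin flips `ω` and answers Yes, i.e. with the number `1`
in register `0`. -/
def Accepts (p : Prog) (w : List ℕ) (ω : ℕ → Bool) : Prop :=
  ∃ t s, Exec p (initState w ω) t s ∧ s.reg 0 = 1

/-- The length of an input word: the bits of its entries, and one delimiter for each entry. -/
def inputSize (w : List ℕ) : ℕ :=
  (w.map fun a => a.size + 1).sum

/-- The law of an infinite sequence of independent fair coin flips. -/
noncomputable def coinMeasure : Measure (ℕ → Bool) :=
  Measure.infinitePi fun _ => (PMF.uniformOfFintype Bool).toMeasure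

end RAM

/-! ## List Coloring Clique Modulator -/

/-- `D` is a clique modulator of `G`: deleting `D` from `G` leaves a clique. -/
def IsCliqueModulator {V : Type*} (G : SimpleGraph V) (D : Finset V) : Prop :=
  G.IsClique {v | v ∉ D}

/-- An instance: a finite graph, a clique modulator and lists of colors. Colors are natural
numbers; the set of colors allowed at `v` is given by an arbitrary enumeration `L v`. -/
structure LCCMInstance where
  n : ℕ
  G : SimpleGraph (Fin n)
  D : Finset (Fin n)
  L : Fin n → List ℕ
  isCliqueModulator : IsCliqueModulator G D

namespace LCCMInstance

/-- The parameter `k`, the size of the given modulator. -/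
def param (I : LCCMInstance) : ℕ := I.D.card

/-- There is a proper coloring that takes the color of each vertex from its list. -/
def HasProperListColoring (I : LCCMInstance) : Prop :=
  ∃ φ : I.G.Coloring ℕ, ∀ v, φ v ∈ I.L v

open Classical in
/-- The input word of an instance: the number of vertices, the rows of the adjacency matrix, the
indicator vector of the modulator, and for each vertex the length of its list and the list. -/
noncomputable def encode (I : LCCMInstance) : List ℕ :=
  [I.n]
    ++ (List.finRange I.n).flatMap
        (fun u => (List.finRange I.n).map fun v => if I.G.Adj u v then 1 else 0)
    ++ (List.finRange I.n).map (fun v => if v ∈ I.D then 1 else 0)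
    ++ (List.finRange I.n).flatMap (fun v => (I.L v).length :: I.L v)

end LCCMInstance

namespace RAM

/-! ## A program logic for total correctness with cost bounds -/

/-! The algorithm tests whether a polynomial vanishes, by evaluating an alternating sum of
determinants at a random point. Let `N` be the length of the input word. Columns of an `N × N`
matrix stand for colors (a color is replaced by a position in the input where it occurs), and the
first `n` rows stand for the vertices. A permutation `σ` assigns a row to every column; the rows of
vertices outside the modulator accept only columns of their lists, all other rows are unconstrained.
Thus `σ` gives pairwise distinct colors to the clique vertices.

The modulator is handled inside the entries. The entry `(r, c)` is a variable times a sum over all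
sets `J` of modulator vertices that could receive color `c` together with row `r`: every member has
`c` in its list and is not adjacent to the clique vertex of row `r`, if there is one, and the
members are pairwise nonadjacent. A summand carries the factor `S d * z d c` for each `d ∈ J`.
Expanding the determinant chooses `σ` and one set `J` per column. Summing over all `S` with sign
`(-1)^|S|` cancels every choice in which some modulator vertex lies in no `J`, so a surviving term
yields a proper list coloring (`exists_of_sieveSum_ne_zero`,
`SieveData.Represents.hasProperListColoring`). Conversely, for a coloring, the 0/1 point that
singles out its permutation and its assignment of the modulator gives the value `±1`
(`SieveData.Represents.exists_perm`, `exists_sieveSum_ne_zero`), so the polynomial is nonzero in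
every characteristic.

The degree is at most `N * (1 + k)`. With `b`-bit random arguments, `E * N * (N + 1) ≤ 2 ^ b` and a
prime `p ≥ 2 ^ b`, the Schwartz–Zippel lemma bounds the probability of a false zero by `1 / E`
(`coinMeasure_eval_eq_zero_le`). A nonzero value always certifies a coloring, so the error is
one-sided.

The sets `S` and `J` together cost `4 ^ k` up to a polynomial factor, and `4 ^ k ≤ 256 * k ^ k`
(`four_pow_le`). Correctness and cost of the actual program are proved together by the rules for
`Does`; the running time is then read off the loop nesting (`Prog.stepBound_le`). -/

@[simp] theorem State.setReg_reg (s : State) (x v y : ℕ) :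
    (s.setReg x v).reg y = if y = x then v else s.reg y := by
  simp [State.setReg, Function.update_apply]

@[simp] theorem State.setReg_arr (s : State) (x v : ℕ) : (s.setReg x v).arr = s.arr := rfl

@[simp] theorem State.setReg_coins (s : State) (x v : ℕ) : (s.setReg x v).coins = s.coins := rfl

@[simp] theorem State.setArr_reg (s : State) (a i v : ℕ) : (s.setArr a i v).reg = s.reg := rfl

@[simp] theorem State.setArr_coins (s : State) (a i v : ℕ) :
    (s.setArr a i v).coins = s.coins := rfl

@[simp] theorem State.setArr_arr (s : State) (a i v b j : ℕ) :
    (s.setArr a i v).arr b j = if b = a ∧ j = i then v else s.arr b j := by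
  by_cases hb : b = a
  · subst hb; simp [State.setArr, Function.update_apply]
  · simp [State.setArr, hb]

@[simp] theorem State.flip_reg (s : State) (x y : ℕ) :
    (s.flip x).reg y = if y = x then (s.coins 0).toNat else s.reg y := by
  simp [State.flip, State.setReg, Function.update_apply]

@[simp] theorem State.flip_coins (s : State) (x : ℕ) :
    (s.flip x).coins = fun i => s.coins (i + 1) := rfl

/-- All numbers stored in the state are at most `M`. -/
structure State.Bdd (M : ℕ) (s : State) : Prop where
  reg : ∀ x, s.reg x ≤ M
  arr : ∀ a i, s.arr a i ≤ M

theorem State.Bdd.setReg {M : ℕ} {s : State} (h : s.Bdd M) (x : ℕ) {v : ℕ} (hv : v ≤ M) :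
    (s.setReg x v).Bdd M := by
  refine ⟨fun y => ?_, h.arr⟩
  rw [State.setReg_reg]; split_ifs
  exacts [hv, h.reg y]

theorem State.Bdd.setArr {M : ℕ} {s : State} (h : s.Bdd M) (a i : ℕ) {v : ℕ} (hv : v ≤ M) :
    (s.setArr a i v).Bdd M := by
  refine ⟨h.reg, fun b j => ?_⟩
  rw [State.setArr_arr]; split_ifs
  exacts [hv, h.arr b j]

/-- A syntactic factor by which an expression can increase the length of the stored numbers. -/
def Expr.width : Expr → ℕ
  | .lit m => m.size
  | .reg _ => 1
  | .get _ _ => 1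
  | .bin _ e₁ e₂ => e₁.width + e₂.width + 1

/-- A syntactic cost factor of an expression. -/
def Expr.weight : Expr → ℕ
  | .lit m => 1 + m.size
  | .reg _ => 2
  | .get _ e => e.weight + (1 + e.width + 1)
  | .bin _ e₁ e₂ => e₁.weight + e₂.weight + (1 + e₁.width) * (1 + e₂.width)

/-! ### Bit lengths of values and costs of expressions -/

theorem size_add_le (a b : ℕ) : (a + b).size ≤ a.size + b.size + 1 := by
  rw [Nat.size_le]
  have ha := Nat.lt_size_self a
  have hb := Nat.lt_size_self b
  have h1 : 2 ^ a.size ≤ 2 ^ (a.size + b.size) := Nat.pow_le_pow_right (by norm_num) (by omega)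
  have h2 : 2 ^ b.size ≤ 2 ^ (a.size + b.size) := Nat.pow_le_pow_right (by norm_num) (by omega)
  rw [pow_succ]; omega

theorem size_mul_le (a b : ℕ) : (a * b).size ≤ a.size + b.size := by
  rw [Nat.size_le, pow_add]
  exact Nat.mul_lt_mul'' (Nat.lt_size_self a) (Nat.lt_size_self b)

theorem Op.size_eval_le (o : Op) (a b : ℕ) : (o.eval a b).size ≤ a.size + b.size + 1 := by
  have h01 : ∀ c : Prop, [Decidable c] → (if c then 1 else 0 : ℕ).size ≤ 1 := by
    intro c _; split_ifs <;> simp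
  cases o with
  | add => exact size_add_le a b
  | sub => exact (Nat.size_le_size (Nat.sub_le a b)).trans (by omega)
  | mul => exact (size_mul_le a b).trans (by omega)
  | div => exact (Nat.size_le_size (Nat.div_le_self a b)).trans (by omega)
  | mod => exact (Nat.size_le_size (Nat.mod_le a b)).trans (by omega)
  | lt => exact (h01 _).trans (by omega)
  | eq => exact (h01 _).trans (by omega)

theorem Op.cost_le (o : Op) (a b : ℕ) : o.cost a b ≤ (1 + a.size) * (1 + b.size) := by
  cases o <;> simp only [Op.cost] <;> nlinarith [Nat.zero_le (a.size * b.size)]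

/-- Only stored numbers are bounded by `M`; intermediate values, such as a product before its
reduction modulo `p`, may be larger. An operation at most adds the lengths of its arguments and one
more bit, so a syntactic factor suffices. -/
theorem Expr.size_eval_le {M : ℕ} {s : State} (h : s.Bdd M) (e : Expr) :
    (e.eval s).size ≤ e.width * (M.size + 1) := by
  induction e with
  | lit m => simp only [Expr.eval, Expr.width]; exact Nat.le_mul_of_pos_right _ (by omega)
  | reg x => simp only [Expr.eval, Expr.width]; have := Nat.size_le_size (h.reg x); omega
  | get a e _ =>
    simp only [Expr.eval, Expr.width]; have := Nat.size_le_size (h.arr a (e.eval s)); omega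
  | bin o e₁ e₂ h₁ h₂ =>
    simp only [Expr.eval, Expr.width]
    refine (Op.size_eval_le o _ _).trans ?_
    nlinarith

/-- The square comes from schoolbook multiplication, which is charged the product of two lengths,
each linear in `M.size + 1`. -/
theorem Expr.cost_le {M : ℕ} {s : State} (h : s.Bdd M) (e : Expr) :
    e.cost s ≤ e.weight * (M.size + 1) ^ 2 := by
  have hB : M.size + 1 ≤ (M.size + 1) ^ 2 := Nat.le_self_pow (by norm_num) _
  induction e with
  | lit m => simp only [Expr.cost, Expr.weight]; exact Nat.le_mul_of_pos_right _ (by positivity)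
  | reg x => simp only [Expr.cost, Expr.weight]; have := Nat.size_le_size (h.reg x); omega
  | get a e ih =>
    have h1 := e.size_eval_le h
    have h2 := Nat.size_le_size (h.arr a (e.eval s))
    have h3 : e.width * (M.size + 1) ≤ e.width * (M.size + 1) ^ 2 := Nat.mul_le_mul_left _ hB
    simp only [Expr.cost, Expr.weight]
    nlinarith
  | bin o e₁ e₂ ih₁ ih₂ =>
    simp only [Expr.cost, Expr.weight]
    have h1 := e₁.size_eval_le h
    have h2 := e₂.size_eval_le h
    have h3 : (1 + (e₁.eval s).size) * (1 + (e₂.eval s).size) ≤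
        ((1 + e₁.width) * (M.size + 1)) * ((1 + e₂.width) * (M.size + 1)) :=
      Nat.mul_le_mul (by nlinarith) (by nlinarith)
    have h4 := Op.cost_le o (e₁.eval s) (e₂.eval s)
    nlinarith

/-- The loop `for x < reg b do p`. -/
def forLoop (x b : ℕ) (p : Prog) : Prog :=
  .seq (.set x (.lit 0))
    (.while (.bin .lt (.reg x) (.reg b)) (.seq p (.set x (.bin .add (.reg x) (.lit 1)))))

/-- Bound on the number of weighted steps, where a loop guarded by `reg x < reg b` makes at most
`β b` rounds. -/
def Prog.stepBound (β : ℕ → ℕ) : Prog → ℕ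
  | .skip => 1
  | .set _ e => e.weight + (1 + e.width)
  | .put _ i e => i.weight + e.weight + (1 + i.width + e.width)
  | .flip _ => 1
  | .seq p q => p.stepBound β + q.stepBound β
  | .ite e p q => e.weight + 1 + (p.stepBound β + q.stepBound β)
  | .while (.bin .lt (.reg _) (.reg b)) p =>
    β b * ((Expr.bin .lt (.reg 0) (.reg 0)).weight + 1 + p.stepBound β) +
      ((Expr.bin .lt (.reg 0) (.reg 0)).weight + 1)
  -- A dummy value: `Does` has a rule only for the loops built by `forLoop`, whose guard has the
  -- preceding shape.
  | .while _ _ => 0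

def Prog.writesReg : Prog → List ℕ
  | .skip => []
  | .set x _ => [x]
  | .put _ _ _ => []
  | .flip x => [x]
  | .seq p q => p.writesReg ++ q.writesReg
  | .ite _ p q => p.writesReg ++ q.writesReg
  | .while _ p => p.writesReg

def Prog.writesArr : Prog → List ℕ
  | .skip => []
  | .set _ _ => []
  | .put a _ _ => [a]
  | .flip _ => []
  | .seq p q => p.writesArr ++ q.writesArr
  | .ite _ p q => p.writesArr ++ q.writesArr
  | .while _ p => p.writesArr

/-- The states `s` and `s'` agree on everything that `p` does not write. -/
structure Frame (p : Prog) (s s' : State) : Prop where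
  reg : ∀ x, x ∉ p.writesReg → s'.reg x = s.reg x
  arr : ∀ a, a ∉ p.writesArr → s'.arr a = s.arr a

theorem Frame.refl (p : Prog) (s : State) : Frame p s s := ⟨fun _ _ => rfl, fun _ _ => rfl⟩

theorem Frame.trans {p : Prog} {s s' s'' : State} (h : Frame p s s') (h' : Frame p s' s'') :
    Frame p s s'' :=
  ⟨fun x hx => (h'.reg x hx).trans (h.reg x hx), fun a ha => (h'.arr a ha).trans (h.arr a ha)⟩

theorem Frame.mono {p q : Prog} {s s' : State} (h : Frame p s s')
    (hr : ∀ x, x ∈ p.writesReg → x ∈ q.writesReg) (ha : ∀ x, x ∈ p.writesArr → x ∈ q.writesArr) :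
    Frame q s s' :=
  ⟨fun x hx => h.reg x fun h => hx (hr x h), fun a h' => h.arr a fun h => h' (ha a h)⟩

/-- What a program may write is computed from its syntax, so for concrete programs the preservation
of a register or an array is settled by `decide`. -/
theorem Exec.frame {p : Prog} {s s' : State} {t : ℕ} (h : Exec p s t s') : Frame p s s' := by
  induction h with
  | skip s => exact Frame.refl _ _
  | set s x e =>
    refine ⟨fun y hy => ?_, fun _ _ => rfl⟩
    simp [Prog.writesReg] at hy; simp [hy]
  | put s a i e =>
    refine ⟨fun y hy => rfl, fun b hb => ?_⟩
    simp [Prog.writesArr] at hb; funext j; simp [hb]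
  | flip s x =>
    refine ⟨fun y hy => ?_, fun _ _ => rfl⟩
    simp [Prog.writesReg] at hy; simp [hy]
  | seq _ _ h h' =>
    exact (h.mono (by simp [Prog.writesReg]; tauto) (by simp [Prog.writesArr]; tauto)).trans
      (h'.mono (by simp [Prog.writesReg]; tauto) (by simp [Prog.writesArr]; tauto))
  | ite_true _ _ h =>
    exact h.mono (by simp [Prog.writesReg]; tauto) (by simp [Prog.writesArr]; tauto)
  | ite_false _ _ h =>
    exact h.mono (by simp [Prog.writesReg]; tauto) (by simp [Prog.writesArr]; tauto)
  | while_true _ _ _ h h' =>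
    exact (h.mono (by simp [Prog.writesReg]) (by simp [Prog.writesArr])).trans h'
  | while_false _ => exact Frame.refl _ _

/-- Started in `s`, where all numbers are at most `M`, the program `p` halts within the cost bound
in a state with the property `Q`, and never stores a number above `M`. -/
def Does (M : ℕ) (β : ℕ → ℕ) (p : Prog) (s : State) (Q : State → Prop) : Prop :=
  s.Bdd M → ∃ t s', Exec p s t s' ∧ t ≤ p.stepBound β * (M.size + 1) ^ 2 ∧ s'.Bdd M ∧ Q s'

/-! ### Rules for total correctness with cost -/

variable {M : ℕ} {β : ℕ → ℕ} {p q : Prog} {s : State} {Q R : State → Prop}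

/-- Makes the bound on the current state available in a proof. This serves assignments that copy a
stored number about which nothing else is known. -/
theorem Does.of_bdd (h : s.Bdd M → Does M β p s Q) : Does M β p s Q := fun hs => h hs hs

theorem Does.mono (h : Does M β p s R) (hQ : ∀ s', Frame p s s' → R s' → Q s') :
    Does M β p s Q := by
  intro hs
  obtain ⟨t, s', he, ht, hb, hR⟩ := h hs
  exact ⟨t, s', he, ht, hb, hQ s' he.frame hR⟩

theorem Does.skip (h : Q s) : Does M β .skip s Q := fun hs =>
  ⟨_, _, .skip s, by simp [Prog.stepBound]; exact Nat.one_le_pow _ _ (by omega), hs, h⟩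

theorem Does.set {x : ℕ} {e : Expr} (hM : e.eval s ≤ M) (h : Q (s.setReg x (e.eval s))) :
    Does M β (.set x e) s Q := by
  intro hs
  refine ⟨_, _, .set s x e, ?_, hs.setReg x hM, h⟩
  have h1 := e.cost_le hs
  have h2 := e.size_eval_le hs
  have hB : M.size + 1 ≤ (M.size + 1) ^ 2 := Nat.le_self_pow (by norm_num) _
  have h3 : e.width * (M.size + 1) ≤ e.width * (M.size + 1) ^ 2 := Nat.mul_le_mul_left _ hB
  simp only [Prog.stepBound]
  nlinarith

theorem Does.put {a : ℕ} {i e : Expr} (hM : e.eval s ≤ M)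
    (h : Q (s.setArr a (i.eval s) (e.eval s))) : Does M β (.put a i e) s Q := by
  intro hs
  refine ⟨_, _, .put s a i e, ?_, hs.setArr a _ hM, h⟩
  have h1 := e.cost_le hs
  have h2 := e.size_eval_le hs
  have h1' := i.cost_le hs
  have h2' := i.size_eval_le hs
  have hB : M.size + 1 ≤ (M.size + 1) ^ 2 := Nat.le_self_pow (by norm_num) _
  have h3 : e.width * (M.size + 1) ≤ e.width * (M.size + 1) ^ 2 := Nat.mul_le_mul_left _ hB
  have h3' : i.width * (M.size + 1) ≤ i.width * (M.size + 1) ^ 2 := Nat.mul_le_mul_left _ hB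
  simp only [Prog.stepBound]
  nlinarith

theorem Does.flip {x : ℕ} (hM : 1 ≤ M) (h : Q (s.flip x)) : Does M β (.flip x) s Q := by
  intro hs
  refine ⟨_, _, .flip s x, by simp [Prog.stepBound]; exact Nat.one_le_pow _ _ (by omega),
    ⟨fun y => ?_, hs.arr⟩, h⟩
  rw [State.flip_reg]; split_ifs
  · exact (Bool.toNat_le _).trans hM
  · exact hs.reg y

theorem Does.seq (h : Does M β p s R) (h' : ∀ s', Frame p s s' → R s' → Does M β q s' Q) :
    Does M β (.seq p q) s Q := by
  intro hs
  obtain ⟨t, s', he, ht, hb, hR⟩ := h hs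
  obtain ⟨t', s'', he', ht', hb', hQ⟩ := h' s' he.frame hR hb
  refine ⟨_, _, .seq he he', ?_, hb', hQ⟩
  simp only [Prog.stepBound, add_mul]; omega

theorem Does.set_seq {x : ℕ} {e : Expr} (hM : e.eval s ≤ M)
    (h : Does M β q (s.setReg x (e.eval s)) Q) : Does M β (.seq (.set x e) q) s Q :=
  Does.seq (R := fun s' => s' = s.setReg x (e.eval s)) (.set hM rfl) fun _ _ h' => h' ▸ h

theorem Does.put_seq {a : ℕ} {i e : Expr} (hM : e.eval s ≤ M)
    (h : Does M β q (s.setArr a (i.eval s) (e.eval s)) Q) : Does M β (.seq (.put a i e) q) s Q :=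
  Does.seq (R := fun s' => s' = s.setArr a (i.eval s) (e.eval s)) (.put hM rfl)
    fun _ _ h' => h' ▸ h

theorem Does.ite {e : Expr} (h : e.eval s ≠ 0 → Does M β p s Q)
    (h' : e.eval s = 0 → Does M β q s Q) : Does M β (.ite e p q) s Q := by
  intro hs
  have h1 := e.cost_le hs
  have hB : 1 ≤ (M.size + 1) ^ 2 := Nat.one_le_pow _ _ (by omega)
  by_cases he : e.eval s = 0
  · obtain ⟨t, s', hx, ht, hb, hQ⟩ := h' he hs
    refine ⟨_, _, .ite_false he hx, ?_, hb, hQ⟩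
    simp only [Prog.stepBound, add_mul]; omega
  · obtain ⟨t, s', hx, ht, hb, hQ⟩ := h he hs
    refine ⟨_, _, .ite_true he hx, ?_, hb, hQ⟩
    simp only [Prog.stepBound, add_mul]; omega

/-- The invariant speaks about the loop head with the counter equal to its index. The body runs
before the counter is incremented, hence the `setReg` in the conclusion of `hstep`. The bound
register is not written, so its initial value is the number of rounds. -/
theorem Does.forLoop {x b : ℕ} (I : ℕ → State → Prop)
    (hx : x ∉ p.writesReg) (hb : b ∉ p.writesReg) (hxb : b ≠ x) (hβ : s.reg b ≤ β b)
    (h0 : I 0 (s.setReg x 0))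
    (hstep : ∀ j s', j < s.reg b → s'.reg x = j → Frame (forLoop x b p) s s' → I j s' →
      Does M β p s' fun s'' => I (j + 1) (s''.setReg x (j + 1)))
    (hQ : ∀ s', Frame (RAM.forLoop x b p) s s' → I (s.reg b) s' → Q s') :
    Does M β (RAM.forLoop x b p) s Q := by
  intro hs
  set g : Expr := .bin .lt (.reg x) (.reg b) with hg
  set body : Prog := .seq p (.set x (.bin .add (.reg x) (.lit 1))) with hbody
  have hwb : b ∉ (RAM.forLoop x b p).writesReg := by
    simp [RAM.forLoop, Prog.writesReg, hb, hxb]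
  have hB : 1 ≤ (M.size + 1) ^ 2 := Nat.one_le_pow _ _ (by omega)
  -- Induction on the number `m` of rounds still to be made.
  have key : ∀ m j s', j + m = s.reg b → s'.Bdd M → s'.reg x = j →
      Frame (RAM.forLoop x b p) s s' → I j s' →
      ∃ t s'', Exec (.while g body) s' t s'' ∧
        t ≤ (m * (g.weight + 1 + body.stepBound β) + (g.weight + 1)) * (M.size + 1) ^ 2 ∧
        s''.Bdd M ∧ Frame (RAM.forLoop x b p) s s'' ∧ I (s.reg b) s'' := by
    intro m
    induction m with
    | zero =>
      intro j s' hj hb' hxj hF hI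
      have hc := g.cost_le hb'
      refine ⟨_, _, .while_false ?_, ?_, hb', hF, ?_⟩
      · have := hF.reg b hwb
        have hlt : ¬ s'.reg x < s'.reg b := by omega
        simp [hg, Expr.eval, Op.eval, hlt]
      · simp only [zero_mul, zero_add, add_mul]; omega
      · rwa [← hj, add_zero]
    | succ m ih =>
      intro j s' hj hb' hxj hF hI
      obtain ⟨t, s₁, he, ht, hb₁, hI₁⟩ := hstep j s' (by omega) hxj hF hI hb'
      have hx₁ : s₁.reg x = j := (he.frame.reg x hx).trans hxj
      have hb₁b : s₁.reg b = s.reg b := (he.frame.reg b hb).trans (hF.reg b hwb)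
      have hM : (Expr.bin .add (.reg x) (.lit 1)).eval s₁ = j + 1 := by
        simp [Expr.eval, Op.eval, hx₁]
      obtain ⟨t₂, s₂, he₂, ht₂, hb₂, hs₂⟩ := (Does.set (β := β) (s := s₁) (x := x) (M := M)
        (e := .bin .add (.reg x) (.lit 1)) (Q := fun s₂ => s₂ = s₁.setReg x (j + 1))
        -- The incremented counter is at most the content of the bound register, which is already at
        -- most `M`.
        (by rw [hM]; have := hs.reg b; omega) (by rw [hM])) hb₁
      subst hs₂
      have hbd := Exec.seq he he₂
      have hF₂ : Frame (RAM.forLoop x b p) s (s₁.setReg x (j + 1)) := by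
        refine hF.trans (hbd.frame.mono ?_ ?_)
        · simp [RAM.forLoop, Prog.writesReg]; tauto
        · simp [RAM.forLoop, Prog.writesArr]
      obtain ⟨t₃, s₃, he₃, ht₃, hb₃, hF₃, hI₃⟩ :=
        ih (j + 1) _ (by omega) hb₂ (by simp) hF₂ hI₁
      refine ⟨_, _, .while_true ?_ hbd he₃, ?_, hb₃, hF₃, hI₃⟩
      · have := hF.reg b hwb
        have hlt : s'.reg x < s'.reg b := by omega
        simp [hg, Expr.eval, Op.eval, hlt]
      · have hc := g.cost_le hb'
        have : t + t₂ ≤ body.stepBound β * (M.size + 1) ^ 2 := by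
          simp only [hbody, Prog.stepBound] at ht₂ ⊢; rw [add_mul]; omega
        calc g.cost s' + 1 + (t + t₂) + t₃
            ≤ g.weight * (M.size + 1) ^ 2 + (M.size + 1) ^ 2 + body.stepBound β * (M.size + 1) ^ 2 +
              (m * (g.weight + 1 + body.stepBound β) + (g.weight + 1)) * (M.size + 1) ^ 2 := by omega
          _ = _ := by ring
  have hF0 : Frame (RAM.forLoop x b p) s (s.setReg x 0) := by
    refine ⟨fun y hy => ?_, fun _ _ => rfl⟩
    simp [RAM.forLoop, Prog.writesReg] at hy
    simp [hy]
  obtain ⟨t₁, s₁, he₁, ht₁, hb₁, hs₁⟩ := (Does.set (β := β) (s := s) (x := x) (M := M)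
    (e := .lit 0) (Q := fun s₂ => s₂ = s.setReg x 0) (by simp [Expr.eval]) rfl) hs
  subst hs₁
  obtain ⟨t, s', he, ht, hb', hF, hI⟩ := key (s.reg b) 0 _ (by omega) hb₁ (by simp) hF0 h0
  refine ⟨_, _, .seq he₁ he, ?_, hb', hQ s' hF hI⟩
  have hgw : g.weight = (Expr.bin .lt (.reg 0) (.reg 0)).weight := rfl
  have : s.reg b * (g.weight + 1 + body.stepBound β) + (g.weight + 1) ≤
      β b * (g.weight + 1 + body.stepBound β) + (g.weight + 1) := by gcongr
  have h2 := Nat.mul_le_mul_right ((M.size + 1) ^ 2) this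
  simp only [RAM.forLoop, Prog.stepBound, ← hgw] at ht₁ ⊢
  rw [add_mul]
  exact Nat.add_le_add ht₁ (ht.trans h2)

/-! ### Syntactic growth of the step bound -/

/-- The nesting depth of loops whose bound register satisfies `c`. -/
def Prog.depth (c : ℕ → Bool) : Prog → ℕ
  | .seq p q => max (p.depth c) (q.depth c)
  | .ite _ p q => max (p.depth c) (q.depth c)
  | .while (.bin .lt (.reg _) (.reg b)) p => (if c b then 1 else 0) + p.depth c
  | _ => 0

/-- Nested loops multiply and consecutive programs add. Since `X` and `Y` are at least `1`,
everything is absorbed by one monomial whose exponents are the nesting depths, times a constant that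
depends on the program alone. This separates the factor in `k` from the polynomial one. -/
theorem Prog.stepBound_le (c : ℕ → Bool) (X Y : ℕ) (hX : 1 ≤ X) (hY : 1 ≤ Y) (p : Prog) :
    p.stepBound (fun b => if c b then X else Y) ≤
      p.stepBound (fun _ => 1) * (X ^ p.depth c * Y ^ p.depth (fun b => !c b)) := by
  have hp : ∀ a b : ℕ, 1 ≤ X ^ a * Y ^ b := fun a b =>
    Nat.one_le_iff_ne_zero.mpr (by positivity)
  have hm : ∀ {a a' b b' : ℕ}, a ≤ a' → b ≤ b' → X ^ a * Y ^ b ≤ X ^ a' * Y ^ b' :=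
    fun h h' => Nat.mul_le_mul (Nat.pow_le_pow_right hX h) (Nat.pow_le_pow_right hY h')
  induction p using Prog.stepBound.induct with
  | case5 p q hp hq =>
    simp only [Prog.stepBound, Prog.depth, add_mul]
    exact Nat.add_le_add (hp.trans (Nat.mul_le_mul_left _ (hm (by simp) (by simp))))
      (hq.trans (Nat.mul_le_mul_left _ (hm (by simp) (by simp))))
  | case6 e p q ihp ihq =>
    simp only [Prog.stepBound, Prog.depth]
    rw [add_mul (e.weight + 1), add_mul (Prog.stepBound _ p)]
    exact Nat.add_le_add (Nat.le_mul_of_pos_right _ (hp _ _))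
      (Nat.add_le_add (ihp.trans (Nat.mul_le_mul_left _ (hm (by simp) (by simp))))
      (ihq.trans (Nat.mul_le_mul_left _ (hm (by simp) (by simp)))))
  | case7 x b p ih =>
    simp only [Prog.stepBound, Prog.depth]
    set w := (Expr.bin Op.lt (Expr.reg 0) (Expr.reg 0)).weight + 1
    set D := X ^ p.depth c * Y ^ p.depth (fun b => !c b)
    set D' := X ^ ((if c b then 1 else 0) + p.depth c) *
      Y ^ ((if !c b then 1 else 0) + p.depth fun b => !c b)
    have hD : (if c b then X else Y) * D = D' := by
      cases hcb : c b <;> simp [D, D', hcb, pow_add] <;> ring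
    have hD1 : 1 ≤ D := hp _ _
    have hD2 : 1 ≤ D' := hp _ _
    have h1 : w + p.stepBound (fun b => if c b then X else Y) ≤
        (w + p.stepBound fun _ => 1) * D := by nlinarith
    calc _ ≤ (if c b then X else Y) * ((w + p.stepBound fun _ => 1) * D) + w * D' :=
          Nat.add_le_add (Nat.mul_le_mul_left _ h1) (Nat.le_mul_of_pos_right _ hD2)
      _ = _ := by rw [← hD]; ring
  | case1 => exact Nat.le_mul_of_pos_right _ (hp _ _)
  | case2 => exact Nat.le_mul_of_pos_right _ (hp _ _)
  | case3 => exact Nat.le_mul_of_pos_right _ (hp _ _)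
  | case4 => exact Nat.le_mul_of_pos_right _ (hp _ _)
  | case8 _ _ h => simp [Prog.stepBound]

end RAM

/-! ## A determinant sieve for colorings -/

section Sieve

variable {ι K R : Type*} [Fintype ι] [DecidableEq ι] [Fintype K] [DecidableEq K] [CommRing R]

/-- The contribution of the set `J` to an entry of the sieve matrix. -/
def sieveTerm (t : ι → ι → ℕ) (u : ι → ι → K → ℕ) (h : K → K → ℕ) (z : K → ι → R)
    (S : K → Fin 2) (r c : ι) (J : K → Fin 2) : R :=
  (t r c : R) * ∏ d, if J d = 1 then
    (S d : ℕ) * z d c * (u r c d : R) * ∏ e, (if J e = 1 then (h d e : R) else 1) else 1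

/-- The matrix of the sieve for the set `S`. -/
def sieveMatrix (t : ι → ι → ℕ) (u : ι → ι → K → ℕ) (h : K → K → ℕ) (x : ι → ι → R)
    (z : K → ι → R) (S : K → Fin 2) : Matrix ι ι R :=
  Matrix.of fun r c => x r c * ∑ J : K → Fin 2, sieveTerm t u h z S r c J

/-- The alternating sum over all sets `S` of the determinants of the sieve matrices. -/
def sieveSum (t : ι → ι → ℕ) (u : ι → ι → K → ℕ) (h : K → K → ℕ) (x : ι → ι → R)
    (z : K → ι → R) : R :=
  ∑ S : K → Fin 2, (∏ d, if S d = 1 then (-1 : R) else 1) * (sieveMatrix t u h x z S).det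

theorem prod_sum_fin_two (f : K → Fin 2 → R) :
    ∑ S : K → Fin 2, ∏ d, f d (S d) = ∏ d, (f d 0 + f d 1) := by
  classical
  have := Finset.prod_univ_sum (fun _ : K => (Finset.univ : Finset (Fin 2))) f
  simp only [Fin.sum_univ_two, Fintype.piFinset_univ] at this
  exact this.symm

-- The set `S` enters a term only through the factors with index in `J`.
omit [Fintype ι] [DecidableEq ι] in
theorem sieveTerm_update {t : ι → ι → ℕ} {u : ι → ι → K → ℕ} {h : K → K → ℕ} {z : K → ι → R}
    {S : K → Fin 2} {r c : ι} {J : K → Fin 2} {d₀ : K} (hd : J d₀ ≠ 1) (a : Fin 2) :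
    sieveTerm t u h z (Function.update S d₀ a) r c J = sieveTerm t u h z S r c J := by
  unfold sieveTerm
  congr 1
  refine Finset.prod_congr rfl fun d _ => ?_
  by_cases hdd : d = d₀
  · subst hdd; simp [hd]
  · simp [hdd]

/-- Toggling `d₀` is a fixed-point-free involution that reverses the sign and preserves `f`. -/
theorem sum_sign_eq_zero (f : (K → Fin 2) → R) (d₀ : K)
    (hf : ∀ S a, f (Function.update S d₀ a) = f S) :
    ∑ S : K → Fin 2, (∏ d, if S d = 1 then (-1 : R) else 1) * f S = 0 := by
  refine Finset.sum_involution (fun S _ => Function.update S d₀ (S d₀ + 1)) ?_ ?_ ?_ ?_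
  · intro S _
    rw [hf, ← Finset.mul_prod_erase _ _ (Finset.mem_univ d₀),
      ← Finset.mul_prod_erase _ _ (Finset.mem_univ d₀)]
    have : ∏ d ∈ Finset.univ.erase d₀,
        (if Function.update S d₀ (S d₀ + 1) d = 1 then (-1 : R) else 1) =
        ∏ d ∈ Finset.univ.erase d₀, if S d = 1 then (-1 : R) else 1 :=
      Finset.prod_congr rfl fun d hd => by simp [Finset.ne_of_mem_erase hd]
    rw [this, Function.update_self]
    generalize S d₀ = a
    fin_cases a <;> simp
  · intro S _ _ heq
    have := congrFun heq d₀
    rw [Function.update_self] at this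
    generalize S d₀ = a at this
    fin_cases a <;> simp at this
  · simp
  · intro S _
    simp only [Function.update_self, Function.update_idem]
    have : ∀ a : Fin 2, a + 1 + 1 = a := by decide
    rw [this, Function.update_eq_self]

/-- Soundness of the sieve: after full expansion, each choice of a permutation and of one set per
column either yields the required `σ` and `g` or contributes zero to the sum over `S`. -/
theorem exists_of_sieveSum_ne_zero {t : ι → ι → ℕ} {u : ι → ι → K → ℕ} {h : K → K → ℕ}
    {x : ι → ι → R} {z : K → ι → R} (hF : sieveSum t u h x z ≠ 0) :
    ∃ (σ : Equiv.Perm ι) (g : K → ι), (∀ c, t (σ c) c ≠ 0) ∧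
      (∀ d, u (σ (g d)) (g d) d ≠ 0) ∧ ∀ d e, g d = g e → h d e ≠ 0 := by
  by_contra hcon
  refine hF ?_
  unfold sieveSum
  simp only [Matrix.det_apply, Finset.mul_sum]
  rw [Finset.sum_comm]
  refine Finset.sum_eq_zero fun σ _ => ?_
  simp only [sieveMatrix, Matrix.of_apply, Finset.prod_mul_distrib, Finset.prod_univ_sum,
    Fintype.piFinset_univ, Finset.mul_sum, Finset.smul_sum]
  -- From here on `σ` and the choice `I` of a set for every column are fixed; only `S` varies.
  rw [Finset.sum_comm]
  refine Finset.sum_eq_zero fun I _ => ?_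
  have hsuff : ∑ S : K → Fin 2, (∏ d, if S d = 1 then (-1 : R) else 1) *
      ∏ c, sieveTerm t u h z S (σ c) c (I c) = 0 := by
    by_cases ht : ∀ c, t (σ c) c ≠ 0
    swap
    · push Not at ht
      obtain ⟨c, hc⟩ := ht
      refine Finset.sum_eq_zero fun S _ => ?_
      rw [Finset.prod_eq_zero (Finset.mem_univ c) (by simp [sieveTerm, hc]), mul_zero]
    by_cases hu : ∀ c d, I c d = 1 → u (σ c) c d ≠ 0
    swap
    · push Not at hu
      obtain ⟨c, d, hI, hc⟩ := hu
      refine Finset.sum_eq_zero fun S _ => ?_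
      rw [Finset.prod_eq_zero (Finset.mem_univ c), mul_zero]
      rw [sieveTerm, Finset.prod_eq_zero (Finset.mem_univ d), mul_zero]
      simp [hI, hc]
    by_cases hh : ∀ c d e, I c d = 1 → I c e = 1 → h d e ≠ 0
    swap
    · push Not at hh
      obtain ⟨c, d, e, hI, hI', hc⟩ := hh
      refine Finset.sum_eq_zero fun S _ => ?_
      rw [Finset.prod_eq_zero (Finset.mem_univ c), mul_zero]
      rw [sieveTerm, Finset.prod_eq_zero (Finset.mem_univ d), mul_zero]
      rw [if_pos hI, Finset.prod_eq_zero (Finset.mem_univ e), mul_zero]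
      simp [hI', hc]
    -- If the chosen sets cover `K`, any selection of a covering column is a valid `g`, even when
    -- some `d` is covered several times. An uncovered `d₀` makes the terms independent of `S d₀`,
    -- and they cancel in pairs.
    by_cases hc : ∀ d, ∃ c, I c d = 1
    · choose g hg using hc
      exact (hcon ⟨σ, g, ht, fun d => hu _ _ (hg d),
        fun d e hde => hh (g d) d e (hg d) (hde ▸ hg e)⟩).elim
    · push Not at hc
      obtain ⟨d₀, hd₀⟩ := hc
      exact sum_sign_eq_zero _ d₀ fun S a =>
        Finset.prod_congr rfl fun c _ => sieveTerm_update (hd₀ c) a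
  calc _ = ∑ S : K → Fin 2, Equiv.Perm.sign σ • ((∏ c, x (σ c) c) *
        ((∏ d, if S d = 1 then (-1 : R) else 1) *
          ∏ c, sieveTerm t u h z S (σ c) c (I c))) := by
        refine Finset.sum_congr rfl fun S _ => ?_
        rw [mul_smul_comm]; congr 1; ring
    _ = 0 := by rw [← Finset.smul_sum, ← Finset.mul_sum, hsuff, mul_zero, smul_zero]

/-- Completeness of the sieve: at a suitable 0/1 point only `σ` survives in the determinant, and the
alternating sum factorizes over `K`. -/
theorem exists_sieveSum_ne_zero [Nontrivial R] {t : ι → ι → ℕ} {u : ι → ι → K → ℕ}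
    {h : K → K → ℕ} (σ : Equiv.Perm ι) (g : K → ι) (ht : ∀ c, t (σ c) c = 1)
    (hu : ∀ d, u (σ (g d)) (g d) d = 1) (hh : ∀ d e, g d = g e → h d e = 1) :
    ∃ (x : ι → ι → R) (z : K → ι → R), sieveSum t u h x z ≠ 0 := by
  refine ⟨fun r c => if r = σ c then 1 else 0, fun d c => if g d = c then 1 else 0, ?_⟩
  have hterm : ∀ (S : K → Fin 2) c J,
      sieveTerm t u h (fun d c => if g d = c then (1 : R) else 0) S (σ c) c J =
      ∏ d, if J d = 1 then ((S d : ℕ) : R) * (if g d = c then 1 else 0) else 1 := by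
    intro S c J
    unfold sieveTerm
    rw [ht, Nat.cast_one, one_mul]
    -- If `J` lies in the fibre of `g` over `c`, all weights are `1` by `hu` and `hh`; otherwise the
    -- chosen `z` makes both sides vanish.
    by_cases hJ : ∀ d, J d = 1 → g d = c
    · refine Finset.prod_congr rfl fun d _ => ?_
      split_ifs with h1 h2
      · subst h2
        rw [hu, Finset.prod_eq_one]
        · simp
        · intro e _
          split_ifs with h3
          · rw [hh d e (hJ e h3).symm]; simp
          · rfl
      · exact absurd (hJ d h1) h2
      · rfl
    · push Not at hJ
      obtain ⟨d, h1, h2⟩ := hJ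
      rw [Finset.prod_eq_zero (Finset.mem_univ d) (by simp [h1, h2]),
        Finset.prod_eq_zero (Finset.mem_univ d) (by simp [h1, h2])]
  have hdet : ∀ S : K → Fin 2, (sieveMatrix t u h (fun r c => if r = σ c then (1 : R) else 0)
      (fun d c => if g d = c then (1 : R) else 0) S).det =
      Equiv.Perm.sign σ • ∏ d, (1 + ((S d : ℕ) : R)) := by
    intro S
    rw [Matrix.det_apply, Finset.sum_eq_single σ]
    · congr 1
      simp only [sieveMatrix, Matrix.of_apply, if_true, one_mul, hterm]
      have : ∀ c, ∑ J : K → Fin 2, ∏ d, (if J d = 1 then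
          ((S d : ℕ) : R) * (if g d = c then 1 else 0) else 1) =
          ∏ d, (1 + ((S d : ℕ) : R) * (if g d = c then 1 else 0)) := by
        intro c
        rw [prod_sum_fin_two fun d j =>
          if j = 1 then ((S d : ℕ) : R) * (if g d = c then 1 else 0) else 1]
        simp
      simp only [this]
      rw [Finset.prod_comm]
      refine Finset.prod_congr rfl fun d _ => ?_
      rw [Finset.prod_eq_single (g d)]
      · simp
      · intro c _ hc; simp [hc.symm]
      · simp
    · intro τ _ hτ
      obtain ⟨c, hc⟩ : ∃ c, τ c ≠ σ c := by
        by_contra hcon; push Not at hcon; exact hτ (Equiv.ext hcon)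
      rw [Finset.prod_eq_zero (Finset.mem_univ c), smul_zero]
      simp [sieveMatrix, hc]
    · simp
  unfold sieveSum
  simp only [hdet, mul_smul_comm, ← Finset.smul_sum, ← Finset.prod_mul_distrib]
  -- Each `d` contributes `1 - (1 + 1) = -1`, so the sum is a unit in every nontrivial ring,
  -- whatever its characteristic.
  rw [prod_sum_fin_two fun d j => (if j = 1 then (-1 : R) else 1) * (1 + ((j : ℕ) : R))]
  have h1 : (1 : R) + -(1 + 1) = -1 := by ring
  have hpow : (-1 : R) ^ Fintype.card K ≠ 0 := by
    rcases neg_one_pow_eq_or R (Fintype.card K) with h | h <;> rw [h] <;> simp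
  have hp : ∏ _d : K, ((1 : R) + -(1 + 1)) = (-1) ^ Fintype.card K := by
    rw [h1, Finset.prod_const, Finset.card_univ]
  simp only [Fin.val_zero, Fin.val_one, Nat.cast_zero, Nat.cast_one, zero_ne_one, if_false, if_true,
    add_zero, mul_one, neg_mul, one_mul, hp]
  rcases Int.units_eq_one_or (Equiv.Perm.sign σ) with hs | hs <;> simpa [hs] using hpow

/-- The sum is a polynomial expression in `x` and `z` with integer coefficients, so ring
homomorphisms pass through. It is applied to the evaluation of polynomials. -/
theorem map_sieveSum {R' : Type*} [CommRing R'] (φ : R →+* R') (t : ι → ι → ℕ)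
    (u : ι → ι → K → ℕ) (h : K → K → ℕ) (x : ι → ι → R) (z : K → ι → R) :
    φ (sieveSum t u h x z) = sieveSum t u h (fun r c => φ (x r c)) (fun d c => φ (z d c)) := by
  simp only [sieveSum, map_sum, map_mul, map_prod, RingHom.map_det]
  refine Finset.sum_congr rfl fun S _ => ?_
  congr 2
  · refine funext fun d => ?_
    split_ifs <;> simp
  · ext r c
    simp only [RingHom.mapMatrix_apply, Matrix.map_apply, sieveMatrix, Matrix.of_apply, map_mul,
      map_sum, sieveTerm, map_prod, map_natCast, apply_ite φ, map_one]

-- An entry has one factor `x` and at most one factor `z` for each element of `K`; the determinant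
-- multiplies one entry per column.
open MvPolynomial in
theorem totalDegree_sieveSum_le {τ : Type*} (t : ι → ι → ℕ) (u : ι → ι → K → ℕ) (h : K → K → ℕ)
    (x : ι → ι → MvPolynomial τ R) (z : K → ι → MvPolynomial τ R)
    (hx : ∀ r c, (x r c).totalDegree ≤ 1) (hz : ∀ d c, (z d c).totalDegree ≤ 1) :
    (sieveSum t u h x z).totalDegree ≤ Fintype.card ι * (1 + Fintype.card K) := by
  have hnat : ∀ m : ℕ, (m : MvPolynomial τ R).totalDegree = 0 := fun m => by
    rw [← map_natCast (C : R →+* MvPolynomial τ R), totalDegree_C]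
  have hterm : ∀ S r c J, (sieveTerm t u h z S r c J).totalDegree ≤ Fintype.card K := by
    intro S r c J
    refine (totalDegree_mul _ _).trans ?_
    rw [hnat, zero_add]
    refine (totalDegree_finsetProd _ _).trans ?_
    rw [Fintype.card_eq_sum_ones]
    refine Finset.sum_le_sum fun d _ => ?_
    split_ifs
    · refine (totalDegree_mul _ _).trans ?_
      have h1 : (∏ e, (if J e = 1 then ((h d e : ℕ) : MvPolynomial τ R) else 1)).totalDegree = 0 := by
        refine Nat.le_zero.mp ((totalDegree_finsetProd _ _).trans ?_)
        refine (Finset.sum_eq_zero fun e _ => ?_).le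
        split_ifs
        · exact hnat _
        · exact totalDegree_one
      rw [h1, add_zero]
      refine (totalDegree_mul _ _).trans ?_
      rw [hnat, add_zero]
      refine (totalDegree_mul _ _).trans ?_
      rw [hnat, zero_add]
      exact hz d c
    · simp
  have hmat : ∀ S r c, (sieveMatrix t u h x z S r c).totalDegree ≤ 1 + Fintype.card K := by
    intro S r c
    refine (totalDegree_mul _ _).trans (Nat.add_le_add (hx r c) ?_)
    exact totalDegree_finsetSum_le fun J _ => hterm S r c J
  refine totalDegree_finsetSum_le fun S _ => ?_
  refine (totalDegree_mul _ _).trans ?_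
  have hs : (∏ d, if S d = 1 then (-1 : MvPolynomial τ R) else 1).totalDegree = 0 := by
    refine Nat.le_zero.mp ((totalDegree_finsetProd _ _).trans ?_)
    refine (Finset.sum_eq_zero fun e _ => ?_).le
    split_ifs
    · rw [totalDegree_neg, totalDegree_one]
    · exact totalDegree_one
  rw [hs, zero_add, Matrix.det_apply]
  refine totalDegree_finsetSum_le fun σ _ => ?_
  refine (totalDegree_smul_le _ _).trans ((totalDegree_finsetProd _ _).trans ?_)
  refine (Finset.sum_le_sum fun c _ => hmat S (σ c) c).trans ?_
  rw [Finset.sum_const, Finset.card_univ, smul_eq_mul]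

end Sieve

/-! ## Random evaluation of a polynomial -/

namespace RAM

/-- The number with binary digits `ω s, …, ω (s + m - 1)`, most significant digit first. -/
def bitsValue (ω : ℕ → Bool) (s : ℕ) : ℕ → ℕ
  | 0 => 0
  | m + 1 => 2 * bitsValue ω s m + (ω (s + m)).toNat

theorem bitsValue_lt (ω : ℕ → Bool) (s m : ℕ) : bitsValue ω s m < 2 ^ m := by
  induction m with
  | zero => simp [bitsValue]
  | succ m ih => rw [bitsValue, pow_succ]; have := Bool.toNat_le (ω (s + m)); omega

theorem bitsValue_inj {ω ω' : ℕ → Bool} {s m : ℕ} (h : bitsValue ω s m = bitsValue ω' s m) :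
    ∀ i < m, ω (s + i) = ω' (s + i) := by
  induction m with
  | zero => simp
  | succ m ih =>
    rw [bitsValue, bitsValue] at h
    have h1 := Bool.toNat_le (ω (s + m))
    have h2 := Bool.toNat_le (ω' (s + m))
    intro i hi
    rcases Nat.lt_succ_iff_lt_or_eq.mp hi with hi | rfl
    · exact ih (by omega) i hi
    · have h3 : (ω (s + i)).toNat = (ω' (s + i)).toNat := by omega
      revert h3; cases ω (s + i) <;> cases ω' (s + i) <;> simp

instance : IsProbabilityMeasure coinMeasure := by unfold coinMeasure; infer_instance

theorem coinMeasure_cylinder (ω₀ : ℕ → Bool) (m : ℕ) :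
    coinMeasure.real {ω | ∀ i < m, ω i = ω₀ i} = (1 / 2) ^ m := by
  have hset : {ω : ℕ → Bool | ∀ i < m, ω i = ω₀ i} =
      Set.pi (Finset.range m : Finset ℕ) fun i => {ω₀ i} := by
    ext ω; simp [Set.mem_pi]
  rw [hset, Measure.real, coinMeasure, Measure.infinitePi_pi _ fun _ _ => measurableSet_singleton _]
  simp

/-- The values of the `n` blocks determine the first `n * b` coins. Only an inequality holds,
because a prescribed value of `2 ^ b` or more leaves the event empty. -/
theorem coinMeasure_bitsValue_le (b n : ℕ) (a : Fin n → ℕ) :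
    coinMeasure.real {ω | ∀ j : Fin n, bitsValue ω (j * b) b = a j} ≤ (1 / 2) ^ (n * b) := by
  by_cases hne : ∃ ω₀ : ℕ → Bool, ∀ j : Fin n, bitsValue ω₀ (j * b) b = a j
  · obtain ⟨ω₀, h₀⟩ := hne
    rw [← coinMeasure_cylinder ω₀ (n * b)]
    refine measureReal_mono fun ω hω i hi => ?_
    have hb : 0 < b := Nat.pos_of_ne_zero (by rintro rfl; simp at hi)
    have hj : i / b < n := Nat.div_lt_of_lt_mul (by rwa [mul_comm])
    have := bitsValue_inj ((hω ⟨i / b, hj⟩).trans (h₀ ⟨i / b, hj⟩).symm) (i % b)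
      (Nat.mod_lt _ hb)
    simpa [Nat.div_add_mod'] using this
  · have : {ω : ℕ → Bool | ∀ j : Fin n, bitsValue ω (j * b) b = a j} = ∅ := by
      ext ω; simp only [Set.mem_ofPred_eq, Set.mem_empty_iff_false, iff_false]
      exact fun h => hne ⟨ω, h⟩
    rw [this]; simp

/-- Schwartz–Zippel on a grid of `2 ^ b` points in each direction, which stay distinct modulo `p`
because `2 ^ b ≤ p`. The zeros on the grid are counted, and each one is hit with probability at most
`2 ^ (-n b)`. -/
theorem coinMeasure_eval_eq_zero_le {p n b : ℕ} [Fact p.Prime] (hb : 2 ^ b ≤ p)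
    {F : MvPolynomial (Fin n) (ZMod p)} (hF : F ≠ 0) :
    coinMeasure.real {ω | MvPolynomial.eval
      (fun j : Fin n => (bitsValue ω (j * b) b : ZMod p)) F = 0} ≤ F.totalDegree / 2 ^ b := by
  classical
  have hinj : Set.InjOn (Nat.cast : ℕ → ZMod p) (Finset.range (2 ^ b) : Finset ℕ) := by
    intro x hx y hy hxy
    simp only [Finset.coe_range, Set.mem_Iio] at hx hy
    rw [ZMod.natCast_eq_natCast_iff'] at hxy
    rwa [Nat.mod_eq_of_lt (by omega), Nat.mod_eq_of_lt (by omega)] at hxy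
  set S : Finset (ZMod p) := (Finset.range (2 ^ b)).image Nat.cast with hS
  have hcard : S.card = 2 ^ b := by rw [hS, Finset.card_image_of_injOn hinj, Finset.card_range]
  set Z := (Fintype.piFinset fun _ : Fin n => S).filter fun f => MvPolynomial.eval f F = 0 with hZ
  have hsub : {ω | MvPolynomial.eval
      (fun j : Fin n => (bitsValue ω (j * b) b : ZMod p)) F = 0} ⊆
      ⋃ f ∈ Z, {ω | ∀ j : Fin n, bitsValue ω (j * b) b = (f j).val} := by
    intro ω hω
    simp only [Set.mem_iUnion]
    refine ⟨fun j => (bitsValue ω (j * b) b : ZMod p), ?_, fun j => ?_⟩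
    · rw [hZ, Finset.mem_filter, Fintype.mem_piFinset]
      refine ⟨fun j => Finset.mem_image_of_mem _ ?_, hω⟩
      exact Finset.mem_range.mpr (bitsValue_lt _ _ _)
    · rw [ZMod.val_natCast, Nat.mod_eq_of_lt ((bitsValue_lt _ _ _).trans_le hb)]
  have hsz := MvPolynomial.schwartz_zippel_totalDegree hF S
  rw [← hZ, hcard] at hsz
  have hsz' : (Z.card : ℝ) / ((2 ^ b : ℕ) : ℝ) ^ n ≤ F.totalDegree / ((2 ^ b : ℕ) : ℝ) := by
    have h := NNRat.cast_mono (K := ℝ) hsz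
    push_cast at h ⊢
    exact h
  calc _ ≤ coinMeasure.real (⋃ f ∈ Z, {ω | ∀ j : Fin n, bitsValue ω (j * b) b = (f j).val}) :=
        measureReal_mono hsub (measure_ne_top _ _)
    _ ≤ ∑ f ∈ Z, coinMeasure.real {ω | ∀ j : Fin n, bitsValue ω (j * b) b = (f j).val} :=
        measureReal_biUnion_finset_le _ _
    _ ≤ ∑ _f ∈ Z, (1 / 2 : ℝ) ^ (n * b) :=
        Finset.sum_le_sum fun f _ => coinMeasure_bitsValue_le b n _
    _ = (Z.card : ℝ) / ((2 ^ b : ℕ) : ℝ) ^ n := by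
        rw [Finset.sum_const, nsmul_eq_mul]; push_cast
        rw [div_eq_mul_inv (Z.card : ℝ), one_div, inv_pow, ← pow_mul, mul_comm n b]
    _ ≤ _ := by simpa using hsz'

/-! ## Notation for expressions -/

instance : Add Expr := ⟨.bin .add⟩
instance : Sub Expr := ⟨.bin .sub⟩
instance : Mul Expr := ⟨.bin .mul⟩
instance : Div Expr := ⟨.bin .div⟩
instance : Mod Expr := ⟨.bin .mod⟩

/-- Comparison of two expressions. -/
def Expr.less (a b : Expr) : Expr := .bin .lt a b

/-- Equality test of two expressions. -/
def Expr.same (a b : Expr) : Expr := .bin .eq a b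

@[simp] theorem Expr.eval_lit (s : State) (m : ℕ) : (Expr.lit m).eval s = m := rfl
@[simp] theorem Expr.eval_reg (s : State) (x : ℕ) : (Expr.reg x).eval s = s.reg x := rfl
@[simp] theorem Expr.eval_get (s : State) (a : ℕ) (e : Expr) :
    (Expr.get a e).eval s = s.arr a (e.eval s) := rfl
@[simp] theorem Expr.eval_add (s : State) (a b : Expr) :
    (a + b).eval s = a.eval s + b.eval s := rfl
@[simp] theorem Expr.eval_sub (s : State) (a b : Expr) :
    (a - b).eval s = a.eval s - b.eval s := rfl
@[simp] theorem Expr.eval_mul (s : State) (a b : Expr) :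
    (a * b).eval s = a.eval s * b.eval s := rfl
@[simp] theorem Expr.eval_div (s : State) (a b : Expr) :
    (a / b).eval s = a.eval s / b.eval s := rfl
@[simp] theorem Expr.eval_mod (s : State) (a b : Expr) :
    (a % b).eval s = a.eval s % b.eval s := rfl
@[simp] theorem Expr.eval_less (s : State) (a b : Expr) :
    (a.less b).eval s = if a.eval s < b.eval s then 1 else 0 := rfl
@[simp] theorem Expr.eval_same (s : State) (a b : Expr) :
    (a.same b).eval s = if a.eval s = b.eval s then 1 else 0 := rfl

theorem rowMajor_inj {N r c r' c' : ℕ} (hc : c < N) (hc' : c' < N)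
    (h : r * N + c = r' * N + c') : r = r' ∧ c = c' := by
  have hN : 0 < N := by omega
  have h1 : (r * N + c) / N = (r' * N + c') / N := by rw [h]
  have h2 : (r * N + c) % N = (r' * N + c') % N := by rw [h]
  rw [Nat.mul_comm, Nat.mul_comm r', Nat.mul_add_div hN, Nat.mul_add_div hN,
    Nat.div_eq_of_lt hc, Nat.div_eq_of_lt hc'] at h1
  rw [Nat.mul_comm, Nat.mul_comm r', Nat.mul_add_mod, Nat.mul_add_mod, Nat.mod_eq_of_lt hc,
    Nat.mod_eq_of_lt hc'] at h2
  omega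

/-! ## Determinants modulo a prime

The registers `0` and `6` hold the size `N` of the matrix and the modulus `p`; the matrix is stored
by rows in array `5`. -/

/-- The matrix stored by rows in an array. -/
def arrMatrix (p N : ℕ) (f : ℕ → ℕ) : Matrix (Fin N) (Fin N) (ZMod p) :=
  Matrix.of fun r c => (f (r * N + c) : ZMod p)

/-- Add `reg 23` times row `reg 22` to row `reg 21`. -/
def rowOp : Prog :=
  forLoop 20 0 (.put 5 (.reg 21 * .reg 0 + .reg 20)
    ((.get 5 (.reg 21 * .reg 0 + .reg 20) +
      .reg 23 * .get 5 (.reg 22 * .reg 0 + .reg 20)) % .reg 6))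

variable {M : ℕ} {β : ℕ → ℕ} {p N : ℕ}

/-- Column `j` is untouched before round `j`, so both entries read in that round are the original
ones. -/
theorem does_rowOp (hp : 0 < p) (hpM : p ≤ M) (hN : N ≤ β 0) {s : State} (a b : Fin N)
    (hab : a ≠ b) (h0 : s.reg 0 = N) (h6 : s.reg 6 = p) (h21 : s.reg 21 = a)
    (h22 : s.reg 22 = b) : Does M β rowOp s fun s' =>
      arrMatrix p N (s'.arr 5) = (arrMatrix p N (s.arr 5)).updateRow a
        (arrMatrix p N (s.arr 5) a + (s.reg 23 : ZMod p) • arrMatrix p N (s.arr 5) b) := by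
  refine Does.forLoop (fun j s' => ∀ r c : Fin N, arrMatrix p N (s'.arr 5) r c =
    if r = a ∧ (c : ℕ) < j then arrMatrix p N (s.arr 5) a c +
      (s.reg 23 : ZMod p) * arrMatrix p N (s.arr 5) b c else arrMatrix p N (s.arr 5) r c)
    (by decide) (by decide) (by decide) (by omega) (by simp) ?_ ?_
  · intro j s' hj hx hF hI
    have e0 : s'.reg 0 = N := (hF.reg 0 (by decide)).trans h0
    have e6 : s'.reg 6 = p := (hF.reg 6 (by decide)).trans h6
    have e21 : s'.reg 21 = a := (hF.reg 21 (by decide)).trans h21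
    have e22 : s'.reg 22 = b := (hF.reg 22 (by decide)).trans h22
    have e23 : s'.reg 23 = s.reg 23 := hF.reg 23 (by decide)
    rw [h0] at hj
    refine Does.put ?_ ?_
    · simp only [Expr.eval_mod, Expr.eval_reg, e6]
      exact (Nat.mod_lt _ hp).le.trans hpM
    · intro r c
      have ha := hI a ⟨j, hj⟩
      have hb := hI b ⟨j, hj⟩
      have hrc := hI r c
      simp only [arrMatrix, Matrix.of_apply, lt_irrefl, and_false, if_false] at ha hb hrc
      simp only [arrMatrix, Matrix.of_apply, State.setReg_arr, State.setArr_arr, Expr.eval_mod,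
        Expr.eval_reg, Expr.eval_add, Expr.eval_mul, Expr.eval_get, e0, e6, e21, e22, e23, hx,
        true_and]
      by_cases hcase : (r : ℕ) * N + c = a * N + j
      · obtain ⟨h1, h2⟩ := rowMajor_inj c.2 hj hcase
        have h1' : r = a := Fin.ext h1
        subst h1'
        rw [if_pos hcase, if_pos ⟨rfl, by omega⟩, ZMod.natCast_mod, Nat.cast_add, Nat.cast_mul, ha,
          hb, h2]
      · rw [if_neg hcase, hrc]
        refine if_congr ?_ rfl rfl
        constructor
        · rintro ⟨h1, h2⟩; exact ⟨h1, by omega⟩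
        · rintro ⟨rfl, h2⟩
          refine ⟨rfl, ?_⟩
          have : (c : ℕ) ≠ j := fun h => hcase (by rw [h])
          omega
  · intro s' _ hI
    rw [h0] at hI
    ext r c
    rw [hI r c]
    by_cases hr : r = a
    · subst hr; simp [Matrix.updateRow_self]
    · simp [hr]

/-- Make the diagonal entry in row `reg 18` nonzero if possible. -/
def pivotStep : Prog :=
  forLoop 19 0 (.ite (((Expr.reg 18).less (.reg 19)) *
      ((Expr.get 5 (.reg 18 * .reg 0 + .reg 18) % .reg 6).same (.lit 0)))
    (.seq (.set 21 (.reg 18)) (.seq (.set 22 (.reg 19)) (.seq (.set 23 (.lit 1)) rowOp))) .skip)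

/-- Compute an inverse of the diagonal entry in row `reg 18`. -/
def inverseStep : Prog :=
  .seq (.set 24 (.lit 0)) (forLoop 25 6
    (.ite ((((Expr.get 5 (.reg 18 * .reg 0 + .reg 18)) * .reg 25) % .reg 6).same (.lit 1))
      (.set 24 (.reg 25)) .skip))

/-- Clear the column `reg 18` below the diagonal. -/
def clearStep : Prog :=
  forLoop 19 0 (.ite ((Expr.reg 18).less (.reg 19))
    (.seq (.set 21 (.reg 19)) (.seq (.set 22 (.reg 18)) (.seq
      (.set 23 (.reg 6 - (.get 5 (.reg 19 * .reg 0 + .reg 18) * .reg 24) % .reg 6)) rowOp))) .skip)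

/-- Gaussian elimination. -/
def eliminate : Prog := forLoop 18 0 (.seq pivotStep (.seq inverseStep clearStep))

/-- The columns before `i` have only zeros below the diagonal. -/
def TriangularBelow {R : Type*} [Zero R] {N : ℕ} (A : Matrix (Fin N) (Fin N) R) (i : ℕ) : Prop :=
  ∀ r c : Fin N, (c : ℕ) < i → c < r → A r c = 0

theorem TriangularBelow.updateRow {R : Type*} [CommRing R] {A : Matrix (Fin N) (Fin N) R} {i : ℕ}
    (h : TriangularBelow A i) {a b : Fin N} (ha : i ≤ a) (hb : i ≤ b) (f : R) :
    TriangularBelow (A.updateRow a (A a + f • A b)) i := by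
  intro r c hc hcr
  by_cases hr : r = a
  · subst hr
    have h1 := h r c hc hcr
    have h2 := h b c hc (Fin.lt_def.mpr (by omega))
    simp [Matrix.updateRow_self, h1, h2]
  · rw [Matrix.updateRow_ne hr]; exact h r c hc hcr

/-- A lower row is added to the pivot row instead of being swapped with it, so the determinant keeps
its sign. A pivot that stays zero certifies that the column is zero below the diagonal. -/
theorem does_pivotStep [Fact p.Prime] (hpM : p ≤ M) (hN : N ≤ β 0) {s : State} (i : Fin N)
    (h0 : s.reg 0 = N) (h6 : s.reg 6 = p) (h18 : s.reg 18 = i)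
    (hT : TriangularBelow (arrMatrix p N (s.arr 5)) i) : Does M β pivotStep s fun s' =>
      (arrMatrix p N (s'.arr 5)).det = (arrMatrix p N (s.arr 5)).det ∧
      TriangularBelow (arrMatrix p N (s'.arr 5)) i ∧
      (arrMatrix p N (s'.arr 5) i i = 0 → ∀ r, i < r → arrMatrix p N (s'.arr 5) r i = 0) := by
  have hp : 0 < p := (Fact.out : p.Prime).pos
  refine Does.forLoop (fun j s' =>
      (arrMatrix p N (s'.arr 5)).det = (arrMatrix p N (s.arr 5)).det ∧
      TriangularBelow (arrMatrix p N (s'.arr 5)) i ∧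
      (arrMatrix p N (s'.arr 5) i i = 0 →
        ∀ r : Fin N, i < r → (r : ℕ) < j → arrMatrix p N (s'.arr 5) r i = 0))
    (by decide) (by decide) (by decide) (by omega) ⟨rfl, hT, by simp⟩ ?_ ?_
  · intro j s' hj hx hF ⟨hI1, hI2, hI3⟩
    have e0 : s'.reg 0 = N := (hF.reg 0 (by decide)).trans h0
    have e6 : s'.reg 6 = p := (hF.reg 6 (by decide)).trans h6
    have e18 : s'.reg 18 = i := (hF.reg 18 (by decide)).trans h18
    rw [h0] at hj
    have hguard : s'.arr 5 (i * N + i) % p = 0 ↔ arrMatrix p N (s'.arr 5) i i = 0 := by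
      rw [arrMatrix, Matrix.of_apply, ZMod.natCast_eq_zero_iff]
      exact (Nat.dvd_iff_mod_eq_zero ..).symm
    refine Does.ite (fun hg => ?_) (fun hg => ?_)
    · simp only [Expr.eval_mul, Expr.eval_less, Expr.eval_reg, Expr.eval_same, Expr.eval_mod,
        Expr.eval_get, Expr.eval_add, Expr.eval_lit, e0, e6, e18, hx, hguard, ne_eq, mul_eq_zero,
        ite_eq_right_iff, one_ne_zero, imp_false, not_or, not_not] at hg
      obtain ⟨hij, hz⟩ := hg
      refine Does.of_bdd fun hbd => ?_
      refine Does.set_seq (by simpa using hbd.reg 18) (Does.set_seq ?_ (Does.set_seq ?_ ?_))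
      · simpa using hbd.reg 19
      · simp only [Expr.eval_lit]; omega
      have hne : i ≠ ⟨j, hj⟩ := fun h => by rw [h] at hij; exact lt_irrefl _ hij
      refine (does_rowOp hp hpM hN i ⟨j, hj⟩ hne (by simp [e0]) (by simp [e6]) (by simp [e18])
        (by simp [hx])).mono fun s'' _ hR => ?_
      simp only [State.setReg_arr, State.setReg_reg, Expr.eval_lit, if_true, Nat.cast_one,
        Nat.reduceEqDiff, if_false] at hR ⊢
      rw [hR]
      refine ⟨?_, hI2.updateRow le_rfl hij.le _, ?_⟩
      · rw [Matrix.det_updateRow_add_smul_self _ hne, hI1]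
      · intro hz' r hir hrj
        rw [Matrix.updateRow_ne hir.ne']
        rcases Nat.lt_succ_iff_lt_or_eq.mp hrj with hrj | hrj
        · exact hI3 hz r hir hrj
        -- The old pivot was zero, so the new pivot is the entry of row `j` itself.
        · have hr : r = ⟨j, hj⟩ := Fin.ext hrj
          simpa [Matrix.updateRow_self, hz, hr] using hz'
    · simp only [Expr.eval_mul, Expr.eval_less, Expr.eval_reg, Expr.eval_same, Expr.eval_mod,
        Expr.eval_get, Expr.eval_add, Expr.eval_lit, e0, e6, e18, hx, hguard, mul_eq_zero,
        ite_eq_right_iff, one_ne_zero, imp_false] at hg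
      refine Does.skip ⟨hI1, hI2, fun hz r hir hrj => ?_⟩
      rcases Nat.lt_succ_iff_lt_or_eq.mp hrj with hrj | hrj
      · exact hI3 hz r hir hrj
      · rcases hg with hg | hg
        · exact absurd (hrj ▸ hir : (i : ℕ) < j) hg
        · exact absurd hz hg
  · rintro s' _ ⟨h1, h2, h3⟩
    exact ⟨h1, h2, fun hz r hr => h3 hz r hr (by rw [h0]; exact r.2)⟩

/-- Exhaustive search modulo `p`; this is affordable because `p` will be polynomially bounded. Once
a valid inverse has been passed, `reg 24` holds a valid one. -/
theorem does_inverseStep [Fact p.Prime] (hp : p ≤ β 6) {s : State} (i : Fin N)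
    (h0 : s.reg 0 = N) (h6 : s.reg 6 = p) (h18 : s.reg 18 = i) :
    Does M β inverseStep s fun s' => arrMatrix p N (s.arr 5) i i ≠ 0 →
      arrMatrix p N (s.arr 5) i i * (s'.reg 24 : ZMod p) = 1 := by
  have hp1 : 1 < p := (Fact.out : p.Prime).one_lt
  refine Does.set_seq (by simp) ?_
  refine Does.forLoop (fun j s' => ∀ m < j, arrMatrix p N (s.arr 5) i i * (m : ZMod p) = 1 →
      arrMatrix p N (s.arr 5) i i * (s'.reg 24 : ZMod p) = 1)
    (by decide) (by decide) (by decide) (by simp; omega) (by simp) ?_ ?_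
  · intro j s' hj hx hF hI
    have e0 : s'.reg 0 = N := (hF.reg 0 (by decide)).trans (by simp [h0])
    have e6 : s'.reg 6 = p := (hF.reg 6 (by decide)).trans (by simp [h6])
    have e18 : s'.reg 18 = i := (hF.reg 18 (by decide)).trans (by simp [h18])
    have ea : s'.arr 5 = s.arr 5 := hF.arr 5 (by decide)
    have hguard : s.arr 5 (i * N + i) * j % p = 1 ↔
        arrMatrix p N (s.arr 5) i i * (j : ZMod p) = 1 := by
      have := ZMod.natCast_eq_natCast_iff' (s.arr 5 (i * N + i) * j) 1 p
      rw [Nat.mod_eq_of_lt hp1, Nat.cast_one, Nat.cast_mul] at this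
      exact this.symm
    refine Does.ite (fun hg => ?_) (fun hg => ?_)
    · simp only [Expr.eval_mul, Expr.eval_reg, Expr.eval_same, Expr.eval_mod,
        Expr.eval_get, Expr.eval_add, Expr.eval_lit, e0, e6, e18, ea, hx, hguard, ne_eq,
        ite_eq_right_iff, one_ne_zero, imp_false, not_not] at hg
      refine Does.of_bdd fun hbd => Does.set (by simpa using hbd.reg 25) ?_
      intro m _ _
      simpa [hx] using hg
    · simp only [Expr.eval_mul, Expr.eval_reg, Expr.eval_same, Expr.eval_mod,
        Expr.eval_get, Expr.eval_add, Expr.eval_lit, e0, e6, e18, ea, hx, hguard,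
        ite_eq_right_iff, one_ne_zero, imp_false] at hg
      refine Does.skip fun m hm hm1 => ?_
      rcases Nat.lt_succ_iff_lt_or_eq.mp hm with hm | rfl
      · simpa using hI m hm hm1
      · exact absurd hm1 hg
  · intro s' _ hI hne
    refine hI ((arrMatrix p N (s.arr 5) i i)⁻¹).val ?_ ?_
    · simpa [h6] using ZMod.val_lt _
    · rw [ZMod.natCast_zmod_val, mul_inv_cancel₀ hne]

/-- With an invertible pivot the usual multiple of the pivot row clears each lower entry. With a
zero pivot the column is already clear by `hz`, and the content of `reg 24` is irrelevant. -/
theorem does_clearStep [Fact p.Prime] (hpM : p ≤ M) (hN : N ≤ β 0) {s : State} (i : Fin N)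
    (h0 : s.reg 0 = N) (h6 : s.reg 6 = p) (h18 : s.reg 18 = i)
    (hT : TriangularBelow (arrMatrix p N (s.arr 5)) i)
    (hz : arrMatrix p N (s.arr 5) i i = 0 → ∀ r, i < r → arrMatrix p N (s.arr 5) r i = 0)
    (hinv : arrMatrix p N (s.arr 5) i i ≠ 0 →
      arrMatrix p N (s.arr 5) i i * (s.reg 24 : ZMod p) = 1) : Does M β clearStep s fun s' =>
      (arrMatrix p N (s'.arr 5)).det = (arrMatrix p N (s.arr 5)).det ∧
      TriangularBelow (arrMatrix p N (s'.arr 5)) (i + 1) := by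
  have hp : 0 < p := (Fact.out : p.Prime).pos
  refine Does.forLoop (fun j s' =>
      (arrMatrix p N (s'.arr 5)).det = (arrMatrix p N (s.arr 5)).det ∧
      TriangularBelow (arrMatrix p N (s'.arr 5)) i ∧
      (∀ r : Fin N, i < r → (r : ℕ) < j → arrMatrix p N (s'.arr 5) r i = 0) ∧
      -- The pivot row and the rows not yet reached are still the original ones, so `hinv` and `hz`
      -- apply to them.
      ∀ r : Fin N, (r ≤ i ∨ j ≤ r) → arrMatrix p N (s'.arr 5) r = arrMatrix p N (s.arr 5) r)
    (by decide) (by decide) (by decide) (by omega) ⟨rfl, hT, by simp, fun _ _ => rfl⟩ ?_ ?_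
  · intro j s' hj hx hF ⟨hI1, hI2, hI3, hI4⟩
    have e0 : s'.reg 0 = N := (hF.reg 0 (by decide)).trans h0
    have e6 : s'.reg 6 = p := (hF.reg 6 (by decide)).trans h6
    have e18 : s'.reg 18 = i := (hF.reg 18 (by decide)).trans h18
    have e24 : s'.reg 24 = s.reg 24 := hF.reg 24 (by decide)
    rw [h0] at hj
    have hi : arrMatrix p N (s'.arr 5) i = arrMatrix p N (s.arr 5) i := hI4 i (.inl le_rfl)
    refine Does.ite (fun hg => ?_) (fun hg => ?_)
    · simp only [Expr.eval_less, Expr.eval_reg, e18, hx, ne_eq, ite_eq_right_iff, one_ne_zero,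
        imp_false, not_not] at hg
      refine Does.of_bdd fun hbd => ?_
      refine Does.set_seq (by simpa using hbd.reg 19) (Does.set_seq ?_ (Does.set_seq ?_ ?_))
      · simpa using hbd.reg 18
      · simp [e6]; omega
      set f := (s'.arr 5 (j * N + i) * s'.reg 24) % p with hf
      have hne : (⟨j, hj⟩ : Fin N) ≠ i := fun h => by rw [← h] at hg; exact lt_irrefl _ hg
      have hjrow : arrMatrix p N (s'.arr 5) ⟨j, hj⟩ = arrMatrix p N (s.arr 5) ⟨j, hj⟩ :=
        hI4 _ (.inr le_rfl)
      -- Since `f < p`, the truncated subtraction is exact and represents `-f`.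
      have hfac : ((p - f : ℕ) : ZMod p) =
          -(arrMatrix p N (s.arr 5) ⟨j, hj⟩ i * (s.reg 24 : ZMod p)) := by
        have hji : (s'.arr 5 (j * N + i) : ZMod p) = arrMatrix p N (s.arr 5) ⟨j, hj⟩ i :=
          congrFun hjrow i
        rw [hf, Nat.cast_sub (Nat.mod_lt _ hp).le, CharP.cast_eq_zero, zero_sub, ZMod.natCast_mod,
          Nat.cast_mul, hji, e24]
      refine (does_rowOp hp hpM hN ⟨j, hj⟩ i hne (by simp [e0]) (by simp [e6]) (by simp [hx])
        (by simp [e18])).mono fun s'' _ hR => ?_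
      simp only [State.setReg_arr, State.setReg_reg, Expr.eval_sub, Expr.eval_mod, Expr.eval_mul,
        Expr.eval_get, Expr.eval_add, Expr.eval_reg, if_true, e0, e6, e18, hx,
        Nat.reduceEqDiff, if_false, OfNat.zero_ne_ofNat] at hR ⊢
      rw [← hf, hfac] at hR
      rw [hR]
      refine ⟨?_, hI2.updateRow hg.le le_rfl _, ?_, ?_⟩
      · rw [Matrix.det_updateRow_add_smul_self _ hne, hI1]
      · intro r hir hrj
        rcases Nat.lt_succ_iff_lt_or_eq.mp hrj with hrj | hrj
        · rw [Matrix.updateRow_ne (fun h => by rw [h] at hrj; exact lt_irrefl _ hrj)]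
          exact hI3 r hir hrj
        · have hr : r = ⟨j, hj⟩ := Fin.ext hrj
          subst hr
          rw [Matrix.updateRow_self, hi, hjrow]
          simp only [Pi.add_apply, Pi.smul_apply, smul_eq_mul]
          by_cases hz0 : arrMatrix p N (s.arr 5) i i = 0
          · rw [hz hz0 _ hir, hz0]; ring
          · linear_combination (-(arrMatrix p N (s.arr 5) ⟨j, hj⟩ i)) * hinv hz0
      · intro r hr
        rw [Matrix.updateRow_ne, hI4 r (by omega)]
        rintro rfl
        rcases hr with hr | hr
        · exact absurd (Fin.le_def.mp hr) (by simp only; omega)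
        · simp only at hr; omega
    · simp only [Expr.eval_less, Expr.eval_reg, e18, hx, ite_eq_right_iff, one_ne_zero,
        imp_false] at hg
      refine Does.skip ⟨hI1, hI2, fun r hir hrj => hI3 r hir ?_, fun r hr => hI4 r (by omega)⟩
      have := Fin.lt_def.mp hir
      omega
  · rintro s' _ ⟨h1, h2, h3, -⟩
    refine ⟨h1, fun r c hc hcr => ?_⟩
    rcases Nat.lt_succ_iff_lt_or_eq.mp hc with hc | hc
    · exact h2 r c hc hcr
    · have : c = i := Fin.ext hc
      subst this
      exact h3 r hcr (by rw [h0]; exact r.2)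

theorem does_eliminate [Fact p.Prime] (hpM : p ≤ M) (hN : N ≤ β 0) (hp : p ≤ β 6) {s : State}
    (h0 : s.reg 0 = N) (h6 : s.reg 6 = p) : Does M β eliminate s fun s' =>
      (arrMatrix p N (s'.arr 5)).det = (arrMatrix p N (s.arr 5)).det ∧
      TriangularBelow (arrMatrix p N (s'.arr 5)) N := by
  refine Does.forLoop (fun i s' =>
      (arrMatrix p N (s'.arr 5)).det = (arrMatrix p N (s.arr 5)).det ∧
      TriangularBelow (arrMatrix p N (s'.arr 5)) i)
    (by decide) (by decide) (by decide) (by omega) ⟨rfl, by simp [TriangularBelow]⟩ ?_ ?_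
  · intro i s' hi hx hF ⟨hI1, hI2⟩
    have e0 : s'.reg 0 = N := (hF.reg 0 (by decide)).trans h0
    have e6 : s'.reg 6 = p := (hF.reg 6 (by decide)).trans h6
    rw [h0] at hi
    refine Does.seq (does_pivotStep hpM hN ⟨i, hi⟩ e0 e6 hx hI2) fun s₁ hF₁ ⟨h11, h12, h13⟩ => ?_
    have f0 : s₁.reg 0 = N := (hF₁.reg 0 (by decide)).trans e0
    have f6 : s₁.reg 6 = p := (hF₁.reg 6 (by decide)).trans e6
    have f18 : s₁.reg 18 = i := (hF₁.reg 18 (by decide)).trans hx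
    refine Does.seq (does_inverseStep hp ⟨i, hi⟩ f0 f6 f18) fun s₂ hF₂ h2 => ?_
    have g0 : s₂.reg 0 = N := (hF₂.reg 0 (by decide)).trans f0
    have g6 : s₂.reg 6 = p := (hF₂.reg 6 (by decide)).trans f6
    have g18 : s₂.reg 18 = i := (hF₂.reg 18 (by decide)).trans f18
    have ga : s₂.arr 5 = s₁.arr 5 := hF₂.arr 5 (by decide)
    rw [← ga] at h11 h12 h13 h2
    refine (does_clearStep hpM hN ⟨i, hi⟩ g0 g6 g18 h12 h13 h2).mono fun s₃ _ ⟨h31, h32⟩ => ?_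
    exact ⟨h31.trans (h11.trans hI1), h32⟩
  · rintro s' _ ⟨h1, h2⟩
    rw [h0] at h2
    exact ⟨h1, h2⟩

/-- Multiply `reg 26` by the determinant of the matrix, modulo the prime. -/
def mulDet : Prog :=
  .seq eliminate (forLoop 18 0
    (.set 26 ((.reg 26 * .get 5 (.reg 18 * .reg 0 + .reg 18)) % .reg 6)))

/-- Elimination preserves the determinant, which is then the product of the diagonal; a zero pivot
needs no separate case. -/
theorem does_mulDet [Fact p.Prime] (hpM : p ≤ M) (hN : N ≤ β 0) (hp : p ≤ β 6) {s : State}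
    (h0 : s.reg 0 = N) (h6 : s.reg 6 = p) : Does M β mulDet s fun s' =>
      (s'.reg 26 : ZMod p) = s.reg 26 * (arrMatrix p N (s.arr 5)).det := by
  have hp0 : 0 < p := (Fact.out : p.Prime).pos
  refine Does.seq (does_eliminate hpM hN hp h0 h6) fun s₁ hF₁ ⟨h1, h2⟩ => ?_
  have f0 : s₁.reg 0 = N := (hF₁.reg 0 (by decide)).trans h0
  have f6 : s₁.reg 6 = p := (hF₁.reg 6 (by decide)).trans h6
  have f26 : s₁.reg 26 = s.reg 26 := hF₁.reg 26 (by decide)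
  refine Does.forLoop (fun i s' => (s'.reg 26 : ZMod p) =
      s.reg 26 * ∏ j ∈ Finset.range i, (s₁.arr 5 (j * N + j) : ZMod p))
    (by decide) (by decide) (by decide) (by omega) (by simp [f26]) ?_ ?_
  · intro i s' hi hx hF hI
    have e0 : s'.reg 0 = N := (hF.reg 0 (by decide)).trans f0
    have e6 : s'.reg 6 = p := (hF.reg 6 (by decide)).trans f6
    have ea : s'.arr 5 = s₁.arr 5 := hF.arr 5 (by decide)
    refine Does.set ?_ ?_
    · simp only [Expr.eval_mod, Expr.eval_reg, e6]
      exact (Nat.mod_lt _ hp0).le.trans hpM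
    · simp only [State.setReg_reg, Expr.eval_mod, Expr.eval_mul, Expr.eval_get, Expr.eval_add,
        Expr.eval_reg, e0, e6, ea, hx, if_true, Nat.reduceEqDiff, if_false]
      rw [ZMod.natCast_mod, Nat.cast_mul, hI, Finset.prod_range_succ, mul_assoc]
  · intro s' _ hI
    rw [hI, ← h1, f0, Finset.prod_range, Matrix.det_of_isUpperTriangular]
    · rfl
    · intro r c hcr
      exact h2 r c c.2 hcr

/-! ## The evaluation of the sieve

Registers: `0` the size `N` of the matrices, `1` the number `n` of vertices, `2` the size `k` of the
modulator, `3` the number `2 ^ k`, `6` the modulus `p`. Arrays: `0` the input, `1` the vertices of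
the modulator, `2` the powers of two, `3` the lists as a matrix, `4` the random numbers. -/

/-- The contents of the memory from which the sieve is computed. -/
structure SieveData where
  N : ℕ
  n : ℕ
  k : ℕ
  p : ℕ
  w : ℕ → ℕ
  dl : ℕ → ℕ
  inl : ℕ → ℕ
  rnd : ℕ → ℕ

namespace SieveData

variable (D : SieveData)

/-- `1` if row `r` belongs to a vertex outside the modulator. -/
def isClique (r : ℕ) : ℕ :=
  (if r < D.n then 1 else 0) * (if D.w (1 + D.n * D.n + r) = 0 then 1 else 0)

/-- `1` if row `r` may receive the color `c`. -/
def rowWeight (r c : ℕ) : ℕ := 1 - D.isClique r * (1 - D.inl (r * D.N + c))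

/-- `1` if the vertex `d` of the modulator may receive the color `c` together with row `r`. -/
def shareWeight (r c d : ℕ) : ℕ :=
  D.inl (D.dl d * D.N + c) * (1 - D.isClique r * D.w (1 + r * D.n + D.dl d))

/-- `1` if the vertices `d` and `e` of the modulator are not adjacent. -/
def pairWeight (d e : ℕ) : ℕ := 1 - D.w (1 + D.dl d * D.n + D.dl e)

/-- The random number attached to an entry of the matrix. -/
def entryVar (r c : ℕ) : ℕ := D.rnd (r * D.N + c)

/-- The random number attached to a vertex of the modulator and a color. -/
def shareVar (d c : ℕ) : ℕ := D.rnd ((D.N + d) * D.N + c)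

/-- The matrix of the sieve for the set `S`. -/
def matrix (S : Fin D.k → Fin 2) : Matrix (Fin D.N) (Fin D.N) (ZMod D.p) :=
  sieveMatrix (fun r c : Fin D.N => D.rowWeight r c) (fun r c (d : Fin D.k) => D.shareWeight r c d)
    (fun d e => D.pairWeight d e) (fun r c => (D.entryVar r c : ZMod D.p))
    (fun d c => (D.shareVar d c : ZMod D.p)) S

/-- The value of the sieve. -/
def value : ZMod D.p :=
  sieveSum (fun r c : Fin D.N => D.rowWeight r c) (fun r c (d : Fin D.k) => D.shareWeight r c d)
    (fun d e => D.pairWeight d e) (fun r c => (D.entryVar r c : ZMod D.p))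
    (fun d c => (D.shareVar d c : ZMod D.p))

/-- The state `s` contains the data. -/
structure Ready (s : State) : Prop where
  r0 : s.reg 0 = D.N
  r1 : s.reg 1 = D.n
  r2 : s.reg 2 = D.k
  r3 : s.reg 3 = 2 ^ D.k
  r6 : s.reg 6 = D.p
  a0 : s.arr 0 = D.w
  a1 : s.arr 1 = D.dl
  a2 : ∀ d < D.k, s.arr 2 d = 2 ^ d
  a3 : s.arr 3 = D.inl
  a4 : s.arr 4 = D.rnd

/-- The data are small enough for the given bounds on stored numbers and on loops. -/
structure Fits (M : ℕ) (β : ℕ → ℕ) : Prop where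
  pM : D.p ≤ M
  N : D.N ≤ β 0
  k : D.k ≤ β 2
  K : 2 ^ D.k ≤ β 3
  p : D.p ≤ β 6

variable {D}

theorem Ready.frame {P : Prog} {s s' : State} (h : D.Ready s) (hF : Frame P s s')
    (hr : ∀ x ∈ [0, 1, 2, 3, 6], x ∉ P.writesReg) (ha : ∀ a ∈ [0, 1, 2, 3, 4], a ∉ P.writesArr) :
    D.Ready s' where
  r0 := (hF.reg 0 (hr _ (by simp))).trans h.r0
  r1 := (hF.reg 1 (hr _ (by simp))).trans h.r1
  r2 := (hF.reg 2 (hr _ (by simp))).trans h.r2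
  r3 := (hF.reg 3 (hr _ (by simp))).trans h.r3
  r6 := (hF.reg 6 (hr _ (by simp))).trans h.r6
  a0 := (hF.arr 0 (ha _ (by simp))).trans h.a0
  a1 := (hF.arr 1 (ha _ (by simp))).trans h.a1
  a2 := fun d hd => by rw [hF.arr 2 (ha _ (by simp))]; exact h.a2 d hd
  a3 := (hF.arr 3 (ha _ (by simp))).trans h.a3
  a4 := (hF.arr 4 (ha _ (by simp))).trans h.a4

theorem Ready.setReg {s : State} (h : D.Ready s) {x : ℕ} (v : ℕ)
    (hx : ∀ y ∈ [0, 1, 2, 3, 6], y ≠ x) : D.Ready (s.setReg x v) where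
  r0 := by rw [State.setReg_reg, if_neg (hx _ (by simp))]; exact h.r0
  r1 := by rw [State.setReg_reg, if_neg (hx _ (by simp))]; exact h.r1
  r2 := by rw [State.setReg_reg, if_neg (hx _ (by simp))]; exact h.r2
  r3 := by rw [State.setReg_reg, if_neg (hx _ (by simp))]; exact h.r3
  r6 := by rw [State.setReg_reg, if_neg (hx _ (by simp))]; exact h.r6
  a0 := h.a0
  a1 := h.a1
  a2 := h.a2
  a3 := h.a3
  a4 := h.a4

end SieveData

/-- The set with characteristic function given by the binary digits of `m`. -/
def bitsOf (k m : ℕ) : Fin k → Fin 2 := fun d => ⟨m / 2 ^ (d : ℕ) % 2, Nat.mod_lt _ (by norm_num)⟩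

theorem bitsOf_eq_one {k m : ℕ} {d : Fin k} : bitsOf k m d = 1 ↔ m / 2 ^ (d : ℕ) % 2 = 1 := by
  rw [Fin.ext_iff]; rfl

/-- Binary expansion is a bijection between the numbers below `2 ^ k` and the subsets, so the
program can loop over numbers. -/
theorem sum_bitsOf {A : Type*} [AddCommMonoid A] (k : ℕ) (f : (Fin k → Fin 2) → A) :
    ∑ m ∈ Finset.range (2 ^ k), f (bitsOf k m) = ∑ J, f J := by
  rw [Finset.sum_range, ← Equiv.sum_comp finFunctionFinEquiv.symm f]
  rfl

open SieveData

/-- The binary digit number `reg d` of `reg x`. -/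
def bitExpr (x d : ℕ) : Expr := (.reg x / .get 2 (.reg d)) % .lit 2

/-- Multiply `reg 15` by the pair weights of the vertex `reg 16` with the set `reg 13`. -/
def pairStep : Prog :=
  forLoop 17 2 (.ite (bitExpr 13 17) (.set 15 ((.reg 15 * (.lit 1 -
    .get 0 (.lit 1 + .get 1 (.reg 16) * .reg 1 + .get 1 (.reg 17)))) % .reg 6)) .skip)

/-- Multiply `reg 15` by the weights of the vertices in the set `reg 13`. -/
def shareStep : Prog :=
  forLoop 16 2 (.ite (bitExpr 13 16) (.seq (.set 15 ((.reg 15 * (bitExpr 9 16 *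
    .get 4 ((.reg 0 + .reg 16) * .reg 0 + .reg 11) *
    (.get 3 (.get 1 (.reg 16) * .reg 0 + .reg 11) *
      (.lit 1 - .reg 14 * .get 0 (.lit 1 + .reg 10 * .reg 1 + .get 1 (.reg 16)))))) % .reg 6))
    pairStep) .skip)

/-- Compute in `reg 12` the sum of the weights of all sets. -/
def sumStep : Prog :=
  .seq (.set 14 (((Expr.reg 10).less (.reg 1)) *
      (Expr.get 0 (.lit 1 + .reg 1 * .reg 1 + .reg 10)).same (.lit 0)))
    (.seq (.set 12 (.lit 0)) (forLoop 13 3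
      (.seq (.set 15 ((.lit 1 - .reg 14 * (.lit 1 - .get 3 (.reg 10 * .reg 0 + .reg 11))) %
        .reg 6)) (.seq shareStep (.set 12 ((.reg 12 + .reg 15) % .reg 6))))))

/-- Compute the matrix for the set `reg 9`. -/
def fillStep : Prog :=
  forLoop 10 0 (forLoop 11 0 (.seq sumStep (.put 5 (.reg 10 * .reg 0 + .reg 11)
    ((.get 4 (.reg 10 * .reg 0 + .reg 11) * .reg 12) % .reg 6))))

/-- Multiply `reg 26` by the sign of the set `reg 9`. -/
def signStep : Prog :=
  forLoop 16 2 (.ite (bitExpr 9 16) (.set 26 (.reg 6 - .reg 26 % .reg 6)) .skip)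

/-- Compute the value of the sieve in `reg 8`. -/
def sieveProg : Prog :=
  .seq (.set 8 (.lit 0)) (forLoop 9 3 (.seq fillStep (.seq (.set 26 (.lit 1))
    (.seq signStep (.seq mulDet (.set 8 ((.reg 8 + .reg 26) % .reg 6)))))))

variable {M : ℕ} {β : ℕ → ℕ} {D : SieveData}

theorem eval_bitExpr {s : State} (h : D.Ready s) {x y d : ℕ} (hd : s.reg y = d) (hk : d < D.k) :
    (bitExpr x y).eval s = s.reg x / 2 ^ d % 2 := by
  simp [bitExpr, hd, h.a2 d hk]

theorem does_pairStep (hf : D.Fits M β) (hp : 0 < D.p) {s : State} (h : D.Ready s) :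
    Does M β pairStep s fun s' => (s'.reg 15 : ZMod D.p) = s.reg 15 *
      ∏ e ∈ Finset.range D.k,
        if s.reg 13 / 2 ^ e % 2 = 1 then (D.pairWeight (s.reg 16) e : ZMod D.p) else 1 := by
  refine Does.forLoop (fun j s' => (s'.reg 15 : ZMod D.p) = s.reg 15 *
      ∏ e ∈ Finset.range j,
        if s.reg 13 / 2 ^ e % 2 = 1 then (D.pairWeight (s.reg 16) e : ZMod D.p) else 1)
    (by decide) (by decide) (by decide) (by rw [h.r2]; exact hf.k) (by simp) ?_ ?_
  · intro j s' hj hx hF hI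
    have h' := h.frame hF (by decide) (by decide)
    have e13 : s'.reg 13 = s.reg 13 := hF.reg 13 (by decide)
    have e16 : s'.reg 16 = s.reg 16 := hF.reg 16 (by decide)
    rw [h.r2] at hj
    have hbit := eval_bitExpr (x := 13) h' hx hj
    rw [e13] at hbit
    refine Does.ite (fun hg => ?_) (fun hg => ?_)
    · rw [hbit] at hg
      have hg1 : s.reg 13 / 2 ^ j % 2 = 1 := by omega
      refine Does.set ?_ ?_
      · simp only [Expr.eval_mod, Expr.eval_reg, h'.r6]
        exact (Nat.mod_lt _ hp).le.trans hf.pM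
      · simp only [State.setReg_reg, Expr.eval_mod, Expr.eval_mul, Expr.eval_sub, Expr.eval_lit,
          Expr.eval_get, Expr.eval_add, Expr.eval_reg, h'.r6, h'.r1, h'.a0, h'.a1, hx, e16,
          if_true, Nat.reduceEqDiff, if_false]
        rw [ZMod.natCast_mod, Nat.cast_mul, hI, Finset.prod_range_succ, if_pos hg1, mul_assoc]
        rfl
    · rw [hbit] at hg
      refine Does.skip ?_
      simp only [State.setReg_reg, Nat.reduceEqDiff, if_false]
      rw [hI, Finset.prod_range_succ, if_neg (by omega), mul_one]
  · intro s' _ hI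
    rw [hI, h.r2]

/-- The weight of a set in an entry of the matrix, in terms of natural numbers. -/
def natTerm (D : SieveData) (S r c J d : ℕ) : ZMod D.p :=
  if J / 2 ^ d % 2 = 1 then
    ((S / 2 ^ d % 2 : ℕ) : ZMod D.p) * (D.shareVar d c : ZMod D.p) *
      (D.shareWeight r c d : ZMod D.p) *
      ∏ e ∈ Finset.range D.k, (if J / 2 ^ e % 2 = 1 then (D.pairWeight d e : ZMod D.p) else 1)
  else 1

theorem does_shareStep (hf : D.Fits M β) (hp : 0 < D.p) {s : State} (h : D.Ready s)
    (h14 : s.reg 14 = D.isClique (s.reg 10)) :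
    Does M β shareStep s fun s' => (s'.reg 15 : ZMod D.p) = s.reg 15 *
      ∏ d ∈ Finset.range D.k, natTerm D (s.reg 9) (s.reg 10) (s.reg 11) (s.reg 13) d := by
  refine Does.forLoop (fun j s' => (s'.reg 15 : ZMod D.p) = s.reg 15 *
      ∏ d ∈ Finset.range j, natTerm D (s.reg 9) (s.reg 10) (s.reg 11) (s.reg 13) d)
    (by decide) (by decide) (by decide) (by rw [h.r2]; exact hf.k) (by simp) ?_ ?_
  · intro j s' hj hx hF hI
    have h' := h.frame hF (by decide) (by decide)
    have e9 : s'.reg 9 = s.reg 9 := hF.reg 9 (by decide)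
    have e10 : s'.reg 10 = s.reg 10 := hF.reg 10 (by decide)
    have e11 : s'.reg 11 = s.reg 11 := hF.reg 11 (by decide)
    have e13 : s'.reg 13 = s.reg 13 := hF.reg 13 (by decide)
    have e14 : s'.reg 14 = s.reg 14 := hF.reg 14 (by decide)
    rw [h.r2] at hj
    have hbit := eval_bitExpr (x := 13) h' hx hj
    have hbit' := eval_bitExpr (x := 9) h' hx hj
    rw [e13] at hbit
    rw [e9] at hbit'
    refine Does.ite (fun hg => ?_) (fun hg => ?_)
    · rw [hbit] at hg
      have hg1 : s.reg 13 / 2 ^ j % 2 = 1 := by omega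
      refine Does.set_seq ?_ ?_
      · simp only [Expr.eval_mod, Expr.eval_reg, h'.r6]
        exact (Nat.mod_lt _ hp).le.trans hf.pM
      · refine (does_pairStep hf hp (h'.setReg _ (by decide))).mono fun s'' _ hs'' => ?_
        simp only [State.setReg_reg, Expr.eval_mod, Expr.eval_mul, Expr.eval_sub, Expr.eval_lit,
          Expr.eval_get, Expr.eval_add, Expr.eval_reg, h'.r0, h'.r6, h'.r1, h'.a0, h'.a1, h'.a3,
          h'.a4, hx, e10, e11, e13, e14, h14, hbit', if_true, Nat.reduceEqDiff, if_false]
          at hs'' ⊢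
        rw [hs'', ZMod.natCast_mod, Nat.cast_mul, hI, Finset.prod_range_succ, mul_assoc, mul_assoc]
        congr 2
        rw [natTerm, if_pos hg1, ← Nat.cast_mul, ← Nat.cast_mul]
        rfl
    · rw [hbit] at hg
      refine Does.skip ?_
      simp only [State.setReg_reg, Nat.reduceEqDiff, if_false]
      rw [hI, Finset.prod_range_succ, natTerm, if_neg (by omega), mul_one]
  · intro s' _ hI
    rw [hI, h.r2]

theorem natTerm_prod (S J : ℕ) (r c : Fin D.N) :
    (D.rowWeight r c : ZMod D.p) * ∏ d ∈ Finset.range D.k, natTerm D S r c J d =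
    sieveTerm (fun r c : Fin D.N => D.rowWeight r c)
      (fun r c (d : Fin D.k) => D.shareWeight r c d) (fun d e => D.pairWeight d e)
      (fun d c => (D.shareVar d c : ZMod D.p)) (bitsOf D.k S) r c (bitsOf D.k J) := by
  simp only [sieveTerm, natTerm, Finset.prod_range, bitsOf_eq_one]
  rfl

/-- A direct sum over all `2 ^ k` sets `J`. As it is recomputed for every `S`, it is the source of
the factor `4 ^ k`. -/
theorem does_sumStep (hf : D.Fits M β) (hp : 0 < D.p) (hM : 1 ≤ M) {s : State} (h : D.Ready s)
    (r c : Fin D.N) (h10 : s.reg 10 = r) (h11 : s.reg 11 = c) :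
    Does M β sumStep s fun s' => (s'.reg 12 : ZMod D.p) = ∑ J, sieveTerm
      (fun r c : Fin D.N => D.rowWeight r c)
      (fun r c (d : Fin D.k) => D.shareWeight r c d) (fun d e => D.pairWeight d e)
      (fun d c => (D.shareVar d c : ZMod D.p)) (bitsOf D.k (s.reg 9)) r c J := by
  have hcl : D.isClique r ≤ 1 := by
    unfold isClique; split_ifs <;> simp
  have hev : (((Expr.reg 10).less (.reg 1)) *
      (Expr.get 0 (.lit 1 + .reg 1 * .reg 1 + .reg 10)).same (.lit 0)).eval s = D.isClique r := by
    simp [h10, h.r1, h.a0, isClique]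
  refine Does.set_seq (by rw [hev]; omega) ?_
  rw [hev]
  refine Does.set_seq (by simp) ?_
  have h1 : D.Ready ((s.setReg 14 (D.isClique r)).setReg 12 0) :=
    (h.setReg _ (by decide)).setReg _ (by decide)
  simp only [Expr.eval_lit]
  set s₀ := (s.setReg 14 (D.isClique r)).setReg 12 0 with hs₀
  refine Does.forLoop (fun j s' => (s'.reg 12 : ZMod D.p) = ∑ J ∈ Finset.range j,
      (D.rowWeight r c : ZMod D.p) * ∏ d ∈ Finset.range D.k, natTerm D (s.reg 9) r c J d)
    (by decide) (by decide) (by decide) (by rw [h1.r3]; exact hf.K) (by simp [hs₀]) ?_ ?_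
  · intro j s' hj hx hF hI
    have h' := h1.frame hF (by decide) (by decide)
    have e9 : s'.reg 9 = s.reg 9 := (hF.reg 9 (by decide)).trans (by simp [hs₀])
    have e10 : s'.reg 10 = r := (hF.reg 10 (by decide)).trans (by simp [hs₀, h10])
    have e11 : s'.reg 11 = c := (hF.reg 11 (by decide)).trans (by simp [hs₀, h11])
    have e14 : s'.reg 14 = D.isClique r := (hF.reg 14 (by decide)).trans (by simp [hs₀])
    refine Does.set_seq ?_ ?_
    · simp only [Expr.eval_mod, Expr.eval_reg, h'.r6]
      exact (Nat.mod_lt _ hp).le.trans hf.pM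
    refine Does.seq (does_shareStep hf hp (h'.setReg _ (by decide)) (by simp [e10, e14])) ?_
    intro s₂ hF₂ h₂
    have h2 := (h'.setReg _ (by decide)).frame hF₂ (by decide) (by decide)
    have g12 : s₂.reg 12 = s'.reg 12 := (hF₂.reg 12 (by decide)).trans (by simp)
    refine Does.set ?_ ?_
    · simp only [Expr.eval_mod, Expr.eval_reg, h2.r6]
      exact (Nat.mod_lt _ hp).le.trans hf.pM
    · simp only [State.setReg_reg, Expr.eval_mod, Expr.eval_mul, Expr.eval_sub, Expr.eval_lit,
        Expr.eval_get, Expr.eval_add, Expr.eval_reg, h'.r0, h'.r6, h2.r6, h'.a3, hx,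
        e9, e10, e11, e14, if_true, Nat.reduceEqDiff, if_false] at h₂ ⊢
      rw [ZMod.natCast_mod, Nat.cast_add, g12, hI, h₂, ZMod.natCast_mod, Finset.sum_range_succ]
      rfl
  · intro s' _ hI
    rw [hI, h1.r3, ← sum_bitsOf]
    exact Finset.sum_congr rfl fun J _ => natTerm_prod _ _ _ _

theorem does_fillStep (hf : D.Fits M β) (hp : 0 < D.p) (hM : 1 ≤ M) {s : State}
    (h : D.Ready s) : Does M β fillStep s fun s' =>
      arrMatrix D.p D.N (s'.arr 5) = D.matrix (bitsOf D.k (s.reg 9)) := by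
  refine Does.forLoop (fun j s' => ∀ r c : Fin D.N, (r : ℕ) < j →
      arrMatrix D.p D.N (s'.arr 5) r c = D.matrix (bitsOf D.k (s.reg 9)) r c)
    (by decide) (by decide) (by decide) (by rw [h.r0]; exact hf.N) (by simp) ?_ ?_
  · intro j s' hj hx hF hI
    have h' := h.frame hF (by decide) (by decide)
    have e9 : s'.reg 9 = s.reg 9 := hF.reg 9 (by decide)
    rw [h.r0] at hj
    -- Rows before `j` are complete, and row `j` is filled up to column `i`.
    refine Does.forLoop (fun i s'' => ∀ r c : Fin D.N, ((r : ℕ) < j ∨ (r : ℕ) = j ∧ (c : ℕ) < i) →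
      arrMatrix D.p D.N (s''.arr 5) r c = D.matrix (bitsOf D.k (s.reg 9)) r c)
      (by decide) (by decide) (by decide) (by rw [h'.r0]; exact hf.N) ?_ ?_ ?_
    · intro r c hrc
      exact hI r c (by omega)
    · intro i s₁ hi hx₁ hF₁ hI₁
      have h₁ := h'.frame hF₁ (by decide) (by decide)
      have f9 : s₁.reg 9 = s.reg 9 := (hF₁.reg 9 (by decide)).trans e9
      have f10 : s₁.reg 10 = j := (hF₁.reg 10 (by decide)).trans hx
      rw [h'.r0] at hi
      refine Does.seq (does_sumStep hf hp hM h₁ ⟨j, hj⟩ ⟨i, hi⟩ f10 hx₁) fun s₂ hF₂ hs₂ => ?_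
      have h₂ := h₁.frame hF₂ (by decide) (by decide)
      have g10 : s₂.reg 10 = j := (hF₂.reg 10 (by decide)).trans f10
      have g11 : s₂.reg 11 = i := (hF₂.reg 11 (by decide)).trans hx₁
      have ga : s₂.arr 5 = s₁.arr 5 := hF₂.arr 5 (by decide)
      refine Does.put ?_ ?_
      · simp only [Expr.eval_mod, Expr.eval_reg, h₂.r6]
        exact (Nat.mod_lt _ hp).le.trans hf.pM
      · intro r c hrc
        simp only [arrMatrix, Matrix.of_apply, State.setReg_arr, State.setArr_arr, Expr.eval_mod,
          Expr.eval_reg, Expr.eval_add, Expr.eval_mul, Expr.eval_get, h₂.r0, h₂.r6, h₂.a4, g10, g11,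
          true_and, ga]
        by_cases hcase : (r : ℕ) * D.N + c = j * D.N + i
        · obtain ⟨h1, h2⟩ := rowMajor_inj c.2 hi hcase
          have h1' : r = ⟨j, hj⟩ := Fin.ext h1
          have h2' : c = ⟨i, hi⟩ := Fin.ext h2
          subst h1' h2'
          rw [if_pos rfl, ZMod.natCast_mod, Nat.cast_mul, hs₂, f9]
          rfl
        · rw [if_neg hcase]
          refine hI₁ r c ?_
          have : ¬ ((r : ℕ) = j ∧ (c : ℕ) = i) := fun ⟨h1, h2⟩ => hcase (by rw [h1, h2])
          omega
    · intro s₁ _ hI₁ r c hr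
      refine hI₁ r c ?_
      have := c.2
      rw [h'.r0]
      omega
  · intro s' _ hI
    ext r c
    exact hI r c (by rw [h.r0]; exact r.2)

theorem does_signStep (hf : D.Fits M β) (hp : 0 < D.p) {s : State} (h : D.Ready s) :
    Does M β signStep s fun s' => (s'.reg 26 : ZMod D.p) = s.reg 26 *
      ∏ d, if bitsOf D.k (s.reg 9) d = 1 then (-1 : ZMod D.p) else 1 := by
  refine Does.forLoop (fun j s' => (s'.reg 26 : ZMod D.p) = s.reg 26 *
      ∏ d ∈ Finset.range j, if s.reg 9 / 2 ^ d % 2 = 1 then (-1 : ZMod D.p) else 1)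
    (by decide) (by decide) (by decide) (by rw [h.r2]; exact hf.k) (by simp) ?_ ?_
  · intro j s' hj hx hF hI
    have h' := h.frame hF (by decide) (by decide)
    have e9 : s'.reg 9 = s.reg 9 := hF.reg 9 (by decide)
    rw [h.r2] at hj
    have hbit := eval_bitExpr (x := 9) h' hx hj
    rw [e9] at hbit
    refine Does.ite (fun hg => ?_) (fun hg => ?_)
    · rw [hbit] at hg
      refine Does.set ?_ ?_
      · simp only [Expr.eval_sub, Expr.eval_reg, h'.r6]
        exact (Nat.sub_le _ _).trans hf.pM
      · simp only [State.setReg_reg, Expr.eval_mod, Expr.eval_sub, Expr.eval_reg, h'.r6,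
          if_true, Nat.reduceEqDiff, if_false]
        -- Reducing before subtracting from `p` keeps the truncated subtraction exact.
        rw [Nat.cast_sub (Nat.mod_lt _ hp).le, CharP.cast_eq_zero, zero_sub, ZMod.natCast_mod, hI,
          Finset.prod_range_succ, if_pos (by omega)]
        ring
    · rw [hbit] at hg
      refine Does.skip ?_
      simp only [State.setReg_reg, Nat.reduceEqDiff, if_false]
      rw [hI, Finset.prod_range_succ, if_neg (by omega), mul_one]
  · intro s' _ hI
    rw [hI, h.r2, Finset.prod_range]
    simp only [bitsOf_eq_one]

/-- The bound below `D.p` is recorded so that the stored number vanishes exactly when its residue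
does. -/
theorem does_sieveProg (hf : D.Fits M β) (hp : D.p.Prime) (hM : 1 ≤ M) {s : State}
    (h : D.Ready s) : Does M β sieveProg s fun s' =>
      s'.reg 8 < D.p ∧ (s'.reg 8 : ZMod D.p) = D.value := by
  have : Fact D.p.Prime := ⟨hp⟩
  refine Does.set_seq (by simp) ?_
  have h1 : D.Ready (s.setReg 8 0) := h.setReg _ (by decide)
  simp only [Expr.eval_lit]
  refine Does.forLoop (fun j s' => s'.reg 8 < D.p ∧ (s'.reg 8 : ZMod D.p) =
      ∑ m ∈ Finset.range j, (∏ d, if bitsOf D.k m d = 1 then (-1 : ZMod D.p) else 1) *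
        (D.matrix (bitsOf D.k m)).det)
    (by decide) (by decide) (by decide) (by rw [h1.r3]; exact hf.K) (by simp [hp.pos]) ?_ ?_
  · intro j s' hj hx hF ⟨_, hI⟩
    have h' := h1.frame hF (by decide) (by decide)
    refine Does.seq (does_fillStep hf hp.pos hM h') fun s₁ hF₁ hs₁ => ?_
    have h₁ := h'.frame hF₁ (by decide) (by decide)
    have f8 : s₁.reg 8 = s'.reg 8 := hF₁.reg 8 (by decide)
    have f9 : s₁.reg 9 = j := (hF₁.reg 9 (by decide)).trans hx
    refine Does.set_seq (by simpa using hM) ?_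
    simp only [Expr.eval_lit]
    refine Does.seq (does_signStep hf hp.pos (h₁.setReg 1 (by decide))) fun s₂ hF₂ hs₂ => ?_
    have h₂ := (h₁.setReg 1 (by decide)).frame hF₂ (by decide) (by decide)
    have g8 : s₂.reg 8 = s'.reg 8 := (hF₂.reg 8 (by decide)).trans (by simp [f8])
    have ga : s₂.arr 5 = s₁.arr 5 := (hF₂.arr 5 (by decide)).trans (by simp)
    refine Does.seq (does_mulDet hf.pM hf.N hf.p h₂.r0 h₂.r6) fun s₃ hF₃ hs₃ => ?_
    have h₃ := h₂.frame hF₃ (by decide) (by decide)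
    have k8 : s₃.reg 8 = s'.reg 8 := (hF₃.reg 8 (by decide)).trans g8
    refine Does.set ?_ ?_
    · simp only [Expr.eval_mod, Expr.eval_reg, h₃.r6]
      exact (Nat.mod_lt _ hp.pos).le.trans hf.pM
    · simp only [State.setReg_reg, Expr.eval_mod, Expr.eval_add, Expr.eval_reg, h₃.r6, k8, f9,
          if_true, Nat.reduceEqDiff, if_false] at hs₂ ⊢
      refine ⟨Nat.mod_lt _ hp.pos, ?_⟩
      rw [ZMod.natCast_mod, Nat.cast_add, hI, hs₃, hs₂, ga, hs₁, hx, Finset.sum_range_succ,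
        Nat.cast_one, one_mul]
  · intro s' _ ⟨hlt, hI⟩
    refine ⟨hlt, ?_⟩
    rw [hI, h1.r3, sum_bitsOf D.k fun S => (∏ d, if S d = 1 then (-1 : ZMod D.p) else 1) *
        (D.matrix S).det]
    rfl

variable {M : ℕ} {β : ℕ → ℕ}

/-! ## Preparation of the data -/

/-- Compute in `reg 4` a power of two, with exponent in `reg 5`, that is at least `reg 36`. -/
def powerStep : Prog :=
  .seq (.set 4 (.lit 1)) (.seq (.set 5 (.lit 0)) (forLoop 30 36
    (.ite ((Expr.reg 4).less (.reg 36))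
      (.seq (.set 4 (.lit 2 * .reg 4)) (.set 5 (.reg 5 + .lit 1))) .skip)))

/-- Write `reg 7` random numbers with `reg 5` binary digits into array `4`. -/
def randomStep : Prog :=
  forLoop 30 7 (.seq (.set 37 (.lit 0)) (.seq
    (forLoop 38 5 (.seq (.flip 39) (.set 37 (.lit 2 * .reg 37 + .reg 39))))
    (.put 4 (.reg 30) (.reg 37))))

theorem does_powerStep {T : ℕ} (hT : 0 < T) (hM : 2 * T ≤ M) (hβ : T ≤ β 36) {s : State}
    (h36 : s.reg 36 = T) : Does M β powerStep s fun s' =>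
      s'.reg 4 = 2 ^ s'.reg 5 ∧ T ≤ s'.reg 4 ∧ s'.reg 4 < 2 * T := by
  refine Does.set_seq (by simp; omega) (Does.set_seq (by simp) ?_)
  simp only [Expr.eval_lit]
  refine Does.forLoop (fun i s' => s'.reg 4 = 2 ^ s'.reg 5 ∧ (T ≤ s'.reg 4 ∨ s'.reg 5 = i) ∧
      s'.reg 4 < 2 * T)
    (by decide) (by decide) (by decide) (by simp [h36, hβ]) (by simp; omega) ?_ ?_
  · rintro i s' hi hx hF ⟨h1, h2, h3⟩
    have e36 : s'.reg 36 = T := (hF.reg 36 (by decide)).trans (by simp [h36])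
    simp only [State.setReg_reg, h36, Nat.reduceEqDiff, if_false] at hi
    refine Does.ite (fun hg => ?_) (fun hg => ?_)
    · simp only [Expr.eval_less, Expr.eval_reg, e36, ne_eq, ite_eq_right_iff, one_ne_zero,
        imp_false, not_not] at hg
      have h5 : s'.reg 5 < 2 ^ s'.reg 5 := Nat.lt_two_pow_self
      refine Does.set_seq (by simp; omega) (Does.set (by simp; omega) ?_)
      simp only [State.setReg_reg, Expr.eval_mul, Expr.eval_add, Expr.eval_lit,
        Expr.eval_reg, if_true, Nat.reduceEqDiff, if_false]
      refine ⟨by rw [pow_succ, h1]; ring, ?_, by omega⟩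
      rcases h2 with h2 | h2
      · omega
      · right; omega
    · simp only [Expr.eval_less, Expr.eval_reg, e36, ite_eq_right_iff, one_ne_zero,
        imp_false] at hg
      refine Does.skip ⟨by simpa using h1, .inl (by simpa using hg), by simpa using h3⟩
  · rintro s' _ ⟨h1, h2, h3⟩
    simp only [State.setReg_reg, h36, Nat.reduceEqDiff, if_false] at h2
    refine ⟨h1, ?_, h3⟩
    rcases h2 with h2 | h2
    · exact h2
    -- If every one of the `T` rounds doubled, the result is `2 ^ T`, which exceeds `T`.
    · rw [h1, h2]; exact Nat.lt_two_pow_self.le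

/-- The second clause of the invariant counts the coins already used: `b` for each finished number,
so the number with index `j` uses the block of coins starting at `j * b`. -/
theorem does_randomStep {b m : ℕ} (hM : 2 ^ b ≤ M) (hm : m ≤ β 7) (hb : b ≤ β 5)
    {s : State} (h5 : s.reg 5 = b) (h7 : s.reg 7 = m) : Does M β randomStep s fun s' =>
      ∀ j < m, s'.arr 4 j = bitsValue s.coins (j * b) b := by
  refine Does.forLoop (fun i s' => (∀ j < i, s'.arr 4 j = bitsValue s.coins (j * b) b) ∧
      s'.coins = fun l => s.coins (i * b + l))
    (by decide) (by decide) (by decide) (by rw [h7]; exact hm) (by simp) ?_ ?_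
  · rintro i s' hi hx hF ⟨h1, h2⟩
    have e5 : s'.reg 5 = b := (hF.reg 5 (by decide)).trans h5
    refine Does.set_seq (by simp) ?_
    simp only [Expr.eval_lit]
    refine Does.seq (R := fun s'' => s''.reg 37 = bitsValue s.coins (i * b) b ∧
      s''.coins = fun l => s.coins (i * b + b + l)) ?_ ?_
    · refine Does.forLoop (fun y s'' => s''.reg 37 = bitsValue s.coins (i * b) y ∧
          s''.coins = fun l => s.coins (i * b + y + l))
        (by decide) (by decide) (by decide) (by simp [e5, hb]) ?_ ?_ ?_
      · simp [bitsValue, h2]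
      · rintro y s₁ hy hx₁ hF₁ ⟨g1, g2⟩
        simp only [State.setReg_reg, e5, Nat.reduceEqDiff, if_false] at hy
        refine Does.seq (R := fun s₂ => s₂ = s₁.flip 39)
          (Does.flip (Nat.one_le_two_pow.trans hM) rfl) fun s₂ _ hs₂ => ?_
        subst hs₂
        have hv : 2 * s₁.reg 37 + (s₁.coins 0).toNat = bitsValue s.coins (i * b) (y + 1) := by
          rw [g1, g2]; rfl
        refine Does.set ?_ ?_
        · simp only [Expr.eval_add, Expr.eval_mul, Expr.eval_lit, Expr.eval_reg, State.flip_reg,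
            if_true, Nat.reduceEqDiff, if_false, hv]
          refine (bitsValue_lt _ _ _).le.trans (le_trans ?_ hM)
          exact Nat.pow_le_pow_right (by norm_num) (by omega)
        · simp only [Expr.eval_add, Expr.eval_mul, Expr.eval_lit, Expr.eval_reg, State.flip_reg,
            State.setReg_reg, State.setReg_coins, State.flip_coins,
            if_true, Nat.reduceEqDiff, if_false, hv, true_and]
          rw [g2]
          funext l
          exact congrArg s.coins (by ring)
      · rintro s₁ _ ⟨g1, g2⟩
        simp only [State.setReg_reg, e5, Nat.reduceEqDiff, if_false] at g1 g2
        exact ⟨g1, g2⟩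
    · rintro s₁ hF₁ ⟨g1, g2⟩
      have f30 : s₁.reg 30 = i := (hF₁.reg 30 (by decide)).trans (by simp [hx])
      have fa : s₁.arr 4 = s'.arr 4 := (hF₁.arr 4 (by decide)).trans (by simp)
      refine Does.of_bdd fun hbd => Does.put (by simpa using hbd.reg 37) ⟨fun j hj => ?_, ?_⟩
      · simp only [State.setReg_arr, State.setArr_arr, Expr.eval_reg, f30, g1, true_and, fa]
        split_ifs with hji
        · rw [hji]
        · exact h1 j (by omega)
      · simp only [State.setReg_coins, State.setArr_coins, g2]
        funext l
        congr 1; ring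
  · rintro s' _ ⟨h1, -⟩
    rw [h7] at h1
    exact h1

/-- Find in `reg 6` a prime number between `reg 4` and twice `reg 4`. -/
def primeStep : Prog :=
  .seq (.set 6 (.lit 0)) (forLoop 30 4 (.seq (.set 40 (.reg 4 + .lit 1 + .reg 30))
    (.seq (.set 41 (.lit 1)) (.seq
      (forLoop 42 40 (.ite (((Expr.lit 1).less (.reg 42)) *
        ((Expr.reg 40 % Expr.reg 42).same (.lit 0))) (.set 41 (.lit 0)) .skip))
      (.ite (.reg 41) (.set 6 (.reg 40)) .skip)))))

/-- Bertrand's postulate guarantees a prime among the `q` candidates `q + 1, …, 2 * q`; they are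
tested by trial division. -/
theorem does_primeStep {q : ℕ} (hq : 0 < q) (hM : 2 * q ≤ M) (hβ : q ≤ β 4)
    (hβ' : 2 * q ≤ β 40) {s : State} (h4 : s.reg 4 = q) : Does M β primeStep s fun s' =>
      (s'.reg 6).Prime ∧ q < s'.reg 6 ∧ s'.reg 6 ≤ 2 * q := by
  refine Does.set_seq (by simp) ?_
  simp only [Expr.eval_lit]
  refine Does.forLoop (fun i s' =>
      (s'.reg 6 ≠ 0 → (s'.reg 6).Prime ∧ q < s'.reg 6 ∧ s'.reg 6 ≤ 2 * q) ∧
      ∀ l < i, (q + 1 + l).Prime → s'.reg 6 ≠ 0)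
    (by decide) (by decide) (by decide) (by simp [h4, hβ]) (by simp) ?_ ?_
  · rintro i s' hi hx hF ⟨h1, h2⟩
    have e4 : s'.reg 4 = q := (hF.reg 4 (by decide)).trans (by simp [h4])
    simp only [State.setReg_reg, h4, Nat.reduceEqDiff, if_false] at hi
    refine Does.set_seq (by simp [e4, hx]; omega) (Does.set_seq (by simp; omega) ?_)
    simp only [Expr.eval_lit, Expr.eval_add, Expr.eval_reg, e4, hx]
    refine Does.seq (R := fun s'' => s''.reg 41 ≠ 0 ↔ (q + 1 + i).Prime) ?_ ?_
    · refine Does.forLoop (fun d s'' => s''.reg 41 ≠ 0 ↔ ∀ m, 2 ≤ m → m < d → ¬ m ∣ q + 1 + i)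
        (by decide) (by decide) (by decide) (by simp; omega) (by simp) ?_ ?_
      · intro d s₁ hd hx₁ hF₁ g
        have e40 : s₁.reg 40 = q + 1 + i := (hF₁.reg 40 (by decide)).trans (by simp)
        refine Does.ite (fun hg => ?_) (fun hg => ?_)
        · simp only [Expr.eval_mul, Expr.eval_less, Expr.eval_same, Expr.eval_mod, Expr.eval_lit,
            Expr.eval_reg, e40, hx₁, ne_eq, mul_eq_zero, ite_eq_right_iff, one_ne_zero, imp_false,
            not_or, not_not] at hg
          refine Does.set (by simp) ?_
          simp only [State.setReg_reg, Nat.reduceEqDiff, if_false, if_true, Expr.eval_lit, ne_eq,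
            not_true_eq_false, false_iff, not_forall]
          exact ⟨d, hg.1, by omega, fun h => h (Nat.dvd_of_mod_eq_zero hg.2)⟩
        · simp only [Expr.eval_mul, Expr.eval_less, Expr.eval_same, Expr.eval_mod, Expr.eval_lit,
            Expr.eval_reg, e40, hx₁, mul_eq_zero, ite_eq_right_iff, one_ne_zero, imp_false] at hg
          refine Does.skip ?_
          simp only [State.setReg_reg, Nat.reduceEqDiff, if_false]
          rw [g]
          refine ⟨fun h m hm hmd => ?_, fun h m hm hmd => h m hm (by omega)⟩
          rcases Nat.lt_succ_iff_lt_or_eq.mp hmd with hmd | rfl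
          · exact h m hm hmd
          · rcases hg with hg | hg
            · omega
            · exact fun h => hg (Nat.mod_eq_zero_of_dvd h)
      · intro s₁ _ g
        simp only [State.setReg_reg, Nat.reduceEqDiff, if_false, if_true] at g
        rw [g, Nat.prime_def_lt']
        exact ⟨fun h => ⟨by omega, h⟩, fun h => h.2⟩
    · intro s₁ hF₁ g
      have f6 : s₁.reg 6 = s'.reg 6 := (hF₁.reg 6 (by decide)).trans (by simp)
      have f40 : s₁.reg 40 = q + 1 + i := (hF₁.reg 40 (by decide)).trans (by simp)
      refine Does.ite (fun hg => ?_) (fun hg => ?_)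
      · refine Does.set (by simp [f40]; omega) ?_
        simp only [State.setReg_reg, Nat.reduceEqDiff, if_false, if_true, Expr.eval_reg, f40]
        exact ⟨fun _ => ⟨g.mp hg, by omega, by omega⟩, fun _ _ _ => by omega⟩
      · refine Does.skip ?_
        simp only [State.setReg_reg, Nat.reduceEqDiff, if_false, f6]
        refine ⟨h1, fun l hl hlp => ?_⟩
        rcases Nat.lt_succ_iff_lt_or_eq.mp hl with hl | rfl
        · exact h2 l hl hlp
        · exact absurd hg (g.mpr hlp)
  · rintro s' _ ⟨h1, h2⟩
    obtain ⟨r, hr, hqr, hrq⟩ := Nat.exists_prime_lt_and_le_two_mul q hq.ne'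
    simp only [State.setReg_reg, Nat.reduceEqDiff, if_false, h4] at h2
    exact h1 (h2 (r - q - 1) (by omega) (by rwa [show q + 1 + (r - q - 1) = r by omega]))

/-- Read the number of vertices and the modulator. -/
def modulatorStep : Prog :=
  .seq (.set 1 (.get 0 (.lit 0))) (.seq (.set 2 (.lit 0)) (.seq (.set 3 (.lit 1))
    (forLoop 30 1 (.ite (.get 0 (.lit 1 + .reg 1 * .reg 1 + .reg 30))
      (.seq (.put 1 (.reg 2) (.reg 30)) (.seq (.put 2 (.reg 2) (.reg 3))
        (.seq (.set 2 (.reg 2 + .lit 1)) (.set 3 (.lit 2 * .reg 3))))) .skip))))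

theorem does_modulatorStep {w : ℕ → ℕ} {n : ℕ} (hn : w 0 = n) (hM : 2 ^ n ≤ M) (hβ : n ≤ β 1)
    {s : State} (ha : s.arr 0 = w) : Does M β modulatorStep s fun s' =>
      s'.reg 1 = n ∧
      s'.reg 2 = ((Finset.range n).filter fun v => w (1 + n * n + v) ≠ 0).card ∧
      s'.reg 3 = 2 ^ s'.reg 2 ∧
      (∀ d < s'.reg 2, s'.arr 2 d = 2 ^ d) ∧
      (∀ d < s'.reg 2, s'.arr 1 d < n ∧ w (1 + n * n + s'.arr 1 d) ≠ 0) ∧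
      ∀ v < n, w (1 + n * n + v) ≠ 0 → ∃ d < s'.reg 2, s'.arr 1 d = v := by
  have hM1 : 1 ≤ M := Nat.one_le_two_pow.trans hM
  have hnM : n ≤ M := Nat.lt_two_pow_self.le.trans hM
  refine Does.set_seq (by simp [ha, hn, hnM]) (Does.set_seq (by simp) (Does.set_seq
    (by simpa using hM1) ?_))
  simp only [Expr.eval_lit, Expr.eval_get, ha, hn]
  refine Does.forLoop (fun i s' =>
      s'.reg 2 = ((Finset.range i).filter fun v => w (1 + n * n + v) ≠ 0).card ∧
      s'.reg 3 = 2 ^ s'.reg 2 ∧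
      (∀ d < s'.reg 2, s'.arr 2 d = 2 ^ d) ∧
      (∀ d < s'.reg 2, s'.arr 1 d < i ∧ w (1 + n * n + s'.arr 1 d) ≠ 0) ∧
      ∀ v < i, w (1 + n * n + v) ≠ 0 → ∃ d < s'.reg 2, s'.arr 1 d = v)
    (by decide) (by decide) (by decide) (by simpa using hβ) (by simp) ?_ ?_
  · rintro i s' hi hx hF ⟨h1, h2, h3, h4, h5⟩
    have e1 : s'.reg 1 = n := (hF.reg 1 (by decide)).trans (by simp)
    have ea : s'.arr 0 = w := (hF.arr 0 (by decide)).trans (by simp [ha])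
    simp only [State.setReg_reg, if_false, if_true, OfNat.one_ne_ofNat] at hi
    have hk : s'.reg 2 ≤ i := by
      rw [h1]; exact (Finset.card_filter_le _ _).trans (by simp)
    -- At most `i < n` vertices have been recorded, so one more doubling stays below `2 ^ n`.
    have hk2 : 2 ^ (s'.reg 2 + 1) ≤ M :=
      (Nat.pow_le_pow_right (by norm_num) (by omega)).trans hM
    rw [Finset.range_add_one, Finset.filter_insert]
    refine Does.ite (fun hg => ?_) (fun hg => ?_)
    · simp only [Expr.eval_get, Expr.eval_add, Expr.eval_mul, Expr.eval_lit, Expr.eval_reg, e1, ea,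
        hx] at hg
      refine Does.of_bdd fun hbd => Does.put_seq (by simpa using hbd.reg 30)
        (Does.put_seq (by simpa using hbd.reg 3) (Does.set_seq (by simp; omega) (Does.set ?_ ?_)))
      · simp only [Expr.eval_mul, Expr.eval_lit, Expr.eval_reg, State.setReg_reg,
          State.setArr_reg, Nat.reduceEqDiff, if_false, h2]
        rw [pow_succ] at hk2; omega
      rw [if_pos hg, Finset.card_insert_of_notMem (by simp), ← h1]
      simp only [State.setReg_reg, State.setArr_reg, State.setReg_arr, State.setArr_arr,
        Expr.eval_add, Expr.eval_mul, Expr.eval_lit, Expr.eval_reg, Nat.reduceEqDiff, if_false,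
        if_true, hx, h2, true_and, OfNat.ofNat_ne_one, OfNat.one_ne_ofNat, false_and]
      refine ⟨by rw [pow_succ]; ring, fun d hd => ?_, fun d hd => ?_, fun v hv hvw => ?_⟩
      · split_ifs with hd2
        · rw [hd2]
        · exact h3 d (by omega)
      · split_ifs with hd2
        · exact ⟨by omega, hg⟩
        · exact ⟨(h4 d (by omega)).1.trans (by omega), (h4 d (by omega)).2⟩
      · rcases Nat.lt_succ_iff_lt_or_eq.mp hv with hv | rfl
        · obtain ⟨d, hd, hdv⟩ := h5 v hv hvw
          exact ⟨d, by omega, by rw [if_neg (by omega), hdv]⟩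
        · exact ⟨s'.reg 2, by omega, by simp⟩
    · simp only [Expr.eval_get, Expr.eval_add, Expr.eval_mul, Expr.eval_lit, Expr.eval_reg, e1, ea,
        hx] at hg
      refine Does.skip ?_
      simp only [State.setReg_reg, Nat.reduceEqDiff, if_false, State.setReg_arr]
      rw [if_neg (by simpa using hg)]
      refine ⟨h1, h2, h3, fun d hd => ⟨(h4 d hd).1.trans (by omega), (h4 d hd).2⟩,
        fun v hv hvw => ?_⟩
      rcases Nat.lt_succ_iff_lt_or_eq.mp hv with hv | rfl
      · exact h5 v hv hvw
      · exact absurd hg hvw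
  · rintro s' hF ⟨h1, h2, h3, h4, h5⟩
    have e1 : s'.reg 1 = n := (hF.reg 1 (by decide)).trans (by simp)
    simp only [State.setReg_reg, if_false, if_true, OfNat.one_ne_ofNat]
      at h1 h4 h5
    exact ⟨e1, h1, h2, h3, h4, h5⟩

/-! ### Colors as positions in the input -/

/-- The last position before `m` at which `w` takes the value `x`. -/
def lastOcc (w : ℕ → ℕ) (x : ℕ) : ℕ → ℕ
  | 0 => 0
  | m + 1 => if w m = x then m else lastOcc w x m

theorem lastOcc_lt (w : ℕ → ℕ) (x : ℕ) {m : ℕ} (hm : 0 < m) : lastOcc w x m < m := by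
  induction m with
  | zero => omega
  | succ m ih =>
    rw [lastOcc]; split_ifs
    · omega
    · rcases Nat.eq_zero_or_pos m with rfl | h
      · simp [lastOcc]
      · exact (ih h).trans (by omega)

/-- A color that occurs in the input can be recovered from its position, so distinct colors have
distinct positions. Thus arbitrarily large colors become column indices below `N`. The last
occurrence is what an overwriting scan finds. -/
theorem lastOcc_eq {w : ℕ → ℕ} {x m i : ℕ} (hi : i < m) (hx : w i = x) :
    w (lastOcc w x m) = x := by
  induction m with
  | zero => omega
  | succ m ih =>
    rw [lastOcc]; split_ifs with h
    · exact h
    · refine ih (lt_of_le_of_ne (by omega) ?_)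
      rintro rfl; exact h hx

/-- Represent the color in position `reg 31` by its last occurrence `reg 34` in the input. -/
def colorStep : Prog :=
  .seq (.set 34 (.lit 0)) (forLoop 35 0
    (.ite ((Expr.get 0 (.reg 35)).same (.get 0 (.reg 31))) (.set 34 (.reg 35)) .skip))

/-- Read the lists of colors. -/
def listStep : Prog :=
  .seq (.set 31 (.lit 1 + .reg 1 * .reg 1 + .reg 1)) (forLoop 30 1
    (.seq (.set 32 (.get 0 (.reg 31))) (.seq
      (forLoop 33 32 (.seq (.set 31 (.reg 31 + .lit 1)) (.seq colorStep
        (.put 3 (.reg 30 * .reg 0 + .reg 34) (.lit 1)))))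
      (.set 31 (.reg 31 + .lit 1)))))

theorem does_colorStep {N : ℕ} (hβ : N ≤ β 0) {s : State} (h0 : s.reg 0 = N) :
    Does M β colorStep s fun s' => s'.reg 34 = lastOcc (s.arr 0) (s.arr 0 (s.reg 31)) N := by
  refine Does.set_seq (by simp) ?_
  simp only [Expr.eval_lit]
  refine Does.forLoop (fun i s' => s'.reg 34 = lastOcc (s.arr 0) (s.arr 0 (s.reg 31)) i)
    (by decide) (by decide) (by decide) (by simp [h0, hβ]) (by simp [lastOcc]) ?_ ?_
  · intro i s' hi hx hF hI
    have ea : s'.arr 0 = s.arr 0 := (hF.arr 0 (by decide)).trans (by simp)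
    have e31 : s'.reg 31 = s.reg 31 := (hF.reg 31 (by decide)).trans (by simp)
    refine Does.ite (fun hg => ?_) (fun hg => ?_)
    · simp only [Expr.eval_same, Expr.eval_get, Expr.eval_reg, ea, e31, hx, ne_eq,
        ite_eq_right_iff, one_ne_zero, imp_false, not_not] at hg
      refine Does.of_bdd fun hbd => Does.set (by simpa using hbd.reg 35) ?_
      simp [lastOcc, hg, hx]
    · simp only [Expr.eval_same, Expr.eval_get, Expr.eval_reg, ea, e31, hx,
        ite_eq_right_iff, one_ne_zero, imp_false] at hg
      refine Does.skip ?_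
      simp [lastOcc, hg, hI]
  · intro s' _ hI
    simpa [h0] using hI

/-- The lists are stored in `w` one after the other, the one with number `v` starting with its
length at position `pos v`. -/
structure ListLayout (w : ℕ → ℕ) (n N : ℕ) (pos : ℕ → ℕ) : Prop where
  zero : pos 0 = 1 + n * n + n
  succ : ∀ v < n, pos (v + 1) = pos v + w (pos v) + 1
  le : ∀ v ≤ n, pos v ≤ N

/-- Array `3` starts with zeros and receives only ones, so a cell is `1` exactly if some list entry
points to it. Positions are below `N`, so the rows of the array do not overlap. -/
theorem does_listStep {w : ℕ → ℕ} {n N : ℕ} {pos : ℕ → ℕ} (hL : ListLayout w n N pos)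
    (hN : 0 < N) (hM : N ≤ M) (hβ0 : N ≤ β 0) (hβ1 : N ≤ β 1) (hβ : N ≤ β 32) {s : State}
    (ha : s.arr 0 = w) (h0 : s.reg 0 = N) (h1 : s.reg 1 = n) (h3 : ∀ i, s.arr 3 i = 0) :
    Does M β listStep s fun s' => ∀ v < n, ∀ c < N, s'.arr 3 (v * N + c) ≤ 1 ∧
      (s'.arr 3 (v * N + c) = 1 ↔ ∃ t < w (pos v), c = lastOcc w (w (pos v + 1 + t)) N) := by
  have hpos0 := hL.le 0 (by omega)
  rw [hL.zero] at hpos0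
  refine Does.set_seq (by simp [h1]; omega) ?_
  simp only [Expr.eval_lit, Expr.eval_add, Expr.eval_mul, Expr.eval_reg, h1]
  refine Does.forLoop (fun i s' => s'.reg 31 = pos i ∧ ∀ v, ∀ c < N, s'.arr 3 (v * N + c) ≤ 1 ∧
      (s'.arr 3 (v * N + c) = 1 ↔
        v < i ∧ ∃ t < w (pos v), c = lastOcc w (w (pos v + 1 + t)) N))
    (by decide) (by decide) (by decide) (by simp [h1]; omega) (by simp [h3, hL.zero]) ?_ ?_
  · rintro i s' hi hx hF ⟨g1, g2⟩
    have ea : s'.arr 0 = w := (hF.arr 0 (by decide)).trans (by simp [ha])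
    have e0 : s'.reg 0 = N := (hF.reg 0 (by decide)).trans (by simp [h0])
    simp only [State.setReg_reg, if_false, OfNat.one_ne_ofNat, h1] at hi
    have hs := hL.succ i hi
    have hle := hL.le (i + 1) (by omega)
    refine Does.of_bdd fun hbd => Does.set_seq (by simpa using hbd.arr _ _) ?_
    simp only [Expr.eval_get, Expr.eval_reg, ea, g1]
    refine Does.seq (R := fun s'' => s''.reg 31 = pos i + w (pos i) ∧
      ∀ v, ∀ c < N, s''.arr 3 (v * N + c) ≤ 1 ∧ (s''.arr 3 (v * N + c) = 1 ↔
        (v < i ∧ ∃ t < w (pos v), c = lastOcc w (w (pos v + 1 + t)) N) ∨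
        (v = i ∧ ∃ t < w (pos i), c = lastOcc w (w (pos v + 1 + t)) N))) ?_ ?_
    · refine Does.forLoop (fun j s'' => s''.reg 31 = pos i + j ∧
          ∀ v, ∀ c < N, s''.arr 3 (v * N + c) ≤ 1 ∧ (s''.arr 3 (v * N + c) = 1 ↔
            (v < i ∧ ∃ t < w (pos v), c = lastOcc w (w (pos v + 1 + t)) N) ∨
            (v = i ∧ ∃ t < j, c = lastOcc w (w (pos v + 1 + t)) N)))
        (by decide) (by decide) (by decide) (by simp; omega) ?_ ?_ ?_
      · simpa [g1] using g2
      · rintro j s₁ hj hx₁ hF₁ ⟨k1, k2⟩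
        have fa : s₁.arr 0 = w := (hF₁.arr 0 (by decide)).trans (by simp [ea])
        have f0 : s₁.reg 0 = N := (hF₁.reg 0 (by decide)).trans (by simp [e0])
        have f30 : s₁.reg 30 = i := (hF₁.reg 30 (by decide)).trans (by simp [hx])
        simp only [State.setReg_reg, if_true] at hj
        refine Does.set_seq (by simp [k1]; omega) ?_
        simp only [Expr.eval_add, Expr.eval_lit, Expr.eval_reg, k1]
        refine Does.seq (does_colorStep hβ0 (by simp [f0])) fun s₂ hF₂ hs₂ => ?_
        have q0 : s₂.reg 0 = N := (hF₂.reg 0 (by decide)).trans (by simp [f0])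
        have q30 : s₂.reg 30 = i := (hF₂.reg 30 (by decide)).trans (by simp [f30])
        have q31 : s₂.reg 31 = pos i + j + 1 := (hF₂.reg 31 (by decide)).trans (by simp)
        have qa : s₂.arr 3 = s₁.arr 3 := (hF₂.arr 3 (by decide)).trans (by simp)
        simp only [State.setReg_arr, State.setReg_reg, if_true, fa] at hs₂
        refine Does.put (by simp; omega) ⟨by simp [q31]; omega, fun v c hc => ?_⟩
        simp only [State.setReg_arr, State.setArr_arr, Expr.eval_add, Expr.eval_mul,
          Expr.eval_reg, Expr.eval_lit, q0, q30, hs₂, true_and, qa]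
        have harg : pos i + j + 1 = pos i + 1 + j := by omega
        rw [harg]
        obtain ⟨m1, m2⟩ := k2 v c hc
        split_ifs with hvc
        · obtain ⟨rfl, rfl⟩ := rowMajor_inj hc (lastOcc_lt _ _ hN) hvc
          exact ⟨le_rfl, by simpa using ⟨j, by omega, rfl⟩⟩
        · refine ⟨m1, m2.trans (or_congr_right (and_congr_right ?_))⟩
          rintro rfl
          refine ⟨fun ⟨t, ht, htc⟩ => ⟨t, by omega, htc⟩, fun ⟨t, ht, htc⟩ => ⟨t, ?_, htc⟩⟩
          refine lt_of_le_of_ne (by omega) ?_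
          rintro rfl
          exact hvc (by rw [htc])
      · rintro s₁ _ ⟨k1, k2⟩
        simp only [State.setReg_reg, if_true] at k1 k2
        exact ⟨k1, k2⟩
    · rintro s₁ _ ⟨k1, k2⟩
      refine Does.set (by simp [k1]; omega) ⟨?_, fun v c hc => ?_⟩
      · simp only [State.setReg_reg, Nat.reduceEqDiff, if_false, if_true, Expr.eval_add,
          Expr.eval_reg, Expr.eval_lit, k1, hs]
      · obtain ⟨m1, m2⟩ := k2 v c hc
        refine ⟨m1, m2.trans ⟨?_, ?_⟩⟩
        · rintro (⟨h, h'⟩ | ⟨rfl, h'⟩)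
          · exact ⟨by omega, h'⟩
          · exact ⟨by omega, h'⟩
        · rintro ⟨h, h'⟩
          rcases Nat.lt_succ_iff_lt_or_eq.mp h with h | rfl
          · exact .inl ⟨h, h'⟩
          · exact .inr ⟨rfl, h'⟩
  · rintro s' _ ⟨-, g2⟩ v hv c hc
    obtain ⟨m1, m2⟩ := g2 v c hc
    refine ⟨m1, m2.trans (and_iff_right ?_)⟩
    simpa [h1] using hv

end RAM

/-! ## The input word -/

/-- The blocks may have different lengths; the offset of a block is the total length of the
preceding ones. This locates both the adjacency rows and the lists in the input word. -/
theorem List.getD_flatMap_take {α β : Type*} (f : α → List β) (d : β) :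
    ∀ (l : List α) (i : ℕ) (hi : i < l.length) (j : ℕ), j < (f l[i]).length →
      (l.flatMap f).getD (((l.take i).map fun x => (f x).length).sum + j) d = (f l[i]).getD j d
  | [], i, hi, _, _ => absurd hi (by simp)
  | a :: l, 0, _, j, hj => by
    simp only [List.getElem_cons_zero] at hj
    simp [List.flatMap_cons, List.getElem?_append_left hj]
  | a :: l, i + 1, hi, j, hj => by
    simp only [List.getElem_cons_succ] at hj
    have ih := List.getD_flatMap_take f d l i (by simpa using hi) j hj
    rw [List.take_succ_cons, List.map_cons, List.sum_cons, List.flatMap_cons, add_assoc,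
      List.getD_append_right _ _ _ _ (by omega), Nat.add_sub_cancel_left, ih]
    simp

namespace LCCMInstance

variable (I : LCCMInstance)

/-- The entries of the input word. -/
noncomputable def word (i : ℕ) : ℕ := I.encode.getD i 0

/-- The position of the list of vertex `v` in the input word. -/
noncomputable def listPos (v : ℕ) : ℕ :=
  1 + I.n * I.n + I.n + (((List.finRange I.n).take v).map fun x => (I.L x).length + 1).sum

theorem length_encode : I.encode.length = I.listPos I.n := by
  have h : (List.finRange I.n).take I.n = List.finRange I.n := by
    rw [List.take_of_length_le]; simp
  rw [listPos, h]
  simp [encode, List.length_flatMap]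
  ring

theorem word_zero : I.word 0 = I.n := by simp [word, encode]

open Classical in
theorem word_adj (u v : Fin I.n) :
    I.word (1 + u * I.n + v) = if I.G.Adj u v then 1 else 0 := by
  have h := List.getD_flatMap_take (fun u => (List.finRange I.n).map fun v =>
    if I.G.Adj u v then 1 else 0) 0 (List.finRange I.n) u (by simp) v (by simp)
  have hlen : (u : ℕ) * I.n + v < I.n * I.n := by
    calc (u : ℕ) * I.n + v < u * I.n + I.n := by omega
      _ = (u + 1) * I.n := by ring
      _ ≤ I.n * I.n := Nat.mul_le_mul_right _ u.2
  have hu : ((List.take (u : ℕ) (List.finRange I.n)).map fun x =>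
      ((List.finRange I.n).map fun v => if I.G.Adj x v then 1 else 0).length).sum = u * I.n := by
    simp
  rw [hu] at h
  rw [word, encode, List.getD_append _ _ _ _ (by simp [List.length_flatMap]; omega),
    List.getD_append _ _ _ _ (by simp [List.length_flatMap]; omega),
    List.getD_append_right _ _ _ _ (by simp; omega)]
  rw [show 1 + (u : ℕ) * I.n + v - [I.n].length = u * I.n + v by simp; omega, h]
  simp

open Classical in
theorem word_modulator (v : Fin I.n) :
    I.word (1 + I.n * I.n + v) = if v ∈ I.D then 1 else 0 := by
  rw [word, encode, List.getD_append _ _ _ _ (by simp [List.length_flatMap]; omega),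
    List.getD_append_right _ _ _ _ (by simp [List.length_flatMap]; omega)]
  rw [show 1 + I.n * I.n + (v : ℕ) - _ = v by simp [List.length_flatMap]; omega]
  simp

theorem word_list (v : Fin I.n) (j : ℕ) (hj : j < (I.L v).length + 1) :
    I.word (I.listPos v + j) = ((I.L v).length :: I.L v).getD j 0 := by
  have h := List.getD_flatMap_take (fun v => (I.L v).length :: I.L v) 0 (List.finRange I.n) v
    (by simp) j (by simpa using hj)
  rw [word, encode, List.getD_append_right _ _ _ _ (by simp [List.length_flatMap, listPos]; omega)]
  rw [show I.listPos v + j - _ = (((List.finRange I.n).take v).map fun x =>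
    (I.L x).length + 1).sum + j by simp [List.length_flatMap, listPos]; omega]
  simpa using h

theorem word_listPos (v : Fin I.n) : I.word (I.listPos v) = (I.L v).length := by
  simpa using I.word_list v 0 (by omega)

theorem listPos_succ (v : Fin I.n) :
    I.listPos (v + 1) = I.listPos v + (I.L v).length + 1 := by
  rw [listPos, listPos, List.take_add_one, List.map_append, List.sum_append]
  simp; ring

theorem listPos_mono {u v : ℕ} (h : u ≤ v) : I.listPos u ≤ I.listPos v := by
  unfold listPos
  have : ((List.finRange I.n).take u).Sublist ((List.finRange I.n).take v) :=
    List.take_sublist_take_left h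
  have := (this.map fun x => (I.L x).length + 1).sum_le_sum (by simp)
  omega

theorem listLayout : RAM.ListLayout I.word I.n I.encode.length I.listPos where
  zero := by simp [listPos]
  succ := fun v hv => by
    rw [I.word_listPos ⟨v, hv⟩, I.listPos_succ ⟨v, hv⟩]
  le := fun v hv => by rw [length_encode]; exact I.listPos_mono hv

theorem exists_word_eq {v : Fin I.n} {x : ℕ} :
    x ∈ I.L v ↔ ∃ t < I.word (I.listPos v), I.word (I.listPos v + 1 + t) = x := by
  rw [word_listPos, List.mem_iff_getElem]
  have h : ∀ t (ht : t < (I.L v).length), I.word (I.listPos v + 1 + t) = (I.L v)[t] := by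
    intro t ht
    rw [add_assoc, add_comm 1 t, I.word_list v (t + 1) (by omega)]
    simp [ht]
  constructor
  · rintro ⟨t, ht, rfl⟩; exact ⟨t, ht, h t ht⟩
  · rintro ⟨t, ht, hx⟩; exact ⟨t, ht, (h t ht).symm.trans hx⟩

theorem exists_word_of_mem {v : Fin I.n} {x : ℕ} (hx : x ∈ I.L v) :
    ∃ i < I.encode.length, I.word i = x := by
  obtain ⟨t, ht, h⟩ := I.exists_word_eq.mp hx
  refine ⟨_, ?_, h⟩
  have h1 := I.listPos_mono (show (v : ℕ) + 1 ≤ I.n from v.2)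
  rw [length_encode]
  rw [word_listPos] at ht
  rw [listPos_succ] at h1
  omega

theorem card_modulator : ((Finset.range I.n).filter fun v =>
    I.word (1 + I.n * I.n + v) ≠ 0).card = I.param := by
  rw [param, ← Finset.card_map Fin.valEmbedding]
  congr 1
  ext v
  simp only [Finset.mem_filter, Finset.mem_range, Finset.mem_map, Fin.valEmbedding_apply]
  constructor
  · rintro ⟨hv, h⟩
    refine ⟨⟨v, hv⟩, ?_, rfl⟩
    by_contra hD
    exact h (by rw [I.word_modulator ⟨v, hv⟩, if_neg hD])
  · rintro ⟨u, hu, rfl⟩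
    exact ⟨u.2, by rw [word_modulator, if_pos hu]; simp⟩

theorem param_le : I.param ≤ I.n := by
  simpa [param] using Finset.card_le_univ I.D

theorem n_lt_length : I.n < I.encode.length := by
  have := I.listLayout.le 0 (by omega)
  rw [I.listLayout.zero] at this
  omega

theorem length_le_inputSize (W : List ℕ) : W.length ≤ RAM.inputSize W := by
  induction W with
  | nil => simp
  | cons a W ih => simp only [RAM.inputSize, List.length_cons, List.map_cons, List.sum_cons] at *; omega

/-- Entries may be exponentially large in the input size; their bit lengths, which determine the
cost, are not. -/
theorem getD_lt_two_pow_inputSize (W : List ℕ) (i : ℕ) : W.getD i 0 < 2 ^ RAM.inputSize W := by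
  induction W generalizing i with
  | nil => simp [RAM.inputSize]
  | cons a W ih =>
    have h : RAM.inputSize (a :: W) = a.size + 1 + RAM.inputSize W := by simp [RAM.inputSize]
    rw [h]
    cases i with
    | zero =>
      refine (Nat.lt_size_self a).trans_le (Nat.pow_le_pow_right (by norm_num) (by omega))
    | succ i =>
      exact (ih i).trans_le (Nat.pow_le_pow_right (by norm_num) (by omega))

end LCCMInstance

namespace RAM

/-! ## Correctness of the sieve for list coloring -/

/-- The data describe the instance `I`. -/
structure SieveData.Represents (D : SieveData) (I : LCCMInstance) : Prop where
  N : D.N = I.encode.length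
  n : D.n = I.n
  k : D.k = I.param
  w : D.w = I.word
  dl_lt : ∀ d < D.k, D.dl d < I.n ∧ I.word (1 + I.n * I.n + D.dl d) ≠ 0
  dl_surj : ∀ v < I.n, I.word (1 + I.n * I.n + v) ≠ 0 → ∃ d < D.k, D.dl d = v
  inl : ∀ v < I.n, ∀ c < I.encode.length, D.inl (v * I.encode.length + c) ≤ 1 ∧
    (D.inl (v * I.encode.length + c) = 1 ↔ ∃ t < I.word (I.listPos v),
      c = lastOcc I.word (I.word (I.listPos v + 1 + t)) I.encode.length)

namespace SieveData.Represents

variable {D : SieveData} {I : LCCMInstance} (h : D.Represents I)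
include h

/-- The vertex with number `d` in the modulator. -/
theorem exists_vertex (d : Fin D.k) : ∃ v : Fin I.n, v ∈ I.D ∧ D.dl d = v := by
  obtain ⟨h1, h2⟩ := h.dl_lt d d.2
  refine ⟨⟨_, h1⟩, ?_, rfl⟩
  by_contra hD
  exact h2 (by rw [I.word_modulator ⟨_, h1⟩, if_neg hD])

theorem exists_index {v : Fin I.n} (hv : v ∈ I.D) : ∃ d : Fin D.k, D.dl d = v := by
  obtain ⟨d, hd, hdv⟩ := h.dl_surj v v.2 (by rw [I.word_modulator, if_pos hv]; simp)
  exact ⟨⟨d, hd⟩, hdv⟩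

theorem inl_iff (v : Fin I.n) (c : Fin D.N) :
    D.inl (v * D.N + c) = 1 ↔ ∃ x ∈ I.L v, (c : ℕ) = lastOcc I.word x D.N := by
  have := (h.inl v v.2 c (by rw [← h.N]; exact c.2)).2
  rw [← h.N] at this
  rw [this]
  constructor
  · rintro ⟨t, ht, hc⟩; exact ⟨_, I.exists_word_eq.mpr ⟨t, ht, rfl⟩, hc⟩
  · rintro ⟨x, hx, hc⟩
    obtain ⟨t, ht, rfl⟩ := I.exists_word_eq.mp hx
    exact ⟨t, ht, hc⟩

theorem inl_le (v : Fin I.n) (c : Fin D.N) : D.inl (v * D.N + c) ≤ 1 := by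
  have := (h.inl v v.2 c (by rw [← h.N]; exact c.2)).1
  rwa [← h.N] at this

theorem word_lastOcc {v : Fin I.n} {x : ℕ} (hx : x ∈ I.L v) :
    I.word (lastOcc I.word x D.N) = x := by
  obtain ⟨i, hi, hix⟩ := I.exists_word_of_mem hx
  exact lastOcc_eq (by rw [h.N]; exact hi) hix

theorem isClique_vertex {v : Fin I.n} (hv : v ∉ I.D) : D.isClique v = 1 := by
  rw [isClique, h.n, h.w, I.word_modulator, if_neg hv]
  simp

theorem isClique_cases (r : ℕ) : D.isClique r = 0 ∨
    D.isClique r = 1 ∧ ∃ v : Fin I.n, v ∉ I.D ∧ r = v := by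
  rw [isClique, h.n, h.w]
  by_cases hr : r < I.n
  · by_cases hD : (⟨r, hr⟩ : Fin I.n) ∈ I.D
    · left
      rw [I.word_modulator ⟨r, hr⟩, if_pos hD]; simp
    · right
      rw [I.word_modulator ⟨r, hr⟩, if_neg hD]
      exact ⟨by simp [hr], ⟨r, hr⟩, hD, rfl⟩
  · left; simp [hr]

/-- A clique vertex takes the column that `σ` sends to its row, a modulator vertex the column given
by `g`; the color is the input entry at that position. -/
theorem hasProperListColoring (σ : Equiv.Perm (Fin D.N)) (g : Fin D.k → Fin D.N)
    (ht : ∀ c, D.rowWeight (σ c) c ≠ 0) (hu : ∀ d, D.shareWeight (σ (g d)) (g d) d ≠ 0)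
    (hh : ∀ d e, g d = g e → D.pairWeight d e ≠ 0) : I.HasProperListColoring := by
  classical
  have hnN : I.n ≤ D.N := by rw [h.N]; exact I.n_lt_length.le
  have hcol : ∀ v : Fin I.n, ∃ c : Fin D.N, (∃ x ∈ I.L v, (c : ℕ) = lastOcc I.word x D.N) ∧
      ((v ∉ I.D ∧ σ c = Fin.castLE hnN v) ∨ ∃ d : Fin D.k, D.dl d = v ∧ v ∈ I.D ∧ g d = c) := by
    intro v
    by_cases hv : v ∈ I.D
    · obtain ⟨d, hd⟩ := h.exists_index hv
      refine ⟨g d, ?_, .inr ⟨d, hd, hv, rfl⟩⟩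
      rw [← h.inl_iff]
      have := hu d
      have h1 := h.inl_le v (g d)
      rw [shareWeight, hd] at this
      have h2 := left_ne_zero_of_mul this
      omega
    · refine ⟨σ.symm (Fin.castLE hnN v), ?_, .inl ⟨hv, by simp⟩⟩
      rw [← h.inl_iff]
      have := ht (σ.symm (Fin.castLE hnN v))
      rw [Equiv.apply_symm_apply, Fin.val_castLE, rowWeight, h.isClique_vertex hv] at this
      have h1 := h.inl_le v (σ.symm (Fin.castLE hnN v))
      omega
  choose γ hγ hγ' using hcol
  have hmem : ∀ v, I.word (γ v) ∈ I.L v := by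
    intro v
    obtain ⟨x, hx, hc⟩ := hγ v
    rw [hc, h.word_lastOcc hx]; exact hx
  -- All columns used are last occurrences, so equal colors force equal columns.
  have hinj : ∀ u v, I.word (γ u) = I.word (γ v) → γ u = γ v := by
    intro u v huv
    obtain ⟨x, hx, hc⟩ := hγ u
    obtain ⟨y, hy, hc'⟩ := hγ v
    rw [hc, hc', h.word_lastOcc hx, h.word_lastOcc hy] at huv
    exact Fin.ext (by rw [hc, hc', huv])
  have hmixed : ∀ u v : Fin I.n, u ∉ I.D → ∀ d : Fin D.k, D.dl d = v → σ (g d) = Fin.castLE hnN u →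
      ¬ I.G.Adj u v := by
    intro u v hu' d hd hσ hadj
    have := hu d
    rw [shareWeight, hσ, Fin.val_castLE, h.isClique_vertex hu', hd, h.w, h.n, I.word_adj,
      if_pos hadj] at this
    simp at this
  refine ⟨SimpleGraph.Coloring.mk (fun v => I.word (γ v)) ?_, hmem⟩
  intro u v hadj heq
  have hc := hinj u v heq
  -- In a common column, two clique vertices would occupy the same row; a mixed pair is nonadjacent
  -- by the share weight, and two modulator vertices by the pair weight.
  rcases hγ' u with ⟨hu1, hu2⟩ | ⟨d, hd, -, hgd⟩ <;>
    rcases hγ' v with ⟨hv1, hv2⟩ | ⟨e, he, -, hge⟩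
  · rw [hc, hv2] at hu2
    exact hadj.ne (Fin.castLE_injective hnN hu2).symm
  · exact hmixed u v hu1 e he (by rw [hge, ← hc, hu2]) hadj
  · exact hmixed v u hv1 d hd (by rw [hgd, hc, hv2]) hadj.symm
  · have := hh d e (by rw [hgd, hge, hc])
    rw [pairWeight, hd, he, h.w, h.n, I.word_adj, if_pos hadj] at this
    simp at this

/-- The map from the columns used by clique vertices to the rows of these vertices is a bijection
between two sets of indices and extends to a permutation. The rows met by the extension elsewhere
carry no constraint. -/
theorem exists_perm (hI : I.HasProperListColoring) :
    ∃ (σ : Equiv.Perm (Fin D.N)) (g : Fin D.k → Fin D.N), (∀ c, D.rowWeight (σ c) c = 1) ∧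
      (∀ d, D.shareWeight (σ (g d)) (g d) d = 1) ∧ ∀ d e, g d = g e → D.pairWeight d e = 1 := by
  classical
  obtain ⟨φ, hφ⟩ := hI
  have hN : 0 < D.N := by rw [h.N]; exact (Nat.zero_le _).trans_lt I.n_lt_length
  have hnN : I.n ≤ D.N := by rw [h.N]; exact I.n_lt_length.le
  set γ : Fin I.n → Fin D.N := fun v => ⟨lastOcc I.word (φ v) D.N, lastOcc_lt _ _ hN⟩ with hγ
  have hγinj : ∀ u v, γ u = γ v → φ u = φ v := by
    intro u v huv
    rw [← h.word_lastOcc (hφ u), ← h.word_lastOcc (hφ v)]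
    exact congrArg I.word (Fin.ext_iff.mp huv)
  have hinl : ∀ v, D.inl (v * D.N + γ v) = 1 := fun v =>
    (h.inl_iff v (γ v)).mpr ⟨φ v, hφ v, rfl⟩
  have hnadj : ∀ u v, γ u = γ v → ¬ I.G.Adj u v := fun u v huv hadj =>
    φ.valid hadj (hγinj u v huv)
  -- The vertices outside the modulator are pairwise adjacent, hence their colors and columns
  -- differ.
  have hf : Function.Injective fun v : {v : Fin I.n // v ∉ I.D} => γ v := by
    intro u v huv
    by_contra hne
    exact hnadj u v huv (I.isCliqueModulator u.2 v.2 fun h' => hne (Subtype.ext h'))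
  have he : Function.Injective fun v : {v : Fin I.n // v ∉ I.D} => Fin.castLE hnN v.1 :=
    fun u v huv => Subtype.ext (Fin.castLE_injective hnN huv)
  set e := (Equiv.ofInjective _ hf).symm.trans (Equiv.ofInjective _ he) with hedef
  set σ : Equiv.Perm (Fin D.N) := e.extendSubtype with hσdef
  have hσ : ∀ v : Fin I.n, v ∉ I.D → σ (γ v) = Fin.castLE hnN v := by
    intro v hv
    have hmem : γ v ∈ Set.range fun v : {v : Fin I.n // v ∉ I.D} => γ v := ⟨⟨v, hv⟩, rfl⟩
    rw [hσdef, Equiv.extendSubtype_apply_of_mem e _ hmem, hedef, Equiv.trans_apply]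
    have : (⟨γ v, hmem⟩ : Set.range fun v : {v : Fin I.n // v ∉ I.D} => γ v) =
      Equiv.ofInjective _ hf ⟨v, hv⟩ := rfl
    rw [this, Equiv.symm_apply_apply]
    rfl
  have hrow : ∀ c, ∀ v : Fin I.n, v ∉ I.D → (σ c : ℕ) = v → c = γ v := by
    intro c v hv hc
    apply σ.injective
    rw [hσ v hv]
    exact Fin.ext hc
  choose vt hvD hvt using h.exists_vertex
  refine ⟨σ, fun d => γ (vt d), fun c => ?_, fun d => ?_, fun d e hde => ?_⟩
  · rcases h.isClique_cases (σ c) with h0 | ⟨h1, v, hv, hr⟩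
    · rw [rowWeight, h0]; simp
    · rw [rowWeight, h1, hr, hrow c v hv hr, hinl]
  · rw [shareWeight, hvt, hinl, one_mul]
    rcases h.isClique_cases (σ (γ (vt d))) with h0 | ⟨h1, v, hv, hr⟩
    · rw [h0]; simp
    · rw [h1, hr, h.w, h.n, I.word_adj, if_neg (hnadj _ _ (hrow _ v hv hr).symm)]
  · rw [pairWeight, hvt, hvt, h.w, h.n, I.word_adj, if_neg (hnadj _ _ hde)]

end SieveData.Represents

/-! ### The sieve as a polynomial in the random numbers -/

namespace SieveData

variable (D : SieveData)

open MvPolynomial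

/-- The variable with number `i`. -/
noncomputable def var (i : ℕ) : MvPolynomial (Fin (2 * D.N * D.N)) (ZMod D.p) :=
  if h : i < 2 * D.N * D.N then X ⟨i, h⟩ else 0

/-- The value of the sieve as a polynomial. -/
noncomputable def poly : MvPolynomial (Fin (2 * D.N * D.N)) (ZMod D.p) :=
  sieveSum (fun r c : Fin D.N => D.rowWeight r c) (fun r c (d : Fin D.k) => D.shareWeight r c d)
    (fun d e => D.pairWeight d e) (fun r c => D.var (r * D.N + c))
    (fun d c => D.var ((D.N + d) * D.N + c))

theorem totalDegree_var_le [Fact D.p.Prime] (i : ℕ) : (D.var i).totalDegree ≤ 1 := by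
  unfold var; split_ifs <;> simp [totalDegree_X]

theorem totalDegree_poly_le [Fact D.p.Prime] : D.poly.totalDegree ≤ D.N * (1 + D.k) := by
  simpa [poly] using totalDegree_sieveSum_le _ _ _ _ _ (fun r c : Fin D.N => D.totalDegree_var_le _)
    (fun (d : Fin D.k) c => D.totalDegree_var_le _)

/-- As `D.k ≤ D.N`, all indices in use are below `2 * D.N * D.N`, where `var` is a genuine variable
and not its default `0`. -/
theorem eval_poly (hk : D.k ≤ D.N) (a : Fin (2 * D.N * D.N) → ZMod D.p) (b : ℕ → ZMod D.p)
    (hab : ∀ i, a i = b i) : eval a D.poly =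
      sieveSum (fun r c : Fin D.N => D.rowWeight r c)
        (fun r c (d : Fin D.k) => D.shareWeight r c d) (fun d e => D.pairWeight d e)
        (fun r c => b (r * D.N + c)) (fun d c => b ((D.N + d) * D.N + c)) := by
  have hvar : ∀ i < 2 * D.N * D.N, eval a (D.var i) = b i := by
    intro i hi
    rw [var, dif_pos hi, eval_X, hab]
  have hlt : ∀ r c, r < 2 * D.N → c < D.N → r * D.N + c < 2 * D.N * D.N := by
    intro r c hr hc
    calc r * D.N + c < r * D.N + D.N := by omega
      _ = (r + 1) * D.N := by ring
      _ ≤ 2 * D.N * D.N := Nat.mul_le_mul_right _ hr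
  rw [poly, map_sieveSum]
  congr 1
  · funext r c; exact hvar _ (hlt _ _ (by omega) c.2)
  · funext d c; exact hvar _ (hlt _ _ (by omega) c.2)

theorem poly_ne_zero [Fact D.p.Prime] {I : LCCMInstance} (h : D.Represents I) (hk : D.k ≤ D.N)
    (hI : I.HasProperListColoring) : D.poly ≠ 0 := by
  obtain ⟨σ, g, ht, hu, hh⟩ := h.exists_perm hI
  obtain ⟨x, z, hxz⟩ := exists_sieveSum_ne_zero (R := ZMod D.p)
    (t := fun r c : Fin D.N => D.rowWeight r c)
    (u := fun r c (d : Fin D.k) => D.shareWeight r c d) (h := fun d e => D.pairWeight d e)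
    σ g ht hu hh
  intro h0
  apply hxz
  have hN : ∀ c : Fin D.N, 0 < D.N := fun c => c.pos
  -- Decodes a row-major index: quotients below `D.N` address `x`, the next `D.k` quotients address
  -- `z`.
  let b : ℕ → ZMod D.p := fun i => if hN : 0 < D.N then
    if h1 : i / D.N < D.N then x ⟨i / D.N, h1⟩ ⟨i % D.N, Nat.mod_lt _ hN⟩
    else if h2 : i / D.N - D.N < D.k then z ⟨i / D.N - D.N, h2⟩ ⟨i % D.N, Nat.mod_lt _ hN⟩ else 0
    else 0
  have hdiv : ∀ r (c : Fin D.N), (r * D.N + c) / D.N = r := fun r c => by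
    rw [mul_comm, Nat.mul_add_div (hN c), Nat.div_eq_of_lt c.2, add_zero]
  have hmod : ∀ r (c : Fin D.N), (r * D.N + c) % D.N = c := fun r c => by
    rw [mul_comm, Nat.mul_add_mod, Nat.mod_eq_of_lt c.2]
  have := D.eval_poly hk (fun i => b i) b fun _ => rfl
  rw [h0, map_zero] at this
  rw [this]
  congr 1
  · funext r c
    simp only [b, dif_pos (hN c), hdiv, hmod, dif_pos r.2]
  · funext d c
    simp only [b, dif_pos (hN c), hdiv, hmod, Nat.add_sub_cancel_left, dif_pos d.2]
    rw [dif_neg (by omega)]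

end SieveData

/-! ## The complete program -/

/-- The program does not flip coins. -/
def Prog.noFlip : Prog → Bool
  | .flip _ => false
  | .seq p q => p.noFlip && q.noFlip
  | .ite _ p q => p.noFlip && q.noFlip
  | .while _ p => p.noFlip
  | _ => true

/-- The state with another sequence of coin flips to come. -/
def State.withCoins (s : State) (ω : ℕ → Bool) : State := { s with coins := ω }

theorem Expr.eval_withCoins (s : State) (ω : ℕ → Bool) (e : Expr) :
    e.eval (s.withCoins ω) = e.eval s := by
  induction e with
  | lit => rfl
  | reg => rfl
  | get a e ih => simp only [Expr.eval, ih]; rfl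
  | bin o e₁ e₂ h₁ h₂ => simp only [Expr.eval, h₁, h₂]

theorem Expr.cost_withCoins (s : State) (ω : ℕ → Bool) (e : Expr) :
    e.cost (s.withCoins ω) = e.cost s := by
  induction e with
  | lit => rfl
  | reg => rfl
  | get a e ih => simp only [Expr.cost, ih, eval_withCoins]; rfl
  | bin o e₁ e₂ h₁ h₂ => simp only [Expr.cost, h₁, h₂, eval_withCoins]

theorem Exec.withCoins {p : Prog} {s s' : State} {t : ℕ} (h : Exec p s t s')
    (hp : p.noFlip = true) (ω : ℕ → Bool) : Exec p (s.withCoins ω) t (s'.withCoins ω) := by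
  induction h with
  | skip s => exact .skip _
  | set s x e =>
    have := Exec.set (s.withCoins ω) x e
    rwa [Expr.eval_withCoins, Expr.cost_withCoins] at this
  | put s a i e =>
    have := Exec.put (s.withCoins ω) a i e
    rwa [Expr.eval_withCoins, Expr.cost_withCoins, Expr.eval_withCoins, Expr.cost_withCoins] at this
  | flip s x => simp [Prog.noFlip] at hp
  | seq _ _ h h' =>
    simp only [Prog.noFlip, Bool.and_eq_true] at hp
    exact .seq (h hp.1) (h' hp.2)
  | ite_true he _ h =>
    simp only [Prog.noFlip, Bool.and_eq_true] at hp
    rw [← Expr.cost_withCoins _ ω]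
    exact .ite_true (by rwa [Expr.eval_withCoins]) (h hp.1)
  | ite_false he _ h =>
    simp only [Prog.noFlip, Bool.and_eq_true] at hp
    rw [← Expr.cost_withCoins _ ω]
    exact .ite_false (by rwa [Expr.eval_withCoins]) (h hp.2)
  | while_true he _ _ h h' =>
    rw [← Expr.cost_withCoins _ ω]
    exact .while_true (by rwa [Expr.eval_withCoins]) (h hp) (h' hp)
  | while_false he =>
    rw [← Expr.cost_withCoins _ ω]
    exact .while_false (by rwa [Expr.eval_withCoins])

/-- A program without flips reaches the same memory for all coin sequences, so the data it prepares
can be chosen before `ω`. -/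
theorem Does.exists_withCoins {M : ℕ} {β : ℕ → ℕ} {p : Prog} {s : State} {Q : State → Prop}
    (h : Does M β p s Q) (hs : s.Bdd M) (hp : p.noFlip = true) :
    ∃ s', Q s' ∧ ∀ ω, Does M β p (s.withCoins ω) fun s'' => s'' = s'.withCoins ω := by
  obtain ⟨t, s', he, ht, hb, hQ⟩ := h hs
  exact ⟨s', hQ, fun ω _ => ⟨t, _, he.withCoins hp ω, ht, ⟨hb.reg, hb.arr⟩, rfl⟩⟩

/-- The part of the program before the first coin flip. -/
def prepareProg (E : ℕ) : Prog :=
  .seq (.set 7 (.lit 2 * .reg 0 * .reg 0)) (.seq (.set 36 (.lit E * (.reg 0 * (.reg 0 + .lit 1))))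
    (.seq powerStep (.seq primeStep (.seq modulatorStep listStep))))

/-- The program for list coloring, with error probability at most `1 / E`. -/
def listColoringProg (E : ℕ) : Prog :=
  .seq (prepareProg E) (.seq randomStep (.seq sieveProg (.set 0 ((Expr.lit 0).less (.reg 8)))))

/-- The bound on the polynomially long loops. -/
def loopBound (E N : ℕ) : ℕ := 4 * (E * (N * (N + 1)))

/-- The bounds on the lengths of the loops with bound register `b`. -/
def loopBounds (E N k : ℕ) : ℕ → ℕ := fun b => if b == 3 then 2 ^ k else loopBound E N

/-- The bound on the numbers stored by the program. -/
def numberBound (E : ℕ) (W : List ℕ) : ℕ := 2 ^ inputSize W + loopBound E W.length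

theorem bdd_initState (E : ℕ) (hE : 0 < E) (W : List ℕ) (ω : ℕ → Bool) :
    (initState W ω).Bdd (numberBound E W) where
  reg := fun x => by
    by_cases hx : x = 0
    · subst hx
      simp only [initState, Function.update_self, numberBound, loopBound]
      have := Nat.le_mul_of_pos_left (W.length * (W.length + 1)) hE
      nlinarith [Nat.zero_le (2 ^ inputSize W)]
    · simp [initState, hx]
  arr := fun a i => by
    by_cases ha : a = 0
    · subst ha
      simp only [initState, Function.update_self, numberBound]
      exact (LCCMInstance.getD_lt_two_pow_inputSize W i).le.trans (Nat.le_add_right _ _)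
    · simp [initState, ha]

theorem does_prepareProg (E : ℕ) (hE : 0 < E) (I : LCCMInstance) (ω : ℕ → Bool) :
    Does (numberBound E I.encode) (loopBounds E I.encode.length I.param) (prepareProg E)
      (initState I.encode ω) fun s => ∃ (D : SieveData) (b : ℕ), D.Represents I ∧ D.p.Prime ∧
        E * (D.N * (D.N + 1)) ≤ 2 ^ b ∧ 2 ^ b ≤ D.p ∧ D.p ≤ loopBound E D.N ∧
        s.reg 5 = b ∧ s.reg 7 = 2 * D.N * D.N ∧ D.Ready s := by
  set W := I.encode with hW
  set N := W.length with hN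
  set M := numberBound E W
  set β := loopBounds E N I.param
  have hnN : I.n < N := I.n_lt_length
  have hN0 : 0 < N := by omega
  set T := E * (N * (N + 1)) with hT
  have hTN : N * (N + 1) ≤ T := Nat.le_mul_of_pos_left _ hE
  have hNT : N ≤ T := by nlinarith
  have hT0 : 0 < T := by omega
  have hRT : 2 * N * N ≤ 4 * T := by nlinarith
  have hZ : loopBound E N = 4 * T := rfl
  have hM : 4 * T ≤ M := Nat.le_add_left _ _
  have hM2 : 2 ^ N ≤ M :=
    (Nat.pow_le_pow_right (by norm_num) (LCCMInstance.length_le_inputSize W)).trans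
      (Nat.le_add_right _ _)
  have hβ : ∀ x, x ≠ 3 → β x = 4 * T := fun x hx => by simp [β, loopBounds, hx, hZ]
  have i0 : (initState W ω).reg 0 = N := by simp [initState, hN]
  have ia0 : (initState W ω).arr 0 = I.word := by
    funext i; simp [initState, LCCMInstance.word, hW]
  have ia3 : ∀ i, (initState W ω).arr 3 i = 0 := by simp [initState]
  refine Does.set_seq (by simp [i0]; omega) (Does.set_seq ?_ ?_)
  · simp [i0]; omega
  simp only [Expr.eval_add, Expr.eval_mul, Expr.eval_lit, Expr.eval_reg, State.setReg_reg, i0,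
    OfNat.zero_ne_ofNat, if_false, ← hT]
  refine Does.seq (does_powerStep hT0 (by omega) (by rw [hβ _ (by decide)]; omega)
    (by simp)) fun s₁ hF₁ ⟨p1, p2, p3⟩ => ?_
  have a0 : s₁.reg 0 = N := (hF₁.reg 0 (by decide)).trans (by simp [i0])
  have a7 : s₁.reg 7 = 2 * N * N := (hF₁.reg 7 (by decide)).trans (by simp)
  have aa0 : s₁.arr 0 = I.word := (hF₁.arr 0 (by decide)).trans (by simp [ia0])
  have aa3 : ∀ i, s₁.arr 3 i = 0 := by rw [hF₁.arr 3 (by decide)]; simpa using ia3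
  refine Does.seq (does_primeStep (q := s₁.reg 4) (by omega) (by omega)
    (by rw [hβ _ (by decide)]; omega) (by rw [hβ _ (by decide)]; omega) rfl)
    fun s₂ hF₂ ⟨q1, q2, q3⟩ => ?_
  have b0 : s₂.reg 0 = N := (hF₂.reg 0 (by decide)).trans a0
  have b4 : s₂.reg 4 = s₁.reg 4 := hF₂.reg 4 (by decide)
  have b5 : s₂.reg 5 = s₁.reg 5 := hF₂.reg 5 (by decide)
  have b7 : s₂.reg 7 = 2 * N * N := (hF₂.reg 7 (by decide)).trans a7
  have ba0 : s₂.arr 0 = I.word := (hF₂.arr 0 (by decide)).trans aa0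
  have ba3 : ∀ i, s₂.arr 3 i = 0 := by rw [hF₂.arr 3 (by decide)]; exact aa3
  refine Does.seq (does_modulatorStep I.word_zero
    ((Nat.pow_le_pow_right (by norm_num) hnN.le).trans hM2)
    (by rw [hβ _ (by decide)]; omega) ba0) fun s₃ hF₃ ⟨m1, m2, m3, m4, m5, m6⟩ => ?_
  rw [I.card_modulator] at m2
  have c0 : s₃.reg 0 = N := (hF₃.reg 0 (by decide)).trans b0
  have c5 : s₃.reg 5 = s₁.reg 5 := (hF₃.reg 5 (by decide)).trans b5
  have c6 : s₃.reg 6 = s₂.reg 6 := hF₃.reg 6 (by decide)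
  have c7 : s₃.reg 7 = 2 * N * N := (hF₃.reg 7 (by decide)).trans b7
  have ca0 : s₃.arr 0 = I.word := (hF₃.arr 0 (by decide)).trans ba0
  have ca3 : ∀ i, s₃.arr 3 i = 0 := by rw [hF₃.arr 3 (by decide)]; exact ba3
  have hL : ListLayout I.word I.n N I.listPos := I.listLayout
  refine (does_listStep hL hN0 (by omega) (by rw [hβ _ (by decide)]; omega)
    (by rw [hβ _ (by decide)]; omega) (by rw [hβ _ (by decide)]; omega) ca0 c0 m1 ca3).mono
    fun s₄ hF₄ l => ?_
  have d0 : s₄.reg 0 = N := (hF₄.reg 0 (by decide)).trans c0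
  have d1 : s₄.reg 1 = I.n := (hF₄.reg 1 (by decide)).trans m1
  have d2 : s₄.reg 2 = s₃.reg 2 := hF₄.reg 2 (by decide)
  have d3 : s₄.reg 3 = s₃.reg 3 := hF₄.reg 3 (by decide)
  have d5 : s₄.reg 5 = s₁.reg 5 := (hF₄.reg 5 (by decide)).trans c5
  have d6 : s₄.reg 6 = s₂.reg 6 := (hF₄.reg 6 (by decide)).trans c6
  have d7 : s₄.reg 7 = 2 * N * N := (hF₄.reg 7 (by decide)).trans c7
  have da0 : s₄.arr 0 = I.word := (hF₄.arr 0 (by decide)).trans ca0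
  have da1 : s₄.arr 1 = s₃.arr 1 := hF₄.arr 1 (by decide)
  have da2 : s₄.arr 2 = s₃.arr 2 := hF₄.arr 2 (by decide)
  rw [m2] at m3 m4 m5 m6
  refine ⟨⟨N, I.n, I.param, s₂.reg 6, I.word, s₃.arr 1, s₄.arr 3, s₄.arr 4⟩, s₁.reg 5,
    ⟨rfl, rfl, rfl, rfl, m5, m6, l⟩, q1, by rw [← p1]; exact p2, by rw [← p1]; exact q2.le,
    ?_, d5, d7, ⟨d0, d1, d2.trans m2, d3.trans m3, d6, da0, da1, ?_, rfl, rfl⟩⟩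
  · change s₂.reg 6 ≤ loopBound E N
    omega
  · rw [da2]; exact m4

/-- `D` and `b` precede the quantifier over `ω`: Schwartz–Zippel needs one fixed polynomial for all
coin outcomes. `D.poly` does not involve `D.rnd`. -/
theorem does_listColoringProg (E : ℕ) (hE : 0 < E) (I : LCCMInstance) :
    ∃ (D : SieveData) (b : ℕ), D.Represents I ∧ D.p.Prime ∧
      E * (D.N * (D.N + 1)) ≤ 2 ^ b ∧ 2 ^ b ≤ D.p ∧ ∀ ω,
      Does (numberBound E I.encode) (loopBounds E I.encode.length I.param) (listColoringProg E)
      (initState I.encode ω) fun s => s.reg 0 = 1 ↔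
        MvPolynomial.eval (fun j : Fin (2 * D.N * D.N) => (bitsValue ω (j * b) b : ZMod D.p)) D.poly ≠ 0 := by
  obtain ⟨s₁, ⟨D, b, hR, hp, hb, hbp, hpZ, r5, r7, hD⟩, hs₁⟩ :=
    (does_prepareProg E hE I fun _ => false).exists_withCoins (bdd_initState E hE _ _) rfl
  refine ⟨D, b, hR, hp, hb, hbp, fun ω => ?_⟩
  set W := I.encode with hW
  set M := numberBound E W with hMdef
  set β := loopBounds E W.length I.param with hβdef
  have hN : D.N = W.length := hR.N
  have hkN : D.k ≤ D.N := by
    rw [hR.k, hN]; exact I.param_le.trans I.n_lt_length.le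
  have hN0 : 0 < D.N := by rw [hN]; exact (Nat.zero_le _).trans_lt I.n_lt_length
  have hβ : ∀ x, x ≠ 3 → β x = loopBound E D.N := fun x hx => by
    simp [hβdef, loopBounds, hx, hN]
  have hM : loopBound E D.N ≤ M := by rw [hN]; exact Nat.le_add_left _ _
  have hNZ : 2 * D.N * D.N ≤ loopBound E D.N := by
    have : D.N * (D.N + 1) ≤ E * (D.N * (D.N + 1)) := Nat.le_mul_of_pos_left _ hE
    unfold loopBound; nlinarith
  have hNZ' : D.N ≤ loopBound E D.N := by nlinarith
  have hb' : b < 2 ^ b := Nat.lt_two_pow_self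
  refine Does.seq (hs₁ ω) fun s hF hs => ?_
  subst hs
  refine Does.seq (does_randomStep (b := b) (m := 2 * D.N * D.N) (by omega)
    (by rw [hβ _ (by decide)]; exact hNZ) (by rw [hβ _ (by decide)]; omega) r5 r7)
    fun s₂ hF₂ h₂ => ?_
  -- The same data with the random numbers of this run; the weights are unchanged.
  let D₂ : SieveData := { D with rnd := s₂.arr 4 }
  have hD₂ : D₂.Ready s₂ := by
    refine ⟨(hF₂.reg 0 (by decide)).trans hD.r0, (hF₂.reg 1 (by decide)).trans hD.r1,
      (hF₂.reg 2 (by decide)).trans hD.r2, (hF₂.reg 3 (by decide)).trans hD.r3,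
      (hF₂.reg 6 (by decide)).trans hD.r6, (hF₂.arr 0 (by decide)).trans hD.a0,
      (hF₂.arr 1 (by decide)).trans hD.a1, ?_, (hF₂.arr 3 (by decide)).trans hD.a3, rfl⟩
    rw [hF₂.arr 2 (by decide)]
    exact hD.a2
  have hfit : D₂.Fits M β := by
    refine ⟨hpZ.trans hM, ?_, ?_, ?_, ?_⟩
    · rw [hβ _ (by decide)]; exact hNZ'
    · rw [hβ _ (by decide)]; exact hkN.trans hNZ'
    · change 2 ^ D.k ≤ β 3
      simp [hβdef, loopBounds, hR.k]
    · rw [hβ _ (by decide)]; exact hpZ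
  refine Does.seq (does_sieveProg hfit hp (by omega) hD₂) fun s₃ _ ⟨h31, h32⟩ => ?_
  have hval : D₂.value =
      MvPolynomial.eval (fun j : Fin (2 * D.N * D.N) => (bitsValue ω (j * b) b : ZMod D.p)) D.poly := by
    refine (D.eval_poly hkN _ (fun i => (s₂.arr 4 i : ZMod D.p)) fun i => ?_).symm
    rw [h₂ i i.2]
    rfl
  rw [← hval, ← h32]
  have h31' : s₃.reg 8 < D.p := h31
  have hev : ((Expr.lit 0).less (.reg 8)).eval s₃ = if s₃.reg 8 = 0 then 0 else 1 := by
    by_cases h0 : s₃.reg 8 = 0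
    · simp [h0]
    · simp [h0, Nat.pos_of_ne_zero h0]
  refine Does.set ?_ ?_
  · rw [hev]; split_ifs <;> omega
  · rw [hev, State.setReg_reg, if_pos rfl, ne_eq, ZMod.natCast_eq_zero_iff]
    split_ifs with h0
    · simp [h0]
    · refine iff_of_true rfl fun hdvd => ?_
      exact absurd (Nat.le_of_dvd (Nat.pos_of_ne_zero h0) hdvd) (Nat.not_le.mpr h31')

/-! ## Running time -/

theorem numberBound_size_le (E : ℕ) (W : List ℕ) :
    (numberBound E W).size ≤ inputSize W + loopBound E W.length + 1 := by
  rw [Nat.size_le, numberBound, pow_succ, pow_add]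
  have h1 : loopBound E W.length < 2 ^ loopBound E W.length := Nat.lt_two_pow_self
  have h2 : 1 ≤ 2 ^ inputSize W := Nat.one_le_two_pow
  nlinarith

theorem loopBound_le (E : ℕ) (W : List ℕ) (hW : 0 < W.length) :
    loopBound E W.length ≤ 8 * E * inputSize W ^ 2 := by
  have h := LCCMInstance.length_le_inputSize W
  have h1 : W.length * (W.length + 1) ≤ 2 * inputSize W ^ 2 := by nlinarith
  calc loopBound E W.length ≤ 4 * (E * (2 * inputSize W ^ 2)) :=
        Nat.mul_le_mul_left _ (Nat.mul_le_mul_left _ h1)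
    _ = _ := by ring

/-- For `k ≥ 4` the base is compared directly; for smaller `k` the constant `256 = 4 ^ 4` absorbs
the left side. At `k = 0` the exponent on the right is `0`. -/
theorem four_pow_le (k : ℕ) :
    (4 : ℝ) ^ k ≤ 256 * (2 : ℝ) ^ ((k : ℝ) * Real.logb 2 (k : ℝ)) := by
  rcases Nat.eq_zero_or_pos k with rfl | hk
  · norm_num
  have hk' : (0 : ℝ) < k := by exact_mod_cast hk
  have h : (2 : ℝ) ^ ((k : ℝ) * Real.logb 2 (k : ℝ)) = (k : ℝ) ^ k := by
    rw [mul_comm, Real.rpow_mul (by norm_num), Real.rpow_logb (by norm_num) (by norm_num) hk',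
      Real.rpow_natCast]
  rw [h]
  have h1 : (1 : ℝ) ≤ (k : ℝ) ^ k := one_le_pow₀ (by exact_mod_cast hk)
  rcases le_or_gt 4 k with h4 | h4
  · have : (4 : ℝ) ^ k ≤ (k : ℝ) ^ k := pow_le_pow_left₀ (by norm_num) (by exact_mod_cast h4) k
    linarith
  · have : (4 : ℝ) ^ k ≤ 4 ^ 4 := pow_le_pow_right₀ (by norm_num) h4.le
    norm_num at this
    linarith

/-- The constant factor in the running time. -/
def timeFactor (E : ℕ) : ℕ :=
  256 * (listColoringProg E).stepBound (fun _ => 1) * (8 * E) ^ 4 * (11 * E) ^ 2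

theorem listColoringProg_time (E : ℕ) (hE : 0 < E) (I : LCCMInstance) :
    (((listColoringProg E).stepBound (loopBounds E I.encode.length I.param) *
      ((numberBound E I.encode).size + 1) ^ 2 : ℕ) : ℝ) ≤
    timeFactor E * (2 : ℝ) ^ ((I.param : ℝ) * Real.logb 2 (I.param : ℝ)) *
      (inputSize I.encode : ℝ) ^ 12 := by
  set W := I.encode with hW
  set S := inputSize W with hS
  set Z := loopBound E W.length with hZ
  set k := I.param with hk
  have hlen : 0 < W.length := (Nat.zero_le _).trans_lt I.n_lt_length
  have hS0 : 0 < S := hlen.trans_le (LCCMInstance.length_le_inputSize W)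
  have hZS : Z ≤ 8 * E * S ^ 2 := loopBound_le E W hlen
  have hZ1 : 1 ≤ Z := by
    have : 0 < Z := by simp only [hZ, loopBound]; positivity
    exact this
  have h1 := Prog.stepBound_le (fun b => b == 3) (2 ^ k) Z Nat.one_le_two_pow hZ1
    (listColoringProg E)
  -- The two nested loops over `2 ^ k` values run through `S` and `J`.
  have hd1 : (listColoringProg E).depth (fun b => b == 3) = 2 := rfl
  -- The deepest polynomial nesting consists of row, column and two modulator vertices `d`, `e`.
  have hd2 : (listColoringProg E).depth (fun b => !(b == 3)) = 4 := rfl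
  rw [hd1, hd2] at h1
  -- The sum `S + 8 * E * S ^ 2 + 2` is at most `(1 + 8 + 2) * E * S ^ 2`.
  have h2 : (numberBound E W).size + 1 ≤ 11 * E * S ^ 2 := by
    have h3 := numberBound_size_le E W
    have h4 : S ≤ S ^ 2 := Nat.le_self_pow (by norm_num) _
    have h5 : S ^ 2 ≤ E * S ^ 2 := Nat.le_mul_of_pos_left _ hE
    have h6 : 1 ≤ S ^ 2 := Nat.one_le_pow _ _ hS0
    nlinarith
  have h3 : (listColoringProg E).stepBound (loopBounds E W.length k) *
      ((numberBound E W).size + 1) ^ 2 ≤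
      ((listColoringProg E).stepBound (fun _ => 1) * ((2 ^ k) ^ 2 * (8 * E * S ^ 2) ^ 4)) *
        (11 * E * S ^ 2) ^ 2 := by
    refine Nat.mul_le_mul (h1.trans ?_) (Nat.pow_le_pow_left h2 2)
    exact Nat.mul_le_mul_left _ (Nat.mul_le_mul_left _ (Nat.pow_le_pow_left hZS 4))
  have h4 : ((2 : ℝ) ^ k) ^ 2 ≤ 256 * (2 : ℝ) ^ ((k : ℝ) * Real.logb 2 (k : ℝ)) := by
    refine le_trans (le_of_eq ?_) (four_pow_le k)
    rw [← pow_mul, mul_comm, pow_mul]; norm_num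
  set C := (listColoringProg E).stepBound (fun _ => 1)
  have h5 : 0 ≤ (C : ℝ) * (8 * E * (S : ℝ) ^ 2) ^ 4 * (11 * E * (S : ℝ) ^ 2) ^ 2 := by positivity
  calc (((listColoringProg E).stepBound (loopBounds E W.length k) *
        ((numberBound E W).size + 1) ^ 2 : ℕ) : ℝ)
      ≤ ((C * ((2 ^ k) ^ 2 * (8 * E * S ^ 2) ^ 4) * (11 * E * S ^ 2) ^ 2 : ℕ) : ℝ) := by
        exact_mod_cast h3
    _ = ((2 : ℝ) ^ k) ^ 2 * (C * (8 * E * (S : ℝ) ^ 2) ^ 4 * (11 * E * (S : ℝ) ^ 2) ^ 2) := by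
        push_cast; ring
    _ ≤ (256 * (2 : ℝ) ^ ((k : ℝ) * Real.logb 2 (k : ℝ))) *
        (C * (8 * E * (S : ℝ) ^ 2) ^ 4 * (11 * E * (S : ℝ) ^ 2) ^ 2) :=
        mul_le_mul_of_nonneg_right h4 h5
    _ = _ := by simp only [timeFactor]; push_cast; ring

end RAM

/-! ### The main theorem -/

open RAM in
theorem mainTheorem8 (ε : ℝ) (hε : 0 < ε) :
    ∃ (p : RAM.Prog) (A c : ℕ), ∀ I : LCCMInstance,
      (∀ ω : ℕ → Bool, RAM.HaltsWithin p I.encode ω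
        (A * (2 : ℝ) ^ ((I.param : ℝ) * Real.logb 2 (I.param : ℝ)) *
          (RAM.inputSize I.encode : ℝ) ^ c)) ∧
      (I.HasProperListColoring →
        1 - ε ≤ RAM.coinMeasure.real {ω | RAM.Accepts p I.encode ω}) ∧
      (¬ I.HasProperListColoring → ∀ ω : ℕ → Bool, ¬ RAM.Accepts p I.encode ω) := by
  obtain ⟨E, hE⟩ := exists_nat_gt (1 / ε)
  have hE0 : 0 < E := by
    have : (0 : ℝ) < E := (one_div_pos.mpr hε).trans hE
    exact_mod_cast this
  refine ⟨listColoringProg E, timeFactor E, 12, fun I => ?_⟩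
  obtain ⟨D, b, hR, hp, hb, hbp, hdoes⟩ := does_listColoringProg E hE0 I
  have : Fact D.p.Prime := ⟨hp⟩
  have hkN : D.k ≤ D.N := by
    rw [hR.k, hR.N]; exact I.param_le.trans I.n_lt_length.le
  have hacc : ∀ ω, Accepts (listColoringProg E) I.encode ω ↔
      MvPolynomial.eval (fun j : Fin (2 * D.N * D.N) => (bitsValue ω (j * b) b : ZMod D.p)) D.poly ≠ 0 := by
    intro ω
    obtain ⟨t, s, he, -, -, hs⟩ := hdoes ω (bdd_initState E hE0 _ _)
    rw [← hs]
    constructor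
    · rintro ⟨t', s', he', h1⟩
      rwa [(he.unique he').2]
    · exact fun h => ⟨t, s, he, h⟩
  refine ⟨fun ω => ?_, fun hI => ?_, fun hI ω hω => ?_⟩
  · obtain ⟨t, s, he, ht, -, -⟩ := hdoes ω (bdd_initState E hE0 _ _)
    exact ⟨t, s, he, (Nat.cast_le.mpr ht).trans (listColoringProg_time E hE0 I)⟩
  · have hF := D.poly_ne_zero hR hkN hI
    have hprob := coinMeasure_eval_eq_zero_le hbp hF
    set B := {ω : ℕ → Bool |
      MvPolynomial.eval (fun j : Fin (2 * D.N * D.N) => (bitsValue ω (j * b) b : ZMod D.p)) D.poly = 0} with hB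
    -- Covering the whole space and using subadditivity gives the lower bound on the acceptance
    -- probability without any measurability argument.
    have hcover : (Set.univ : Set (ℕ → Bool)) ⊆
        {ω | Accepts (listColoringProg E) I.encode ω} ∪ B := by
      intro ω _
      by_cases h : ω ∈ B
      · exact .inr h
      · exact .inl ((hacc ω).mpr h)
    have h1 : (1 : ℝ) ≤ coinMeasure.real {ω | Accepts (listColoringProg E) I.encode ω} +
        coinMeasure.real B := by
      calc (1 : ℝ) = coinMeasure.real Set.univ := by simp
        _ ≤ _ := (measureReal_mono hcover (measure_ne_top _ _)).trans (measureReal_union_le _ _)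
    have hdeg : (D.poly.totalDegree : ℝ) ≤ D.N * (D.N + 1) := by
      have := D.totalDegree_poly_le.trans (Nat.mul_le_mul_left D.N (show 1 + D.k ≤ D.N + 1 by omega))
      exact_mod_cast this
    have hb' : (E : ℝ) * (D.N * (D.N + 1)) ≤ 2 ^ b := by exact_mod_cast hb
    -- The degree is at most `N * (N + 1)`, the grid size at least `E` times that, and `1 / E < ε`.
    have hsmall : (D.poly.totalDegree : ℝ) / 2 ^ b ≤ ε := by
      rw [div_le_iff₀ (by positivity)]
      have h2 : 1 ≤ ε * E := by
        rw [div_lt_iff₀ hε] at hE; linarith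
      have h3 : (0 : ℝ) ≤ D.N * (D.N + 1) := by positivity
      calc (D.poly.totalDegree : ℝ) ≤ D.N * (D.N + 1) := hdeg
        _ ≤ (ε * E) * (D.N * (D.N + 1)) := le_mul_of_one_le_left h3 h2
        _ = ε * (E * (D.N * (D.N + 1))) := by ring
        _ ≤ ε * 2 ^ b := mul_le_mul_of_nonneg_left hb' hε.le
    linarith
  · have hne := (hacc ω).mp hω
    -- Acceptance means that the sieve is nonzero at this very point, and a nonzero value already
    -- yields a coloring; no probability is involved.
    rw [D.eval_poly hkN _ (fun i => (bitsValue ω (i * b) b : ZMod D.p)) fun _ => rfl] at hne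
    obtain ⟨σ, g, ht, hu, hh⟩ := exists_of_sieveSum_ne_zero hne
    exact hI (hR.hasProperListColoring σ g ht hu hh)
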